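/- For $a\in\mathbb C\setminus\{0\}$ let $R_a(z)=\dfrac{a}{z^2+2z}$, a rational map of $\hat{\mathbb C}$ with the superattracting cycle $\infty\mapsto 0\mapsto\infty$, and let $A_\infty^a$ be its immediate basin at $\infty$, that is, the connected component containing $\infty$ of $\{z : R_a^{2n}(z)\to\infty\}$. Let $P_\infty$ be the set of $a\neq0$ for which the critical value $-a=R_a(-1)$ lies in $A_\infty^a$. Let $\Phi_a$ be the Böttcher coordinate of $R_a$ at $\infty$, i.e. the conformal map near $\infty$ with $\Phi_a(\infty)=\infty$, $\Phi_a\circ R_a^{2}=\Phi_a^2$ and $\Phi_a'(\infty)>0$ (meaning $\lim_{z\to\infty}\Phi_a(z)/z>0$), extended to regions of $A_\infty^a$ that it maps conformally onto $\{|w|>r\}\cup\{\infty\}$, $r\ge1$. Then: 1. The complement $\mathbb C\setminus P_\infty$ is compact, and $P_\infty\cup\{\infty\}\subset\hat{\mathbb C}$ is simply connected. 2. $\mathbb C\setminus P_\infty$ has logarithmic capacity $2$, where the logarithmic capacity of a compact set $K\subset\mathbb C$ is $\sup_\mu\exp\bigl(-\iint\log\frac1{|z-w|}\,d\mu(z)\,d\mu(w)\bigr)$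 over Borel probability measures $\mu$ on $K$. 3. For every $a\in P_\infty$ the value $\Phi_a(-a)$ is well defined, and $a\mapsto\Phi_a(-a)$ is holomorphic on $P_\infty$, takes every value in $\{w\in\mathbb C:|w|>1\}$ exactly once, and satisfies $\Phi_a(-a)/a\to-\tfrac12$ as $a\to\infty$ (so it has a simple pole at $\infty$). -/

import Mathlib

open Filter Topology MeasureTheory Set OnePoint

noncomputable section

namespace BasilicaFamily

/-- The quadratic rational map `R_a(z) = a / (z² + 2z)` on the Riemann sphere `ℂ ∪ {∞}`
(used for `a ≠ 0`): the zeros `0, -2` of the denominator go to `∞`, and `∞` goes to `0`. -/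
def ratMap (a : ℂ) : OnePoint ℂ → OnePoint ℂ
  | ∞ => ((0 : ℂ) : OnePoint ℂ)
  | (z : ℂ) => if z ^ 2 + 2 * z = 0 then ∞ else ((a / (z ^ 2 + 2 * z) : ℂ) : OnePoint ℂ)

/-- The basin of the point `∞`, a superattracting fixed point of `R_a²`
(`∞ ↦ 0 ↦ ∞` is a superattracting cycle of period two of `R_a`). -/
def basin (a : ℂ) : Set (OnePoint ℂ) :=
  {z | Tendsto (fun n : ℕ => (ratMap a)^[2 * n] z) atTop (𝓝 ∞)}

/-- The immediate basin `A_∞` of `R_a` at `∞`: the connected component of the basin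
that contains `∞`. -/
def immediateBasin (a : ℂ) : Set (OnePoint ℂ) :=
  connectedComponentIn (basin a) ∞

/-- The exterior capture component `P_∞`: the parameters `a ≠ 0` for which the free critical
value `-a = R_a(-1)` lies in the immediate basin of `∞`. -/
def exteriorComponent : Set ℂ :=
  {a | a ≠ 0 ∧ ((-a : ℂ) : OnePoint ℂ) ∈ immediateBasin a}

/-- `Φ` on `U ∪ {∞}` is the normalized Böttcher coordinate of `R_a` at `∞`, continued to the
region `U ∪ {∞}` of the immediate basin that it maps conformally onto `{|w| > r} ∪ {∞}`:
it conjugates the second iterate of `R_a` to `w ↦ w²`, fixes `∞`, and has a positive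
derivative there. -/
structure IsBottcher (a : ℂ) (r : ℝ) (U : Set ℂ) (Φ : ℂ → ℂ) : Prop where
  one_le : 1 ≤ r
  isOpen : IsOpen U
  nhds_infty : ∀ᶠ z in Bornology.cobounded ℂ, z ∈ U
  subset_basin : ∀ z ∈ U, (z : OnePoint ℂ) ∈ immediateBasin a
  holomorphic : DifferentiableOn ℂ Φ U
  bijOn : BijOn Φ U {w | r < ‖w‖}
  conj : ∀ z ∈ U, ∃ z' ∈ U, (ratMap a)^[2] (z : OnePoint ℂ) = (z' : OnePoint ℂ) ∧
    Φ z' = Φ z ^ 2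
  normalized : ∃ c : ℝ, 0 < c ∧
    Tendsto (fun z => Φ z / z) (Bornology.cobounded ℂ) (𝓝 (c : ℂ))

/-- `w` is the value `Φ_a(z)` of the Böttcher coordinate of `R_a` at the point `z`. -/
def IsBottcherValue (a z w : ℂ) : Prop :=
  ∃ (r : ℝ) (U : Set ℂ) (Φ : ℂ → ℂ), IsBottcher a r U Φ ∧ z ∈ U ∧ Φ z = w

/-- The logarithmic energy `∬ log (1 / |z - w|) dμ(z) dμ(w)`, as the integral of the positive
part minus the integral of the negative part; the kernel is `+∞` on the diagonal. -/
def logEnergy (μ : Measure ℂ) : EReal :=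
  ((∫⁻ z, ∫⁻ w, (-ENNReal.log (edist z w)).toENNReal ∂μ ∂μ : ENNReal) : EReal) -
    ((∫⁻ z, ∫⁻ w, (ENNReal.log (edist z w)).toENNReal ∂μ ∂μ : ENNReal) : EReal)

/-- The logarithmic capacity of `K`: the supremum of `exp (-I(μ))`, where `I` is the logarithmic
energy and `μ` runs over the Borel probability measures with compact support in `K`. -/
def logCapacity (K : Set ℂ) : ENNReal :=
  ⨆ μ ∈ {μ : Measure ℂ | IsProbabilityMeasure μ ∧ ∃ C ⊆ K, IsCompact C ∧ μ Cᶜ = 0},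
    EReal.exp (-logEnergy μ)

end BasilicaFamily

end

noncomputable section

namespace BasilicaFamily

open Metric

/-! Dynamics. Put ζ = 1/z and u = 1/w, and seek the inverse Böttcher coordinate as g(u) = u/(Y(u) -
u), so that z + 1 = Y(u)/u. Because R_a(z) = a/((z+1)² - 1), solving R_a²(z(u)) = z(u²) for z(u)
costs exactly two square roots: with Z = Y(u²) - u², the first is S² = Z² + a u² Z, where S/Z =
R_a(z) + 1, and the second is Y² = Z + S + u². The data at u are thus determined by Y at u², and
pulling back along u ↦ u² gives existence, uniqueness, bounds that do not depend on the radius, and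
injectivity. The roots continue from radius r to √r unless the image of the r-disc contains -a (then
S vanishes) or R_a(-a) (then Y vanishes). If -a is in the basin of ∞ the second case is impossible,
since R_a maps that basin off itself. So for a ∈ P_∞ the continuation goes on until it meets -a, at
a point u = `critCoord a`; otherwise it would exhaust the immediate basin without meeting -a
(`exists_isInvBottcher_critical_value`).

Parameter plane. The function E(b) = `critCoord b⁻¹`, with E(0) = 0, maps the image of P_∞ ∪ {∞}
under inversion into the unit disc. It is holomorphic as a limit of 2ⁿ-th roots of iterates of the
critical value. The radius-free bounds give a·u → -2 at ∞, so E'(0) = -2, and 0 is the only zero.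
Since g exists up to radius √|u|, a definite distance beyond u, normal families show that E is
proper (`extCoord_proper`). A proper holomorphic map with a single simple zero is bijective
(`bijOn_of_proper`). This yields simple connectivity and, once 1/u is identified with Φ_a(-a)
(`isBottcherValue_iff`), the third assertion.

Capacity. Let ψ(c) = 1/E⁻¹(c) = -2/c + ⋯ and let ν_s be the image under ψ of the uniform measure on
|c| = s. The mean value property gives ν_s the potential log s - log 2 on the complement K of P_∞,
and energy at most that. The logarithmic kernel is conditionally positive definite, so I(μ) ≥ 2 I(μ,
ν_s) - I(ν_s) ≥ log s - log 2 for every probability measure μ on K; s → 1 gives I(μ) ≥ -log 2. A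
weak limit of ν_s as s → 1 lives on K and attains the bound, by lower semicontinuity of energy. -/

/-! ### Holomorphic functions on discs -/

/-- A zero-free holomorphic function on a disc has a holomorphic square root with prescribed
value at the centre. -/
theorem exists_sqrt_on_ball {f : ℂ → ℂ} {r : ℝ} (hr : 0 < r)
    (hf : DifferentiableOn ℂ f (ball 0 r)) (h0 : ∀ z ∈ ball (0 : ℂ) r, f z ≠ 0) {c : ℂ}
    (hc : c ^ 2 = f 0) :
    ∃ s : ℂ → ℂ, DifferentiableOn ℂ s (ball 0 r) ∧ (∀ z ∈ ball (0 : ℂ) r, s z ^ 2 = f z) ∧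
      s 0 = c := by
  have h00 : (0 : ℂ) ∈ ball (0 : ℂ) r := mem_ball_self hr
  have hd : DifferentiableOn ℂ (fun z => deriv f z / f z) (ball 0 r) :=
    (hf.deriv isOpen_ball).div hf h0
  obtain ⟨L, hL0, hL⟩ := (hd.isExactOn_ball).with_val_at 0 0
  have hconst : ∀ z ∈ ball (0 : ℂ) r, f z * Complex.exp (-L z) = f 0 := by
    intro z hz
    have key : ∀ z ∈ ball (0 : ℂ) r, HasDerivAt (fun z => f z * Complex.exp (-L z)) 0 z := by
      intro z hz
      have h1 := (hf.differentiableAt (isOpen_ball.mem_nhds hz)).hasDerivAt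
      have h2 := (hL z hz).neg.cexp
      have e : f z * (deriv f z / f z) = deriv f z := mul_div_cancel₀ _ (h0 z hz)
      refine (h1.mul h2).congr_deriv ?_
      linear_combination -Complex.exp (-L z) * e
    have := isOpen_ball.is_const_of_deriv_eq_zero (convex_ball (0 : ℂ) r).isPreconnected
      (fun z hz => (key z hz).differentiableAt.differentiableWithinAt)
      (fun z hz => (key z hz).deriv) hz h00
    simpa [hL0] using this
  refine ⟨fun z => c * Complex.exp (L z / 2), ?_, ?_, by simp [hL0]⟩
  · intro z hz
    exact (((hL z hz).div_const 2).cexp.const_mul c).differentiableAt.differentiableWithinAt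
  · intro z hz
    rw [mul_pow, hc, ← hconst z hz, ← Complex.exp_nat_mul, mul_assoc, ← Complex.exp_add]
    simp [mul_div_cancel₀]

/-- In f² - g² = (f - g)(f + g) the second factor is nonzero near the centre, so the identity
theorem applies. This selects the branch of every square root by its value at 0. -/
theorem eqOn_of_sq_eq_sq {f g : ℂ → ℂ} {r : ℝ} (hr : 0 < r)
    (hf : DifferentiableOn ℂ f (ball 0 r)) (hg : DifferentiableOn ℂ g (ball 0 r))
    (h : ∀ z ∈ ball (0 : ℂ) r, f z ^ 2 = g z ^ 2) (h0 : f 0 = g 0) (h1 : f 0 ≠ 0) :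
    EqOn f g (ball 0 r) := by
  have h00 : (0 : ℂ) ∈ ball (0 : ℂ) r := mem_ball_self hr
  have hnhds : ball (0 : ℂ) r ∈ 𝓝 (0 : ℂ) := isOpen_ball.mem_nhds h00
  have hcont : ContinuousAt (fun z => f z + g z) 0 :=
    (hf.differentiableAt hnhds).continuousAt.add (hg.differentiableAt hnhds).continuousAt
  have hne : ∀ᶠ z in 𝓝 (0 : ℂ), f z + g z ≠ 0 := by
    apply hcont.eventually_ne
    rw [← h0, ← two_mul]
    exact mul_ne_zero two_ne_zero h1
  apply (hf.analyticOnNhd isOpen_ball).eqOn_of_preconnected_of_eventuallyEq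
    (hg.analyticOnNhd isOpen_ball) (convex_ball (0 : ℂ) r).isPreconnected h00
  filter_upwards [hne, hnhds] with z hz hzb
  have : (f z + g z) * (f z - g z) = 0 := by linear_combination h z hzb
  exact sub_eq_zero.1 ((mul_eq_zero.1 this).resolve_left hz)

/-- A uniformly bounded sequence of holomorphic functions on a disc has a subsequence that
converges continuously to a holomorphic function. -/
theorem exists_subseq_continuous_limit {f : ℕ → ℂ → ℂ} {r M : ℝ} (hr : 0 < r)
    (hf : ∀ n, DifferentiableOn ℂ (f n) (ball 0 r))
    (hM : ∀ n, ∀ z ∈ ball (0 : ℂ) r, ‖f n z‖ ≤ M) :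
    ∃ φ : ℕ → ℕ, StrictMono φ ∧ ∃ g : ℂ → ℂ, DifferentiableOn ℂ g (ball 0 r) ∧
      ∀ (v : ℕ → ℂ) (z : ℂ), z ∈ ball (0 : ℂ) r → Tendsto v atTop (𝓝 z) →
        Tendsto (fun n => f (φ n) (v n)) atTop (𝓝 (g z)) := by
  -- Montel through Taylor coefficients: Cauchy's estimates place the coefficient sequences in a
  -- compact product of discs, and dominated convergence turns coefficientwise limits into limits of
  -- values, even along moving points.
  set c : ℕ → ℕ → ℂ := fun n k => (k.factorial : ℂ)⁻¹ * iteratedDeriv k (f n) 0 with hc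
  have hM0 : 0 ≤ M := (norm_nonneg _).trans (hM 0 0 (mem_ball_self hr))
  have hsum : ∀ n, ∀ z ∈ ball (0 : ℂ) r, ∑' k, c n k * z ^ k = f n z := by
    intro n z hz
    simpa [hc] using Complex.taylorSeries_eq_on_ball' hz (hf n)
  have hcb : ∀ n k, ‖c n k‖ ≤ M / r ^ k := by
    intro n k
    have h1 : ∀ s ∈ Ioo 0 r, ‖c n k‖ ≤ M / s ^ k := by
      intro s hs
      have := Complex.norm_iteratedDeriv_le_of_forall_mem_sphere_norm_le (c := 0) k hs.1
        (C := M) (f := f n) (((hf n).mono (closedBall_subset_ball hs.2)).diffContOnCl_ball subset_rfl)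
        (fun z hz => hM n z (by
          rw [mem_sphere_zero_iff_norm] at hz
          simpa [hz] using hs.2))
      have hk : (0 : ℝ) < k.factorial := by positivity
      simp only [hc, norm_mul, norm_inv, Complex.norm_natCast]
      calc (k.factorial : ℝ)⁻¹ * ‖iteratedDeriv k (f n) 0‖
          ≤ (k.factorial : ℝ)⁻¹ * (k.factorial * M / s ^ k) := by gcongr
        _ = M / s ^ k := by field_simp
    have h2 : Tendsto (fun s : ℝ => M / s ^ k) (𝓝[<] r) (𝓝 (M / r ^ k)) := by
      apply Tendsto.mono_left _ nhdsWithin_le_nhds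
      exact tendsto_const_nhds.div (tendsto_id.pow k) (by positivity)
    refine ge_of_tendsto h2 ?_
    filter_upwards [Ioo_mem_nhdsLT hr] with s hs using h1 s hs
  have hcomp : IsCompact (Set.pi univ fun k : ℕ => closedBall (0 : ℂ) (M / r ^ k)) :=
    isCompact_univ_pi fun k => isCompact_closedBall _ _
  obtain ⟨d, hd, φ, hφ, hlim⟩ := hcomp.tendsto_subseq (x := c)
    (fun n k _ => by simpa using hcb n k)
  have hdb : ∀ k, ‖d k‖ ≤ M / r ^ k := fun k => by simpa using hd k (mem_univ k)
  have hlimk : ∀ k, Tendsto (fun n => c (φ n) k) atTop (𝓝 (d k)) := fun k =>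
    (tendsto_pi_nhds.1 hlim k)
  have hgeom : ∀ s : ℝ, 0 ≤ s → s < r → Summable fun k : ℕ => M / r ^ k * s ^ k := by
    intro s hs hsr
    have : Summable fun k : ℕ => M * (s / r) ^ k :=
      (summable_geometric_of_lt_one (by positivity) ((div_lt_one hr).2 hsr)).mul_left M
    refine this.congr fun k => ?_
    rw [div_pow]; field_simp
  refine ⟨φ, hφ, fun z => ∑' k, d k * z ^ k, ?_, ?_⟩
  · intro z hz
    rw [mem_ball_zero_iff] at hz
    obtain ⟨s, hzs, hsr⟩ := exists_between hz
    have hs0 : 0 ≤ s := (norm_nonneg z).trans hzs.le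
    have : DifferentiableOn ℂ (fun z => ∑' k, d k * z ^ k) (ball 0 s) := by
      refine Complex.differentiableOn_tsum_of_summable_norm (hgeom s hs0 hsr) (fun k => ?_)
        isOpen_ball ?_
      · fun_prop
      · intro k w hw
        rw [mem_ball_zero_iff] at hw
        rw [norm_mul, norm_pow]
        gcongr
        exact hdb k
    exact (this.differentiableAt (isOpen_ball.mem_nhds (by simpa using hzs))).differentiableWithinAt
  · intro v z hz hv
    rw [mem_ball_zero_iff] at hz
    obtain ⟨s, hzs, hsr⟩ := exists_between hz
    have hs0 : 0 ≤ s := (norm_nonneg z).trans hzs.le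
    have hev : ∀ᶠ n in atTop, ‖v n‖ < s := hv.norm.eventually_lt_const hzs
    have : Tendsto (fun n => ∑' k, c (φ n) k * v n ^ k) atTop (𝓝 (∑' k, d k * z ^ k)) := by
      refine tendsto_tsum_of_dominated_convergence (hgeom s hs0 hsr)
        (fun k => (hlimk k).mul (hv.pow k)) ?_
      filter_upwards [hev] with n hn k
      rw [norm_mul, norm_pow]
      gcongr
      exact hcb _ _
    refine this.congr' ?_
    filter_upwards [hev] with n hn
    exact hsum _ _ (by simpa using hn.trans hsr)

/-- If `f` takes no other value twice at points `a n → a₀` where its derivative does not vanish,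
then its derivative does not vanish at `a₀` either, unless `f` is locally constant. -/
theorem deriv_ne_zero_of_tendsto {f : ℂ → ℂ} {U : Set ℂ} (hU : IsOpen U)
    (hf : DifferentiableOn ℂ f U) {a₀ : ℂ} (ha₀ : a₀ ∈ U)
    (hnc : ¬ ∀ᶠ z in 𝓝 a₀, f z = f a₀) {a : ℕ → ℂ} (ha : Tendsto a atTop (𝓝 a₀))
    (hinj : ∀ n, ∀ b ∈ U, f b = f (a n) → b = a n) (hd : ∀ n, deriv f (a n) ≠ 0) :
    deriv f a₀ ≠ 0 := by
  intro hder
  have hDd : DifferentiableOn ℂ (dslope f a₀) U :=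
    (Complex.differentiableOn_dslope (hU.mem_nhds ha₀)).2 hf
  have hDan : AnalyticAt ℂ (dslope f a₀) a₀ := hDd.analyticAt (hU.mem_nhds ha₀)
  have hev : ∀ᶠ z in 𝓝[≠] a₀, dslope f a₀ z ≠ 0 := by
    rcases hDan.eventually_eq_zero_or_eventually_ne_zero with h | h
    · refine absurd ?_ hnc
      filter_upwards [h] with z hz
      rcases eq_or_ne z a₀ with rfl | hne
      · rfl
      · rw [dslope_of_ne _ hne, slope_def_field, div_eq_zero_iff] at hz
        exact sub_eq_zero.1 (hz.resolve_right (sub_ne_zero.2 hne))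
    · exact h
  obtain ⟨ρ, hρ, hρU⟩ : ∃ ρ > 0, closedBall a₀ ρ ⊆ U ∩ {z | z ≠ a₀ → dslope f a₀ z ≠ 0} := by
    apply nhds_basis_closedBall.mem_iff.1
    exact inter_mem (hU.mem_nhds ha₀) (eventually_nhdsWithin_iff.1 hev)
  have hUc : closedBall a₀ ρ ⊆ U := fun z hz => (hρU hz).1
  have hsne : ∀ z ∈ sphere a₀ ρ, z ≠ a₀ := by
    rintro z hz rfl
    simp [hρ.ne] at hz
  have hsc : ContinuousOn (fun z => ‖dslope f a₀ z‖) (sphere a₀ ρ) :=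
    (hDd.continuousOn.mono (sphere_subset_closedBall.trans hUc)).norm
  obtain ⟨m, hm, hmle⟩ : ∃ m > 0, ∀ z ∈ sphere a₀ ρ, m ≤ ‖dslope f a₀ z‖ := by
    obtain ⟨z₁, hz₁, hmin⟩ := (isCompact_sphere a₀ ρ).exists_isMinOn
      (NormedSpace.sphere_nonempty.2 hρ.le) hsc
    exact ⟨_, norm_pos_iff.2 ((hρU (sphere_subset_closedBall hz₁)).2 (hsne z₁ hz₁)), hmin⟩
  have hlow : ∀ᶠ b in 𝓝 a₀, ∀ z ∈ sphere a₀ ρ, m / 2 < ‖slope f b z‖ := by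
    apply (isCompact_sphere a₀ ρ).eventually_forall_of_forall_eventually
    intro z hz
    have hzU := hUc (sphere_subset_closedBall hz)
    have hcont : ContinuousAt (fun p : ℂ × ℂ => ‖(f p.2 - f p.1) / (p.2 - p.1)‖) (a₀, z) := by
      have h1 : ContinuousAt f z := (hf.differentiableAt (hU.mem_nhds hzU)).continuousAt
      have h2 : ContinuousAt f a₀ := (hf.differentiableAt (hU.mem_nhds ha₀)).continuousAt
      refine ContinuousAt.norm (ContinuousAt.div ?_ ?_ ?_)
      · exact (h1.comp_of_eq continuousAt_snd rfl).sub (h2.comp_of_eq continuousAt_fst rfl)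
      · fun_prop
      · exact sub_ne_zero.2 (hsne z hz)
    have h3 : m / 2 < ‖(f z - f a₀) / (z - a₀)‖ := by
      have := hmle z hz
      rw [dslope_of_ne _ (hsne z hz), slope_def_field] at this
      linarith
    filter_upwards [hcont.eventually (lt_mem_nhds h3)] with p hp
    rwa [slope_def_field]
  have hball : ∀ᶠ b in 𝓝 a₀, b ∈ ball a₀ ρ := ball_mem_nhds a₀ hρ
  have hsmall : ∀ᶠ b in 𝓝 a₀, ‖dslope f a₀ b‖ < m / 2 := by
    have := hDan.continuousAt.norm
    have h0 : ‖dslope f a₀ a₀‖ < m / 2 := by rw [dslope_same, hder]; simpa using hm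
    exact this.eventually (gt_mem_nhds h0)
  obtain ⟨n, hn1, hn2, hn3⟩ := (ha.eventually (hlow.and (hball.and hsmall))).exists
  have hanU : a n ∈ U := hUc (ball_subset_closedBall hn2)
  -- The difference quotient based at `a n` has no zero in the disc, so the maximum principle for
  -- its reciprocal carries the bound m/2 from the circle to `a₀`. By symmetry its value there is
  -- the quotient based at `a₀`, which is too small.
  have hnz : ∀ z ∈ closedBall a₀ ρ, dslope f (a n) z ≠ 0 := by
    intro z hz
    rcases eq_or_ne z (a n) with rfl | hne
    · rw [dslope_same]; exact hd n
    · rw [dslope_of_ne _ hne, slope_def_field]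
      refine div_ne_zero (sub_ne_zero.2 fun h => hne (hinj n z (hUc hz) h)) (sub_ne_zero.2 hne)
  have hdn : DifferentiableOn ℂ (fun z => (dslope f (a n) z)⁻¹) (closedBall a₀ ρ) :=
    (((Complex.differentiableOn_dslope (hU.mem_nhds hanU)).2 hf).mono hUc).inv hnz
  have hbound := Complex.norm_le_of_forall_mem_frontier_norm_le (isBounded_ball (x := a₀) (r := ρ))
    (hdn.diffContOnCl_ball subset_rfl) (C := (m / 2)⁻¹) (by
      intro z hz
      rw [frontier_ball _ hρ.ne'] at hz
      rw [norm_inv]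
      have hne : z ≠ a n := by
        rintro rfl
        rw [mem_sphere] at hz
        exact absurd (mem_ball.1 hn2) (by rw [hz]; exact lt_irrefl _)
      rw [dslope_of_ne _ hne]
      exact inv_anti₀ (by positivity) (hn1 z hz).le) (subset_closure (mem_ball_self hρ))
  have hne : dslope f (a n) a₀ = dslope f a₀ (a n) := by
    rcases eq_or_ne a₀ (a n) with h | h
    · rw [← h]
    · rw [dslope_of_ne _ h, dslope_of_ne _ h.symm, slope_comm]
  rw [norm_inv, inv_le_inv₀ (norm_pos_iff.2 (hnz _ (mem_closedBall_self hρ.le))) (by positivity),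
    hne] at hbound
  linarith

theorem not_eventually_const_of_injOn {f : ℂ → ℂ} {U : Set ℂ} (hU : IsOpen U) (hinj : InjOn f U)
    {z : ℂ} (hz : z ∈ U) : ¬ ∀ᶠ w in 𝓝 z, f w = f z := by
  intro h
  have h' : ∀ᶠ w in 𝓝[≠] z, f w = f z ∧ w ∈ U ∧ w ≠ z :=
    (eventually_nhdsWithin_of_eventually_nhds h).and
      ((eventually_nhdsWithin_of_eventually_nhds (hU.mem_nhds hz)).and self_mem_nhdsWithin)
  obtain ⟨w, h1, h2, h3⟩ := h'.exists
  exact h3 (hinj h2 hz h1)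

/-- The derivative cannot vanish on a neighbourhood of z, so it is nonzero at points accumulating at
z, and `deriv_ne_zero_of_tendsto` passes this to z. -/
theorem deriv_ne_zero_of_injOn {f : ℂ → ℂ} {U : Set ℂ} (hU : IsOpen U)
    (hf : DifferentiableOn ℂ f U) (hinj : InjOn f U) {z : ℂ} (hz : z ∈ U) : deriv f z ≠ 0 := by
  have hnc := not_eventually_const_of_injOn hU hinj hz
  have hda : AnalyticAt ℂ (deriv f) z := (hf.deriv hU).analyticAt (hU.mem_nhds hz)
  have hne : ∃ᶠ w in 𝓝 z, deriv f w ≠ 0 ∧ w ∈ U := by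
    refine (Filter.Frequently.and_eventually ?_ (hU.mem_nhds hz))
    intro h
    simp only [not_not] at h
    obtain ⟨ε, hε, hb⟩ := Metric.mem_nhds_iff.1 (h.and (hU.mem_nhds hz))
    apply hnc
    filter_upwards [ball_mem_nhds z hε] with w hw
    exact isOpen_ball.is_const_of_deriv_eq_zero (convex_ball z ε).isPreconnected
      (hf.mono fun w hw => (hb hw).2) (fun w hw => (hb hw).1) hw (mem_ball_self hε)
  obtain ⟨a, ha, hap⟩ := exists_seq_forall_of_frequently hne
  exact deriv_ne_zero_of_tendsto hU hf hz hnc ha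
    (fun n b hb h => hinj hb (hap n).2 h) (fun n => (hap n).1)

/-- The inverse of an injective holomorphic function is holomorphic on the (open) image. -/
theorem isOpen_image_of_injOn {f : ℂ → ℂ} {U : Set ℂ} (hU : IsOpen U)
    (hf : DifferentiableOn ℂ f U) (hinj : InjOn f U) : IsOpen (f '' U) := by
  rw [isOpen_iff_mem_nhds]
  rintro _ ⟨z, hz, rfl⟩
  have h := ((hf.analyticAt (hU.mem_nhds hz)).eventually_constant_or_nhds_le_map_nhds).resolve_left
    (not_eventually_const_of_injOn hU hinj hz)
  exact h (image_mem_map (hU.mem_nhds hz))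

theorem differentiableOn_inverse {f g : ℂ → ℂ} {U : Set ℂ} (hU : IsOpen U)
    (hf : DifferentiableOn ℂ f U) (hinj : InjOn f U) (hg : ∀ z ∈ U, g (f z) = z) :
    DifferentiableOn ℂ g (f '' U) := by
  rintro _ ⟨z, hz, rfl⟩
  have hda := hf.analyticAt (hU.mem_nhds hz)
  have hs : HasStrictDerivAt f (deriv f z) z := hda.hasStrictDerivAt
  have hne := deriv_ne_zero_of_injOn hU hf hinj hz
  have := hs.to_local_left_inverse (f' := deriv f z) hne
    (g := g) (Filter.mem_of_superset (hU.mem_nhds hz) hg)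
  exact this.hasDerivAt.differentiableAt.differentiableWithinAt

/-! ### The inverse Böttcher coordinate

In the coordinates `w = 1 / u` the inverse Böttcher coordinate of `R_a` at `∞` has the form
`(Y u - u) / u`.  The conjugacy equation becomes a pair of algebraic equations for `Y` and an
auxiliary square root `S`. -/

/-- `Y` and `S` encode the inverse Böttcher coordinate `1 / u ↦ (Y u - u) / u` of `R_a` on the
disc of radius `r`. -/
structure IsInvBottcher (a : ℂ) (r : ℝ) (Y S : ℂ → ℂ) : Prop where
  pos : 0 < r
  le_one : r ≤ 1
  diffY : DifferentiableOn ℂ Y (ball 0 r)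
  diffS : DifferentiableOn ℂ S (ball 0 r)
  Y_zero : Y 0 = 2
  S_zero : S 0 = 2
  S_sq : ∀ u ∈ ball (0 : ℂ) r,
    S u ^ 2 = (Y (u ^ 2) - u ^ 2) ^ 2 + a * u ^ 2 * (Y (u ^ 2) - u ^ 2)
  Y_sq : ∀ u ∈ ball (0 : ℂ) r, Y u ^ 2 = Y (u ^ 2) - u ^ 2 + S u + u ^ 2

/-- The inverse Böttcher coordinate in the coordinate `1 / z`. -/
def gmap (Y : ℂ → ℂ) (u : ℂ) : ℂ := u / (Y u - u)

/-- The second iterate of `R_a` in the coordinate `ζ = 1 / z`. -/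
def hmap (a ζ : ℂ) : ℂ := ζ ^ 2 * (2 + 4 * ζ + a * ζ ^ 2) / (1 + 2 * ζ) ^ 2

theorem sq_mem_ball {r : ℝ} (hr : r ≤ 1) {u : ℂ} (hu : u ∈ ball (0 : ℂ) r) :
    u ^ 2 ∈ ball (0 : ℂ) r := by
  rw [mem_ball_zero_iff] at hu ⊢
  rw [norm_pow]
  nlinarith [norm_nonneg u]

theorem pow_mem_ball {r : ℝ} (hr : r ≤ 1) {u : ℂ} (hu : u ∈ ball (0 : ℂ) r) (n : ℕ) :
    u ^ 2 ^ n ∈ ball (0 : ℂ) r := by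
  induction n with
  | zero => simpa using hu
  | succ n ih => rw [pow_succ, pow_mul]; exact sq_mem_ball hr ih

theorem tendsto_pow_two_pow {u : ℂ} (hu : ‖u‖ < 1) :
    Tendsto (fun n : ℕ => u ^ 2 ^ n) atTop (𝓝 0) :=
  (tendsto_pow_atTop_nhds_zero_of_norm_lt_one hu).comp
    (tendsto_pow_atTop_atTop_of_one_lt one_lt_two)

/-- Repeated squaring brings every point of the disc close to 0, so a property true near 0 and
inherited from u² by u holds throughout. -/
theorem sq_ball_induction {p : ℂ → Prop} {r : ℝ} (hr : r ≤ 1) (h0 : ∀ᶠ t in 𝓝 (0 : ℂ), p t)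
    (hstep : ∀ t ∈ ball (0 : ℂ) r, p (t ^ 2) → p t) : ∀ u ∈ ball (0 : ℂ) r, p u := by
  have key : ∀ n : ℕ, ∀ u ∈ ball (0 : ℂ) r, p (u ^ 2 ^ n) → p u := by
    intro n
    induction n with
    | zero => intro u _ h; simpa using h
    | succ n ih =>
      intro u hu h
      refine ih u hu (hstep _ (pow_mem_ball hr hu n) ?_)
      rwa [← pow_mul, ← pow_succ]
  intro u hu
  have hu1 : ‖u‖ < 1 := (mem_ball_zero_iff.1 hu).trans_le hr
  obtain ⟨n, hn⟩ := ((tendsto_pow_two_pow hu1).eventually h0).exists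
  exact key n u hu hn

theorem exists_injOn_nhds_of_deriv_ne_zero {f : ℂ → ℂ} {z : ℂ} (hf : AnalyticAt ℂ f z)
    (hd : deriv f z ≠ 0) : ∃ s ∈ 𝓝 z, InjOn f s := by
  have hs := hf.hasStrictDerivAt.hasStrictFDerivAt_equiv hd
  exact ⟨_, hs.mem_toOpenPartialHomeomorph_source |> (hs.toOpenPartialHomeomorph f).open_source.mem_nhds,
    (hs.toOpenPartialHomeomorph f).injOn⟩

namespace IsInvBottcher

variable {a : ℂ} {r : ℝ} {Y S : ℂ → ℂ}

theorem mono (h : IsInvBottcher a r Y S) {r' : ℝ} (h0 : 0 < r') (hr : r' ≤ r) :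
    IsInvBottcher a r' Y S where
  pos := h0
  le_one := hr.trans h.le_one
  diffY := h.diffY.mono (ball_subset_ball hr)
  diffS := h.diffS.mono (ball_subset_ball hr)
  Y_zero := h.Y_zero
  S_zero := h.S_zero
  S_sq u hu := h.S_sq u (ball_subset_ball hr hu)
  Y_sq u hu := h.Y_sq u (ball_subset_ball hr hu)

theorem zero_mem (h : IsInvBottcher a r Y S) : (0 : ℂ) ∈ ball (0 : ℂ) r := mem_ball_self h.pos

theorem ball_mem (h : IsInvBottcher a r Y S) : ball (0 : ℂ) r ∈ 𝓝 (0 : ℂ) := ball_mem_nhds _ h.pos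

theorem continuousAt_Y (h : IsInvBottcher a r Y S) : ContinuousAt Y 0 :=
  (h.diffY.differentiableAt h.ball_mem).continuousAt

theorem continuousAt_S (h : IsInvBottcher a r Y S) : ContinuousAt S 0 :=
  (h.diffS.differentiableAt h.ball_mem).continuousAt

theorem diff_sq (h : IsInvBottcher a r Y S) :
    DifferentiableOn ℂ (fun u => Y (u ^ 2) - u ^ 2) (ball 0 r) :=
  (h.diffY.comp (by fun_prop) fun _ hu => sq_mem_ball h.le_one hu).sub (by fun_prop)

/-- The bound reproduces itself when passing from u² to u: |S|² ≤ |Z|² + κ|Z| ≤ (|Z| + κ/2)², hence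
|Y|² ≤ 2|Z| + κ/2 + 1 ≤ (3 + κ)². Its independence of r is what later gives normality and
properness. -/
theorem norm_le (h : IsInvBottcher a r Y S) {κ : ℝ} (hκ : 0 ≤ κ) :
    ∀ u ∈ ball (0 : ℂ) r, ‖a‖ * ‖u‖ ^ 2 ≤ κ → ‖Y u‖ ≤ 3 + κ := by
  refine sq_ball_induction (p := fun u => ‖a‖ * ‖u‖ ^ 2 ≤ κ → ‖Y u‖ ≤ 3 + κ) h.le_one ?_ ?_
  · have : ∀ᶠ t in 𝓝 (0 : ℂ), ‖Y t‖ < 3 := by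
      apply h.continuousAt_Y.norm.eventually_lt_const
      simp [h.Y_zero]; norm_num
    filter_upwards [this] with t ht _
    linarith
  · intro u hu ih hle
    have hu1 : ‖u‖ ≤ 1 := (mem_ball_zero_iff.1 hu).le.trans h.le_one
    have hn := norm_nonneg u
    have hu2 : ‖u‖ ^ 2 ≤ 1 := pow_le_one₀ hn hu1
    have hle2 : ‖a‖ * ‖u ^ 2‖ ^ 2 ≤ κ := by
      refine le_trans ?_ hle
      rw [norm_pow]
      gcongr
      nlinarith
    have hY := ih hle2
    set Z := Y (u ^ 2) - u ^ 2 with hZ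
    have hZn : ‖Z‖ ≤ 4 + κ := by
      refine (norm_sub_le _ _).trans ?_
      rw [norm_pow]; linarith
    have hS : ‖S u‖ ≤ ‖Z‖ + κ / 2 := by
      have e := congrArg norm (h.S_sq u hu)
      rw [norm_pow] at e
      have e2 : ‖S u‖ ^ 2 ≤ ‖Z‖ ^ 2 + κ * ‖Z‖ := by
        rw [e]
        refine (norm_add_le _ _).trans ?_
        rw [norm_pow, norm_mul, norm_mul, norm_pow]
        gcongr
      refine abs_le_of_sq_le_sq' (a := ‖S u‖) (b := ‖Z‖ + κ / 2) ?_ (by positivity) |>.2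
      nlinarith [norm_nonneg Z]
    have hYsq : ‖Y u‖ ^ 2 ≤ (3 + κ) ^ 2 := by
      have e := congrArg norm (h.Y_sq u hu)
      rw [norm_pow] at e
      rw [e]
      calc ‖Z + S u + u ^ 2‖ ≤ ‖Z‖ + ‖S u‖ + ‖u ^ 2‖ := norm_add₃_le
        _ ≤ (3 + κ) ^ 2 := by
          rw [norm_pow]
          have : ‖Z‖ ≤ ‖Y (u ^ 2)‖ + ‖u‖ ^ 2 := by
            rw [← norm_pow]; exact norm_sub_le (Y (u ^ 2)) (u ^ 2)
          nlinarith
    exact abs_le_of_sq_le_sq' hYsq (by positivity) |>.2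

theorem norm_S_le (h : IsInvBottcher a r Y S) {M : ℝ} (hM : ∀ u ∈ ball (0 : ℂ) r, ‖Y u‖ ≤ M) :
    ∀ u ∈ ball (0 : ℂ) r, ‖S u‖ ≤ M ^ 2 + M + 2 := by
  intro u hu
  have hu1 : ‖u‖ ≤ 1 := (mem_ball_zero_iff.1 hu).le.trans h.le_one
  have hu2 : ‖u‖ ^ 2 ≤ 1 := pow_le_one₀ (norm_nonneg u) hu1
  have e : S u = Y u ^ 2 - Y (u ^ 2) := by rw [h.Y_sq u hu]; ring
  have h1 := hM u hu
  have h2 := hM _ (sq_mem_ball h.le_one hu)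
  rw [e]
  refine (norm_sub_le _ _).trans ?_
  rw [norm_pow]
  nlinarith [norm_nonneg (Y u)]

/-- A Schwarz-type estimate for the deviation of `Y` from its value at the origin. -/
theorem norm_sub_two_le (h : IsInvBottcher a r Y S) {κ : ℝ} (hκ : ‖a‖ * r ^ 2 ≤ κ) {u : ℂ}
    (hu : u ∈ ball (0 : ℂ) r) : ‖Y u - 2‖ ≤ (5 + κ) / r * ‖u‖ := by
  have hκ0 : 0 ≤ κ := le_trans (by have := h.pos; positivity) hκ
  have := Complex.dist_le_div_mul_dist_of_mapsTo_ball (R₂ := 5 + κ) h.diffY ?_ hu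
  · simpa [dist_eq_norm, h.Y_zero] using this
  · intro t ht
    rw [mem_closedBall, dist_eq_norm, h.Y_zero]
    have h1 : ‖Y t‖ ≤ 3 + κ := by
      refine h.norm_le hκ0 t ht (le_trans ?_ hκ)
      gcongr
      exact (mem_ball_zero_iff.1 ht).le
    refine (norm_sub_le _ _).trans ?_
    norm_num
    linarith

/-- If Z + S = 0 then S² = Z², so a u² Z = 0. Only a = 0 survives, and there the value at the centre
forces S = Z, making the sum 2Z. -/
theorem add_S_ne_zero_of (h : IsInvBottcher a r Y S) {u : ℂ} (hu : u ∈ ball (0 : ℂ) r)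
    (hZ : Y (u ^ 2) - u ^ 2 ≠ 0) : Y (u ^ 2) - u ^ 2 + S u ≠ 0 := by
  intro h0
  rcases eq_or_ne u 0 with rfl | hu0
  · norm_num [h.Y_zero, h.S_zero] at h0
  have e := h.S_sq u hu
  rw [eq_neg_of_add_eq_zero_right h0] at e
  rcases eq_or_ne a 0 with rfl | ha
  · have hS := eqOn_of_sq_eq_sq h.pos h.diffS h.diff_sq (by
      intro z hz; rw [h.S_sq z hz]; ring) (by simp [h.Y_zero, h.S_zero]) (by simp [h.S_zero]) hu
    simp only at hS
    rw [hS, ← two_mul] at h0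
    exact hZ ((mul_eq_zero.1 h0).resolve_left two_ne_zero)
  · have : a * u ^ 2 * (Y (u ^ 2) - u ^ 2) = 0 := by linear_combination -e
    exact mul_ne_zero (mul_ne_zero ha (pow_ne_zero 2 hu0)) hZ this

/-- The identity (Y - u)(Y + u) = Z + S transports nonvanishing from u² to u. Dynamically, the
coordinate never meets z = 0. -/
theorem den_ne_zero (h : IsInvBottcher a r Y S) : ∀ u ∈ ball (0 : ℂ) r, Y u - u ≠ 0 := by
  refine sq_ball_induction (p := fun u => Y u - u ≠ 0) h.le_one ?_ ?_
  · have : ContinuousAt (fun u => Y u - u) 0 := h.continuousAt_Y.sub continuousAt_id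
    apply this.eventually_ne
    simp [h.Y_zero]
  · intro u hu hZ h0
    apply h.add_S_ne_zero_of hu hZ
    linear_combination -h.Y_sq u hu + (Y u + u) * h0

theorem add_S_ne_zero (h : IsInvBottcher a r Y S) {u : ℂ} (hu : u ∈ ball (0 : ℂ) r) :
    Y (u ^ 2) - u ^ 2 + S u ≠ 0 :=
  h.add_S_ne_zero_of hu (h.den_ne_zero _ (sq_mem_ball h.le_one hu))

theorem add_ne_zero (h : IsInvBottcher a r Y S) {u : ℂ} (hu : u ∈ ball (0 : ℂ) r) :
    Y u + u ≠ 0 := by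
  intro h0
  apply h.add_S_ne_zero hu
  linear_combination -h.Y_sq u hu + (Y u - u) * h0

theorem S_even (h : IsInvBottcher a r Y S) {u : ℂ} (hu : u ∈ ball (0 : ℂ) r) : S (-u) = S u := by
  have hneg : ∀ z ∈ ball (0 : ℂ) r, -z ∈ ball (0 : ℂ) r := fun z hz => by simpa using hz
  refine eqOn_of_sq_eq_sq h.pos (f := fun z => S (-z)) (h.diffS.comp (by fun_prop) hneg) h.diffS
    ?_ (by simp) (by simp [h.S_zero]) hu
  intro z hz
  rw [h.S_sq z hz, h.S_sq (-z) (hneg z hz), neg_sq]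

/-- Since z + 1 = Y(u)/u, evenness of Y expresses the symmetry z ↦ -2 - z of R_a. -/
theorem Y_even (h : IsInvBottcher a r Y S) {u : ℂ} (hu : u ∈ ball (0 : ℂ) r) : Y (-u) = Y u := by
  have hneg : ∀ z ∈ ball (0 : ℂ) r, -z ∈ ball (0 : ℂ) r := fun z hz => by simpa using hz
  refine eqOn_of_sq_eq_sq h.pos (f := fun z => Y (-z)) (h.diffY.comp (by fun_prop) hneg) h.diffY
    ?_ (by simp) (by simp [h.Y_zero]) hu
  intro z hz
  rw [h.Y_sq z hz, h.Y_sq (-z) (hneg z hz), neg_sq, h.S_even hz]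

/-- Near 0 the difference of two solutions at u is at most the difference at u². Iterating, it is
bounded by values tending to |2 - 2| = 0; the identity theorem does the rest. -/
theorem unique {Y' S' : ℂ → ℂ} (h : IsInvBottcher a r Y S) (h' : IsInvBottcher a r Y' S') :
    EqOn Y Y' (ball 0 r) := by
  have hc1 := h.continuousAt_Y
  have hc2 := h'.continuousAt_Y
  have hsq : Tendsto (fun u : ℂ => u ^ 2) (𝓝 0) (𝓝 0) := by
    simpa using (continuous_pow 2).tendsto (0 : ℂ)
  -- All three sums tend to 4; the margins 5, 3, 3 give the factor (1 + 5/3)/3 = 8/9 < 1.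
  have e1 : ∀ᶠ u in 𝓝 (0 : ℂ), ‖Y (u ^ 2) - u ^ 2 + (Y' (u ^ 2) - u ^ 2) + a * u ^ 2‖ < 5 := by
    have : Tendsto (fun u => ‖Y (u ^ 2) - u ^ 2 + (Y' (u ^ 2) - u ^ 2) + a * u ^ 2‖) (𝓝 0)
        (𝓝 ‖Y 0 - 0 + (Y' 0 - 0) + a * 0‖) :=
      ((((hc1.tendsto.comp hsq).sub hsq).add ((hc2.tendsto.comp hsq).sub hsq)).add
        (hsq.const_mul a)).norm
    apply this.eventually_lt_const
    rw [h.Y_zero, h'.Y_zero]; norm_num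
  have e2 : ∀ᶠ u in 𝓝 (0 : ℂ), 3 < ‖S u + S' u‖ := by
    apply (h.continuousAt_S.add h'.continuousAt_S).norm.eventually_const_lt
    change 3 < ‖S 0 + S' 0‖
    rw [h.S_zero, h'.S_zero]; norm_num
  have e3 : ∀ᶠ u in 𝓝 (0 : ℂ), 3 < ‖Y u + Y' u‖ := by
    apply (hc1.add hc2).norm.eventually_const_lt
    change 3 < ‖Y 0 + Y' 0‖
    rw [h.Y_zero, h'.Y_zero]; norm_num
  have hstep : ∀ᶠ u in 𝓝 (0 : ℂ), ‖Y u - Y' u‖ ≤ ‖Y (u ^ 2) - Y' (u ^ 2)‖ := by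
    filter_upwards [e1, e2, e3, h.ball_mem] with u h1 h2 h3 hu
    have i1 : (S u - S' u) * (S u + S' u) = (Y (u ^ 2) - Y' (u ^ 2)) *
        (Y (u ^ 2) - u ^ 2 + (Y' (u ^ 2) - u ^ 2) + a * u ^ 2) := by
      linear_combination h.S_sq u hu - h'.S_sq u hu
    have i2 : (Y u - Y' u) * (Y u + Y' u) = (Y (u ^ 2) - Y' (u ^ 2)) + (S u - S' u) := by
      linear_combination h.Y_sq u hu - h'.Y_sq u hu
    have n1 := congrArg norm i1
    have n2 := congrArg norm i2
    rw [norm_mul, norm_mul] at n1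
    rw [norm_mul] at n2
    have n3 := norm_add_le (Y (u ^ 2) - Y' (u ^ 2)) (S u - S' u)
    set d := ‖Y (u ^ 2) - Y' (u ^ 2)‖ with hd
    have hd0 : 0 ≤ d := norm_nonneg _
    have k1 : ‖S u - S' u‖ * 3 ≤ d * 5 := by
      calc ‖S u - S' u‖ * 3 ≤ ‖S u - S' u‖ * ‖S u + S' u‖ := by gcongr
        _ ≤ d * 5 := by rw [n1]; gcongr
    have k2 : ‖Y u - Y' u‖ * 3 ≤ d + ‖S u - S' u‖ := by
      calc ‖Y u - Y' u‖ * 3 ≤ ‖Y u - Y' u‖ * ‖Y u + Y' u‖ := by gcongr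
        _ ≤ _ := by rw [n2]; exact n3
    linarith
  obtain ⟨δ, hδ, hb⟩ := Metric.mem_nhds_iff.1 hstep
  apply (h.diffY.analyticOnNhd isOpen_ball).eqOn_of_preconnected_of_eventuallyEq
    (h'.diffY.analyticOnNhd isOpen_ball) (convex_ball (0 : ℂ) r).isPreconnected h.zero_mem
  have hmin : 0 < min δ 1 := lt_min hδ one_pos
  filter_upwards [ball_mem_nhds (0 : ℂ) hmin] with u hu
  have hiter : ∀ n : ℕ, ‖Y u - Y' u‖ ≤ ‖Y (u ^ 2 ^ n) - Y' (u ^ 2 ^ n)‖ := by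
    intro n
    induction n with
    | zero => simp
    | succ n ih =>
      refine ih.trans ?_
      have := hb (ball_subset_ball (min_le_left _ _) (pow_mem_ball (min_le_right _ _) hu n))
      rwa [mem_ofPred_eq, ← pow_mul, ← pow_succ] at this
  have hu1 : ‖u‖ < 1 := (mem_ball_zero_iff.1 hu).trans_le (min_le_right _ _)
  have hlim : Tendsto (fun n : ℕ => ‖Y (u ^ 2 ^ n) - Y' (u ^ 2 ^ n)‖) atTop (𝓝 0) := by
    have := ((hc1.tendsto.comp (tendsto_pow_two_pow hu1)).sub
      (hc2.tendsto.comp (tendsto_pow_two_pow hu1))).norm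
    simpa [h.Y_zero, h'.Y_zero] using this
  have := ge_of_tendsto' hlim hiter
  exact sub_eq_zero.1 (norm_eq_zero.1 (le_antisymm this (norm_nonneg _)))

theorem hmap_gmap (h : IsInvBottcher a r Y S) {u : ℂ} (hu : u ∈ ball (0 : ℂ) r) :
    hmap a (gmap Y u) = gmap Y (u ^ 2) := by
  have h1 := h.den_ne_zero u hu
  have h2 := h.den_ne_zero _ (sq_mem_ball h.le_one hu)
  have h3 := h.add_ne_zero hu
  have h4 := h.add_S_ne_zero hu
  have eS := h.S_sq u hu
  have eY := h.Y_sq u hu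
  unfold hmap gmap
  have k1 : 1 + 2 * (u / (Y u - u)) = (Y u + u) / (Y u - u) := by field_simp; ring
  rw [k1]
  set Z := Y (u ^ 2) - u ^ 2
  have k2 : (Y u - u) * (Y u + u) = Z + S u := by linear_combination eY
  have k3 : (Z + S u) ^ 2 = Z * (2 * (Z + S u) + a * u ^ 2) := by linear_combination eS
  have k4 : (u / (Y u - u)) ^ 2 * (2 + 4 * (u / (Y u - u)) + a * (u / (Y u - u)) ^ 2) /
      ((Y u + u) / (Y u - u)) ^ 2
      = u ^ 2 * (2 * ((Y u - u) * (Y u + u)) + a * u ^ 2) / ((Y u - u) * (Y u + u)) ^ 2 := by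
    field_simp
    ring
  rw [k4, k2, k3]
  have h5 : 2 * (Z + S u) + a * u ^ 2 ≠ 0 := by
    intro h0
    rw [h0, mul_zero] at k3
    exact h4 (pow_eq_zero_iff two_ne_zero |>.1 k3)
  rw [div_eq_div_iff (mul_ne_zero h2 h5) h2]
  ring

theorem gmap_zero : gmap Y 0 = 0 := by simp [gmap]

theorem diff_gmap (h : IsInvBottcher a r Y S) : DifferentiableOn ℂ (gmap Y) (ball 0 r) :=
  differentiableOn_id.div (h.diffY.sub differentiableOn_id) h.den_ne_zero

theorem hasDerivAt_gmap_zero (h : IsInvBottcher a r Y S) : HasDerivAt (gmap Y) (1 / 2) 0 := by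
  have h1 : HasDerivAt Y (deriv Y 0) 0 := (h.diffY.differentiableAt h.ball_mem).hasDerivAt
  have := (hasDerivAt_id (0 : ℂ)).div (h1.sub (hasDerivAt_id (0 : ℂ)))
    (by simp [h.Y_zero])
  refine this.congr_deriv ?_
  simp [h.Y_zero]
  norm_num

/-- A zero of Y is a point with z(u) = -1, the free critical point, so z(u²) = R_a²(-1) = R_a(-a) =
1/(a - 2). -/
theorem gmap_sq_eq_of_Y_eq_zero (h : IsInvBottcher a r Y S) {u : ℂ} (hu : u ∈ ball (0 : ℂ) r)
    (h0 : Y u = 0) : gmap Y (u ^ 2) = a - 2 := by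
  have hu0 : u ≠ 0 := by rintro rfl; simp [h.Y_zero] at h0
  have h2 := h.den_ne_zero _ (sq_mem_ball h.le_one hu)
  have eS := h.S_sq u hu
  have eY := h.Y_sq u hu
  rw [h0] at eY
  unfold gmap
  set Z := Y (u ^ 2) - u ^ 2
  rw [div_eq_iff h2]
  have : u ^ 2 * (u ^ 2 - (a - 2) * Z) = 0 := by
    linear_combination eS - (Z + u ^ 2 - S u) * eY
  have := (mul_eq_zero.1 this).resolve_left (pow_ne_zero 2 hu0)
  linear_combination this

/-- A coincidence at u, v gives one at u², v² by the conjugacy. Descending from local injectivity at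
0 leaves u = ±v, and by evenness of Y the minus sign would force v·Y(v) = 0. -/
theorem injOn_gmap (h : IsInvBottcher a r Y S) (hY : ∀ u ∈ ball (0 : ℂ) r, Y u ≠ 0) :
    InjOn (gmap Y) (ball 0 r) := by
  obtain ⟨s, hs, hinj⟩ := exists_injOn_nhds_of_deriv_ne_zero
    (h.diff_gmap.analyticAt h.ball_mem) (by rw [h.hasDerivAt_gmap_zero.deriv]; norm_num)
  have key : ∀ n : ℕ, ∀ u ∈ ball (0 : ℂ) r, ∀ v ∈ ball (0 : ℂ) r, u ^ 2 ^ n ∈ s → v ^ 2 ^ n ∈ s →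
      gmap Y u = gmap Y v → u = v := by
    intro n
    induction n with
    | zero =>
      intro u _ v _ hus hvs huv
      exact hinj (by simpa using hus) (by simpa using hvs) huv
    | succ n ih =>
      intro u hu v hv hus hvs huv
      have h2 : u ^ 2 = v ^ 2 := by
        refine ih _ (sq_mem_ball h.le_one hu) _ (sq_mem_ball h.le_one hv) ?_ ?_ ?_
        · rwa [← pow_mul, mul_comm, ← pow_succ]
        · rwa [← pow_mul, mul_comm, ← pow_succ]
        · rw [← h.hmap_gmap hu, ← h.hmap_gmap hv, huv]
      rcases sq_eq_sq_iff_eq_or_eq_neg.1 h2 with h3 | h3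
      · exact h3
      · subst h3
        rw [gmap, gmap, h.Y_even hv, div_eq_div_iff] at huv
        · have : v * Y v = 0 := by linear_combination -huv / 2
          rcases mul_eq_zero.1 this with h4 | h4
          · simp [h4]
          · exact absurd h4 (hY v hv)
        · simpa [h.Y_even hv] using h.den_ne_zero _ hu
        · exact h.den_ne_zero _ hv
  intro u hu v hv huv
  have hu1 : ‖u‖ < 1 := (mem_ball_zero_iff.1 hu).trans_le h.le_one
  have hv1 : ‖v‖ < 1 := (mem_ball_zero_iff.1 hv).trans_le h.le_one
  obtain ⟨n, h1, h2⟩ := (((tendsto_pow_two_pow hu1).eventually hs).and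
    ((tendsto_pow_two_pow hv1).eventually hs)).exists
  exact key n u hu v hv h1 h2 huv

/-- The inverse Böttcher coordinate extends to the disc of radius `√r` as long as the image
avoids the critical value `-a` and its image. -/
theorem exists_extension (h : IsInvBottcher a r Y S)
    (h1 : ∀ t ∈ ball (0 : ℂ) r, Y t - t + a * t ≠ 0)
    (h2 : ∀ t ∈ ball (0 : ℂ) r, gmap Y t = a - 2 → t = 0) :
    ∃ Y' S', IsInvBottcher a (√r) Y' S' := by
  have hρ : 0 < √r := Real.sqrt_pos.2 h.pos
  have hρ1 : √r ≤ 1 := Real.sqrt_le_one.2 h.le_one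
  have hrρ : r ≤ √r := Real.le_sqrt_of_sq_le (by nlinarith [h.pos, h.le_one])
  have hsq : ∀ u ∈ ball (0 : ℂ) (√r), u ^ 2 ∈ ball (0 : ℂ) r := by
    intro u hu
    rw [mem_ball_zero_iff] at hu ⊢
    rw [norm_pow]
    exact (Real.lt_sqrt (norm_nonneg u)).1 hu
  have hdZ : DifferentiableOn ℂ (fun u => Y (u ^ 2) - u ^ 2) (ball 0 (√r)) :=
    (h.diffY.comp (by fun_prop) hsq).sub (by fun_prop)
  -- The radicand is Z(Z + a u²); its second factor vanishes exactly when the coordinate at u² is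
  -- -a, which `h1` excludes.
  obtain ⟨S', hS'd, hS'sq, hS'0⟩ := exists_sqrt_on_ball hρ
    (f := fun u => (Y (u ^ 2) - u ^ 2) ^ 2 + a * u ^ 2 * (Y (u ^ 2) - u ^ 2)) (c := 2)
    (by fun_prop) (by
      intro u hu
      have := mul_ne_zero (h.den_ne_zero _ (hsq u hu)) (h1 _ (hsq u hu))
      intro h0
      apply this
      linear_combination h0) (by simp [h.Y_zero])
  -- A zero of this radicand would be a critical point z(u) = -1, placing R_a(-a) in the image at
  -- u², against `h2`.
  obtain ⟨Y', hY'd, hY'sq, hY'0⟩ := exists_sqrt_on_ball hρ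
    (f := fun u => Y (u ^ 2) - u ^ 2 + S' u + u ^ 2) (c := 2)
    (by fun_prop) (by
      intro u hu h0
      have eS := hS'sq u hu
      have hden := h.den_ne_zero _ (hsq u hu)
      rcases eq_or_ne u 0 with rfl | hu0
      · norm_num [h.Y_zero, hS'0] at h0
      have e1 : u ^ 2 * (u ^ 2 - (a - 2) * (Y (u ^ 2) - u ^ 2)) = 0 := by
        linear_combination (Y (u ^ 2) - u ^ 2 + u ^ 2 - S' u) * h0 + eS
      have e2 := (mul_eq_zero.1 e1).resolve_left (pow_ne_zero 2 hu0)
      refine pow_ne_zero 2 hu0 (h2 _ (hsq u hu) ?_)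
      rw [gmap, div_eq_iff hden]
      linear_combination e2) (by simp [h.Y_zero, hS'0]; norm_num)
  have hSS : EqOn S' S (ball 0 r) := eqOn_of_sq_eq_sq h.pos (hS'd.mono (ball_subset_ball hrρ))
    h.diffS (fun z hz => by rw [hS'sq z (ball_subset_ball hrρ hz), h.S_sq z hz])
    (by rw [hS'0, h.S_zero]) (by simp [hS'0])
  have hYY : EqOn Y' Y (ball 0 r) := eqOn_of_sq_eq_sq h.pos (hY'd.mono (ball_subset_ball hrρ))
    h.diffY (fun z hz => by rw [hY'sq z (ball_subset_ball hrρ hz), h.Y_sq z hz, hSS hz])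
    (by rw [hY'0, h.Y_zero]) (by simp [hY'0])
  refine ⟨Y', S', hρ, hρ1, hY'd, hS'd, hY'0, hS'0, ?_, ?_⟩
  · intro u hu
    rw [hYY (hsq u hu)]
    exact hS'sq u hu
  · intro u hu
    rw [hYY (hsq u hu)]
    exact hY'sq u hu

end IsInvBottcher

/-! ### Normal limits and existence of the inverse Böttcher coordinate. -/

theorem norm_sqrt_sub_le {x : ℂ} {c : ℝ} (hc : 0 < c) :
    ‖x.sqrt - c‖ ≤ ‖x - c ^ 2‖ / c := by
  have hsq : x.sqrt ^ 2 = x := by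
    rw [Complex.sqrt]
    exact Complex.cpow_ofNat_inv_pow x 2
  have hre : 0 ≤ x.sqrt.re := by
    rw [Complex.sqrt, Complex.cpow_inv_two_re]; positivity
  have h1 : c ≤ ‖x.sqrt + c‖ := by
    refine le_trans ?_ (Complex.re_le_norm _)
    simpa using hre
  rw [le_div_iff₀ hc]
  calc ‖x.sqrt - c‖ * c ≤ ‖x.sqrt - c‖ * ‖x.sqrt + c‖ := by gcongr
    _ = ‖x - c ^ 2‖ := by
      rw [← norm_mul]
      congr 1
      linear_combination hsq

theorem mem_slitPlane_of_norm_sub_four {x : ℂ} (hx : ‖x - 4‖ < 4) : x ∈ Complex.slitPlane := by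
  left
  have := (Complex.abs_re_le_norm (x - 4)).trans_lt hx
  simp at this
  linarith [(abs_lt.1 this).1]

theorem exists_isInvBottcher_limit {a : ℕ → ℂ} {a₀ : ℂ} (ha : Tendsto a atTop (𝓝 a₀)) {r : ℝ}
    {Y S : ℕ → ℂ → ℂ} (h : ∀ n, IsInvBottcher (a n) r (Y n) (S n)) :
    ∃ (φ : ℕ → ℕ) (Y' S' : ℂ → ℂ), StrictMono φ ∧ IsInvBottcher a₀ r Y' S' ∧
      ∀ (v : ℕ → ℂ) (z : ℂ), z ∈ ball (0 : ℂ) r → Tendsto v atTop (𝓝 z) →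
        Tendsto (fun n => Y (φ n) (v n)) atTop (𝓝 (Y' z)) := by
  have hr := (h 0).pos
  have hr1 := (h 0).le_one
  obtain ⟨A, hA⟩ : ∃ A, ∀ n, ‖a n‖ ≤ A := by
    obtain ⟨A, hA⟩ := (Metric.isBounded_range_of_tendsto _ ha).exists_norm_le
    exact ⟨A, fun n => hA _ (mem_range_self n)⟩
  have hA0 : 0 ≤ A := (norm_nonneg _).trans (hA 0)
  have hYb : ∀ n, ∀ z ∈ ball (0 : ℂ) r, ‖Y n z‖ ≤ 3 + A := by
    intro n z hz
    refine (h n).norm_le hA0 z hz ?_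
    have : ‖z‖ ^ 2 ≤ 1 := pow_le_one₀ (norm_nonneg z) ((mem_ball_zero_iff.1 hz).le.trans hr1)
    nlinarith [hA n, norm_nonneg (a n)]
  obtain ⟨φ, hφ, Y', hY'd, hY'⟩ := exists_subseq_continuous_limit hr (fun n => (h n).diffY) hYb
  obtain ⟨θ, hθ, S', hS'd, hS'⟩ := exists_subseq_continuous_limit hr (fun n => (h (φ n)).diffS)
    (fun n => (h (φ n)).norm_S_le (hYb (φ n)))
  have hY'' : ∀ (v : ℕ → ℂ) (z : ℂ), z ∈ ball (0 : ℂ) r → Tendsto v atTop (𝓝 z) →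
      Tendsto (fun n => Y (φ (θ n)) (v n)) atTop (𝓝 (Y' z)) := by
    intro v z hz hv
    -- Convergence along moving points is known for the indices φ(n); filling the gaps of θ with the
    -- constant z makes it usable along φ ∘ θ.
    have hv2 : Tendsto (Function.extend θ v fun _ => z) atTop (𝓝 z) := by
      intro s hs
      rw [mem_map]
      obtain ⟨N, hN⟩ := mem_atTop_sets.1 (hv hs)
      refine mem_atTop_sets.2 ⟨θ N, fun m hm => ?_⟩
      by_cases hmr : ∃ k, θ k = m
      · obtain ⟨k, rfl⟩ := hmr
        rw [mem_preimage, hθ.injective.extend_apply]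
        exact hN k (hθ.le_iff_le.1 hm)
      · rw [mem_preimage, Function.extend_apply' _ _ _ hmr]
        exact mem_of_mem_nhds hs
    have := (hY' _ z hz hv2).comp hθ.tendsto_atTop
    refine this.congr fun n => ?_
    simp [hθ.injective.extend_apply]
  have ha' : Tendsto (fun n => a (φ (θ n))) atTop (𝓝 a₀) :=
    ha.comp (hφ.comp hθ).tendsto_atTop
  have cY : ∀ z ∈ ball (0 : ℂ) r, Tendsto (fun n => Y (φ (θ n)) z) atTop (𝓝 (Y' z)) :=
    fun z hz => hY'' _ z hz tendsto_const_nhds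
  have cS : ∀ z ∈ ball (0 : ℂ) r, Tendsto (fun n => S (φ (θ n)) z) atTop (𝓝 (S' z)) :=
    fun z hz => hS' _ z hz tendsto_const_nhds
  have h00 : (0 : ℂ) ∈ ball (0 : ℂ) r := mem_ball_self hr
  refine ⟨φ ∘ θ, Y', S', hφ.comp hθ, ⟨hr, hr1, hY'd, hS'd, ?_, ?_, ?_, ?_⟩, hY''⟩
  · exact tendsto_nhds_unique (cY 0 h00) (by simp [(h _).Y_zero])
  · exact tendsto_nhds_unique (cS 0 h00) (by simp [(h _).S_zero])
  · intro u hu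
    have hu2 := sq_mem_ball hr1 hu
    refine tendsto_nhds_unique ((cS u hu).pow 2) ?_
    simp only [(h _).S_sq u hu]
    exact (((cY _ hu2).sub_const _).pow 2).add ((ha'.mul_const _).mul ((cY _ hu2).sub_const _))
  · intro u hu
    have hu2 := sq_mem_ball hr1 hu
    refine tendsto_nhds_unique ((cY u hu).pow 2) ?_
    simp only [(h _).Y_sq u hu]
    exact (((cY _ hu2).sub_const _).add (cS u hu)).add_const _

/-- The class |Y - 2| ≤ |u| is stable: the radicands differ from 4 by O(A|u|²), which 16A|u|² ≤ |u|
absorbs, so they stay in the slit plane and the principal root is holomorphic and near 2. -/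
theorem exists_iteration_step {a : ℂ} {A ε : ℝ} (hA : 1 + ‖a‖ ≤ A) (hε0 : 0 < ε)
    (hε : 16 * A * ε ≤ 1) {Y : ℂ → ℂ} (hYd : DifferentiableOn ℂ Y (ball 0 ε))
    (hY : ∀ u ∈ ball (0 : ℂ) ε, ‖Y u - 2‖ ≤ ‖u‖) :
    ∃ Y' S' : ℂ → ℂ, DifferentiableOn ℂ Y' (ball 0 ε) ∧ DifferentiableOn ℂ S' (ball 0 ε) ∧
      (∀ u ∈ ball (0 : ℂ) ε, ‖Y' u - 2‖ ≤ ‖u‖) ∧ (∀ u ∈ ball (0 : ℂ) ε, ‖S' u - 2‖ ≤ ‖u‖) ∧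
      (∀ u ∈ ball (0 : ℂ) ε,
        S' u ^ 2 = (Y (u ^ 2) - u ^ 2) ^ 2 + a * u ^ 2 * (Y (u ^ 2) - u ^ 2)) ∧
      (∀ u ∈ ball (0 : ℂ) ε, Y' u ^ 2 = Y (u ^ 2) - u ^ 2 + S' u + u ^ 2) := by
  have ha := norm_nonneg a
  have hA1 : 1 ≤ A := by linarith
  have hε1 : ε ≤ 1 / 16 := by nlinarith
  have hsqrt : ∀ x : ℂ, x.sqrt ^ 2 = x := fun x => Complex.cpow_ofNat_inv_pow x 2
  have hmem : ∀ u ∈ ball (0 : ℂ) ε, u ^ 2 ∈ ball (0 : ℂ) ε := fun u hu =>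
    sq_mem_ball (by linarith) hu
  have hZ : ∀ u ∈ ball (0 : ℂ) ε, ‖Y (u ^ 2) - u ^ 2 - 2‖ ≤ 2 * ‖u‖ ^ 2 := by
    intro u hu
    have h1 := hY _ (hmem u hu)
    have : Y (u ^ 2) - u ^ 2 - 2 = (Y (u ^ 2) - 2) - u ^ 2 := by ring
    rw [this]
    refine (norm_sub_le _ _).trans ?_
    rw [norm_pow] at h1 ⊢
    linarith
  have hu16 : ∀ u ∈ ball (0 : ℂ) ε, ‖u‖ ≤ 1 / 16 ∧ 16 * A * ‖u‖ ^ 2 ≤ ‖u‖ := by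
    intro u hu
    have hu := (mem_ball_zero_iff.1 hu).le
    refine ⟨hu.trans hε1, ?_⟩
    have : 16 * A * ‖u‖ ≤ 1 := le_trans (by gcongr) hε
    nlinarith [norm_nonneg u]
  have hE : ∀ u ∈ ball (0 : ℂ) ε,
      ‖(Y (u ^ 2) - u ^ 2) ^ 2 + a * u ^ 2 * (Y (u ^ 2) - u ^ 2) - 4‖ ≤ 10 * A * ‖u‖ ^ 2 := by
    intro u hu
    obtain ⟨hu1, -⟩ := hu16 u hu
    have h1 := hZ u hu
    have hn := norm_nonneg u
    set Z := Y (u ^ 2) - u ^ 2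
    have h2 : ‖Z‖ ≤ 3 := by
      have : Z = (Z - 2) + 2 := by ring
      rw [this]
      refine (norm_add_le _ _).trans ?_
      norm_num
      nlinarith
    have h3 : Z ^ 2 + a * u ^ 2 * Z - 4 = (Z - 2) * (Z + 2) + a * u ^ 2 * Z := by ring
    rw [h3]
    refine (norm_add_le _ _).trans ?_
    rw [norm_mul, norm_mul, norm_mul, norm_pow]
    have h4 : ‖Z + 2‖ ≤ 5 := by
      refine (norm_add_le _ _).trans ?_
      norm_num
      linarith
    have h5 : ‖Z - 2‖ * ‖Z + 2‖ ≤ 2 * ‖u‖ ^ 2 * 5 := by gcongr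
    have h6 : ‖a‖ * ‖u‖ ^ 2 * ‖Z‖ ≤ ‖a‖ * ‖u‖ ^ 2 * 3 := by gcongr
    nlinarith [mul_le_mul_of_nonneg_right hA (sq_nonneg ‖u‖), mul_nonneg ha (sq_nonneg ‖u‖)]
  set S' : ℂ → ℂ := fun u =>
    ((Y (u ^ 2) - u ^ 2) ^ 2 + a * u ^ 2 * (Y (u ^ 2) - u ^ 2)).sqrt with hS'
  have hSb : ∀ u ∈ ball (0 : ℂ) ε, ‖S' u - 2‖ ≤ 5 * A * ‖u‖ ^ 2 := by
    intro u hu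
    have h1 := norm_sqrt_sub_le (x := (Y (u ^ 2) - u ^ 2) ^ 2 + a * u ^ 2 * (Y (u ^ 2) - u ^ 2))
      (two_pos : (0 : ℝ) < 2)
    have h2 := hE u hu
    norm_num at h1
    simp only [hS']
    linarith
  have hQ : ∀ u ∈ ball (0 : ℂ) ε, ‖Y (u ^ 2) - u ^ 2 + S' u + u ^ 2 - 4‖ ≤ 8 * A * ‖u‖ ^ 2 := by
    intro u hu
    have h1 := hZ u hu
    have h2 := hSb u hu
    have : Y (u ^ 2) - u ^ 2 + S' u + u ^ 2 - 4 =
      (Y (u ^ 2) - u ^ 2 - 2) + (S' u - 2) + u ^ 2 := by ring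
    rw [this]
    refine norm_add₃_le.trans ?_
    rw [norm_pow]
    nlinarith [sq_nonneg ‖u‖]
  have hdZ : DifferentiableOn ℂ (fun u => Y (u ^ 2) - u ^ 2) (ball 0 ε) :=
    (hYd.comp (by fun_prop) hmem).sub (by fun_prop)
  have hdS : DifferentiableOn ℂ S' (ball 0 ε) := by
    refine Complex.differentiableOn_sqrt.comp (by fun_prop) fun u hu => ?_
    apply mem_slitPlane_of_norm_sub_four
    obtain ⟨h1, h2⟩ := hu16 u hu
    have := hE u hu
    linarith [mul_nonneg (by linarith : 0 ≤ A) (sq_nonneg ‖u‖)]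
  refine ⟨fun u => (Y (u ^ 2) - u ^ 2 + S' u + u ^ 2).sqrt, S', ?_, hdS, ?_, ?_,
    fun u _ => hsqrt _, fun u _ => hsqrt _⟩
  · refine Complex.differentiableOn_sqrt.comp (by fun_prop) fun u hu => ?_
    apply mem_slitPlane_of_norm_sub_four
    obtain ⟨h1, h2⟩ := hu16 u hu
    have := hQ u hu
    linarith [mul_nonneg (by linarith : 0 ≤ A) (sq_nonneg ‖u‖)]
  · intro u hu
    have h1 := norm_sqrt_sub_le (x := Y (u ^ 2) - u ^ 2 + S' u + u ^ 2) (two_pos : (0 : ℝ) < 2)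
    have h2 := hQ u hu
    have h3 := (hu16 u hu).2
    norm_num at h1 ⊢
    linarith [mul_nonneg (by linarith : 0 ≤ A) (sq_nonneg ‖u‖)]
  · intro u hu
    have h2 := hSb u hu
    have h3 := (hu16 u hu).2
    linarith [mul_nonneg (by linarith : 0 ≤ A) (sq_nonneg ‖u‖)]

/-- Existence of the inverse Böttcher coordinate near `∞`. -/
theorem exists_isInvBottcher (a : ℂ) : ∃ (r : ℝ) (Y S : ℂ → ℂ), IsInvBottcher a r Y S := by
  set A : ℝ := 1 + ‖a‖ with hA
  have ha := norm_nonneg a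
  have hA1 : 1 ≤ A := by linarith
  set ε : ℝ := 1 / (16 * A) with hεd
  have hε0 : 0 < ε := by positivity
  have hε : 16 * A * ε ≤ 1 := by rw [hεd]; field_simp; exact le_rfl
  have hε1 : ε ≤ 1 / 16 := by nlinarith
  let C := {Y : ℂ → ℂ // DifferentiableOn ℂ Y (ball 0 ε) ∧ ∀ u ∈ ball (0 : ℂ) ε, ‖Y u - 2‖ ≤ ‖u‖}
  have hstep : ∀ Y : C, ∃ (Y' : C) (S' : ℂ → ℂ), DifferentiableOn ℂ S' (ball 0 ε) ∧
      (∀ u ∈ ball (0 : ℂ) ε, ‖S' u - 2‖ ≤ ‖u‖) ∧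
      (∀ u ∈ ball (0 : ℂ) ε,
        S' u ^ 2 = (Y.1 (u ^ 2) - u ^ 2) ^ 2 + a * u ^ 2 * (Y.1 (u ^ 2) - u ^ 2)) ∧
      (∀ u ∈ ball (0 : ℂ) ε, Y'.1 u ^ 2 = Y.1 (u ^ 2) - u ^ 2 + S' u + u ^ 2) := by
    rintro ⟨Y, hY1, hY2⟩
    obtain ⟨Y', S', h1, h2, h3, h4, h5, h6⟩ := exists_iteration_step hA.ge hε0 hε hY1 hY2
    exact ⟨⟨Y', h1, h3⟩, S', h2, h4, h5, h6⟩
  choose T R hSd hSb hSsq hYsq using hstep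
  set Y : ℕ → C := fun n => T^[n] ⟨fun _ => 2, by fun_prop, by simp⟩ with hY
  have hYs : ∀ n, Y (n + 1) = T (Y n) := fun n => Function.iterate_succ_apply' _ _ _
  have hb : ∀ u ∈ ball (0 : ℂ) ε, ‖u‖ ≤ 1 / 16 := fun u hu =>
    (mem_ball_zero_iff.1 hu).le.trans hε1
  have hmem : ∀ u ∈ ball (0 : ℂ) ε, u ^ 2 ∈ ball (0 : ℂ) ε := fun u hu =>
    sq_mem_ball (by linarith) hu
  have hcontr : ∀ V W : C, ∀ u ∈ ball (0 : ℂ) ε,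
      ‖(T V).1 u - (T W).1 u‖ ≤ ‖V.1 (u ^ 2) - W.1 (u ^ 2)‖ := by
    intro V W u hu
    have hu1 := hb u hu
    have hn := norm_nonneg u
    have i1 : (R V u - R W u) * (R V u + R W u) = (V.1 (u ^ 2) - W.1 (u ^ 2)) *
        (V.1 (u ^ 2) - u ^ 2 + (W.1 (u ^ 2) - u ^ 2) + a * u ^ 2) := by
      linear_combination hSsq V u hu - hSsq W u hu
    have i2 : ((T V).1 u - (T W).1 u) * ((T V).1 u + (T W).1 u) =
        (V.1 (u ^ 2) - W.1 (u ^ 2)) + (R V u - R W u) := by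
      linear_combination hYsq V u hu - hYsq W u hu
    have n1 := congrArg norm i1
    have n2 := congrArg norm i2
    rw [norm_mul, norm_mul] at n1
    rw [norm_mul] at n2
    have n3 := norm_add_le (V.1 (u ^ 2) - W.1 (u ^ 2)) (R V u - R W u)
    have near : ∀ x y : ℂ, ‖x - 2‖ ≤ ‖u‖ → ‖y - 2‖ ≤ ‖u‖ → 3 ≤ ‖x + y‖ := by
      intro x y hx hy
      have : (4 : ℂ) = (x + y) - (x - 2) - (y - 2) := by ring
      have h4 : ‖(4 : ℂ)‖ ≤ ‖x + y‖ + ‖x - 2‖ + ‖y - 2‖ := by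
        rw [this]
        exact (norm_sub_le _ _).trans (by gcongr; exact norm_sub_le _ _)
      norm_num at h4
      linarith
    have m1 := near _ _ (hSb V u hu) (hSb W u hu)
    have m2 := near _ _ ((T V).2.2 u hu) ((T W).2.2 u hu)
    have m3 : ‖V.1 (u ^ 2) - u ^ 2 + (W.1 (u ^ 2) - u ^ 2) + a * u ^ 2‖ ≤ 5 := by
      have e : V.1 (u ^ 2) - u ^ 2 + (W.1 (u ^ 2) - u ^ 2) + a * u ^ 2 =
        (V.1 (u ^ 2) - 2) + (W.1 (u ^ 2) - 2) + ((a - 2) * u ^ 2 + 4) := by ring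
      have k1 := V.2.2 _ (hmem u hu)
      have k2 := W.2.2 _ (hmem u hu)
      rw [norm_pow] at k1 k2
      rw [e]
      refine norm_add₃_le.trans ?_
      have k3 : ‖(a - 2) * u ^ 2 + 4‖ ≤ (‖a‖ + 2) * ‖u‖ ^ 2 + 4 := by
        refine (norm_add_le _ _).trans ?_
        rw [norm_mul, norm_pow]
        have : ‖a - 2‖ ≤ ‖a‖ + 2 := (norm_sub_le _ _).trans (by norm_num)
        norm_num
        gcongr
      have k4 : A * ‖u‖ ≤ 1 / 16 := by
        have : ‖u‖ ≤ ε := (mem_ball_zero_iff.1 hu).le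
        nlinarith
      nlinarith
    set d := ‖V.1 (u ^ 2) - W.1 (u ^ 2)‖ with hd
    have hd0 : 0 ≤ d := norm_nonneg _
    have k1 : ‖R V u - R W u‖ * 3 ≤ d * 5 := by
      calc ‖R V u - R W u‖ * 3 ≤ ‖R V u - R W u‖ * ‖R V u + R W u‖ := by gcongr
        _ ≤ d * 5 := by rw [n1]; gcongr
    have k2 : ‖(T V).1 u - (T W).1 u‖ * 3 ≤ d + ‖R V u - R W u‖ := by
      calc ‖(T V).1 u - (T W).1 u‖ * 3
          ≤ ‖(T V).1 u - (T W).1 u‖ * ‖(T V).1 u + (T W).1 u‖ := by gcongr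
        _ ≤ _ := by rw [n2]; exact n3
    linarith
  have hdiff : ∀ n : ℕ, ∀ u ∈ ball (0 : ℂ) ε,
      ‖(Y (n + 1)).1 u - (Y n).1 u‖ ≤ 2 * ‖u ^ 2 ^ n‖ := by
    intro n
    induction n with
    | zero =>
      intro u hu
      have e : (Y (0 + 1)).1 u - (Y 0).1 u = ((Y 1).1 u - 2) - ((Y 0).1 u - 2) := by ring
      rw [e]
      refine (norm_sub_le _ _).trans ?_
      have h1 := (Y 1).2.2 u hu
      have h2 := (Y 0).2.2 u hu
      simp only [pow_zero, pow_one]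
      linarith
    | succ n ih =>
      intro u hu
      rw [hYs (n + 1), hYs n]
      refine (hcontr _ _ u hu).trans ?_
      have := ih _ (hmem u hu)
      rwa [hYs n, ← pow_mul, ← pow_succ'] at this
  have hbound : ∀ x : ℂ, ∀ u ∈ ball (0 : ℂ) ε, ‖x - 2‖ ≤ ‖u‖ → ‖x‖ ≤ 3 := by
    intro x u hu hx
    have : x = (x - 2) + 2 := by ring
    rw [this]
    refine (norm_add_le _ _).trans ?_
    norm_num
    linarith [hb u hu]
  obtain ⟨φ, hφ, Y', hY'd, hY'⟩ := exists_subseq_continuous_limit hε0 (fun n => (Y n).2.1)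
    (fun n u hu => hbound _ u hu ((Y n).2.2 u hu))
  obtain ⟨θ, hθ, S', hS'd, hS'⟩ := exists_subseq_continuous_limit hε0
    (fun n => hSd (Y (φ n))) (fun n u hu => hbound _ u hu (hSb (Y (φ n)) u hu))
  have cY : ∀ u ∈ ball (0 : ℂ) ε, Tendsto (fun n => (Y (φ (θ n))).1 u) atTop (𝓝 (Y' u)) :=
    fun u hu => (hY' _ u hu tendsto_const_nhds).comp hθ.tendsto_atTop
  have cS : ∀ u ∈ ball (0 : ℂ) ε, Tendsto (fun n => R (Y (φ (θ n))) u) atTop (𝓝 (S' u)) :=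
    fun u hu => hS' _ u hu tendsto_const_nhds
  -- Consecutive iterates differ by at most 2|u|^(2ⁿ), so the images under `T` of the extracted
  -- subsequence have the same limit, which is therefore a fixed point.
  have cY1 : ∀ u ∈ ball (0 : ℂ) ε,
      Tendsto (fun n => (T (Y (φ (θ n)))).1 u) atTop (𝓝 (Y' u)) := by
    intro u hu
    have h0 : Tendsto (fun n => (Y (n + 1)).1 u - (Y n).1 u) atTop (𝓝 0) := by
      refine squeeze_zero_norm (hdiff · u hu) ?_
      have := (tendsto_pow_two_pow (u := u) (by linarith [hb u hu])).norm.const_mul 2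
      simpa using this
    have := (h0.comp (hφ.comp hθ).tendsto_atTop).add (cY u hu)
    rw [zero_add] at this
    refine this.congr fun n => ?_
    simp [hYs]
  have h00 : (0 : ℂ) ∈ ball (0 : ℂ) ε := mem_ball_self hε0
  have hz : ∀ x : ℂ, ‖x - 2‖ ≤ ‖(0 : ℂ)‖ → x = 2 := by
    intro x hx
    rw [norm_zero] at hx
    exact sub_eq_zero.1 (norm_eq_zero.1 (le_antisymm hx (norm_nonneg _)))
  refine ⟨ε, Y', S', hε0, by linarith, hY'd, hS'd, ?_, ?_, ?_, ?_⟩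
  · refine tendsto_nhds_unique (cY 0 h00) (tendsto_const_nhds.congr fun n => ?_)
    exact (hz _ ((Y _).2.2 0 h00)).symm
  · refine tendsto_nhds_unique (cS 0 h00) (tendsto_const_nhds.congr fun n => ?_)
    exact (hz _ (hSb _ 0 h00)).symm
  · intro u hu
    refine tendsto_nhds_unique ((cS u hu).pow 2) ?_
    simp only [hSsq _ u hu]
    have c2 := cY _ (hmem u hu)
    exact ((c2.sub_const _).pow 2).add ((c2.sub_const _).const_mul _)
  · intro u hu
    refine tendsto_nhds_unique ((cY1 u hu).pow 2) ?_
    simp only [hYsq _ u hu]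
    exact (((cY _ (hmem u hu)).sub_const _).add (cS u hu)).add_const _

/-! ### The coordinate at infinity and the dynamics of `R_a` -/

/-- The chart `ζ ↦ 1 / ζ` of the Riemann sphere at `∞`. -/
def invChart (ζ : ℂ) : OnePoint ℂ := if ζ = 0 then ∞ else ((ζ⁻¹ : ℂ) : OnePoint ℂ)

@[simp] theorem invChart_zero : invChart 0 = ∞ := by simp [invChart]

theorem invChart_of_ne {ζ : ℂ} (h : ζ ≠ 0) : invChart ζ = ((ζ⁻¹ : ℂ) : OnePoint ℂ) := by
  simp [invChart, h]

theorem map_inv_nhdsNE_zero : map (fun z : ℂ => z⁻¹) (𝓝[≠] 0) = Bornology.cobounded ℂ := by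
  apply le_antisymm tendsto_inv₀_nhdsNE_zero
  have := map_mono (m := fun z : ℂ => z⁻¹) (tendsto_inv₀_cobounded' (α := ℂ))
  rw [Filter.map_map] at this
  have e : (fun z : ℂ => z⁻¹) ∘ Inv.inv = id := by ext z; simp
  rwa [e, Filter.map_id] at this

theorem coclosedCompact_eq_cobounded : coclosedCompact ℂ = Bornology.cobounded ℂ := by
  rw [coclosedCompact_eq_cocompact, Metric.cobounded_eq_cocompact]

/-- Equality of filters, rather than an inequality, yields continuity and openness of the chart
together. -/
theorem map_invChart_nhds (ζ : ℂ) : map invChart (𝓝 ζ) = 𝓝 (invChart ζ) := by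
  rcases eq_or_ne ζ 0 with rfl | h
  · have e : map invChart (𝓝[≠] 0) = map (fun z : ℂ => (z : OnePoint ℂ)) (coclosedCompact ℂ) := by
      rw [coclosedCompact_eq_cobounded, ← map_inv_nhdsNE_zero, Filter.map_map]
      apply Filter.map_congr
      filter_upwards [self_mem_nhdsWithin] with z hz
      exact invChart_of_ne hz
    rw [← nhdsNE_sup_pure, Filter.map_sup, e, Filter.map_pure, invChart_zero, nhds_infty_eq]
  · rw [invChart_of_ne h, nhds_coe_eq]
    have e1 : map (fun z : ℂ => z⁻¹) (𝓝 ζ) = 𝓝 ζ⁻¹ := by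
      apply le_antisymm (tendsto_inv₀ h)
      have h2 := map_mono (m := fun z : ℂ => z⁻¹) (tendsto_inv₀ (inv_ne_zero h))
      rw [Filter.map_map, inv_inv] at h2
      have e : (fun z : ℂ => z⁻¹) ∘ (fun z : ℂ => z⁻¹) = id := by ext z; simp
      rwa [e, Filter.map_id] at h2
    rw [← e1, Filter.map_map]
    apply Filter.map_congr
    filter_upwards [isOpen_ne.mem_nhds h] with z hz
    exact invChart_of_ne hz

theorem continuous_invChart : Continuous invChart :=
  continuous_iff_continuousAt.2 fun ζ => (map_invChart_nhds ζ).le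

theorem isOpenMap_invChart : IsOpenMap invChart :=
  isOpenMap_iff_nhds_le.2 fun ζ => (map_invChart_nhds ζ).ge

theorem injective_invChart : Function.Injective invChart := by
  intro x y h
  unfold invChart at h
  split_ifs at h with h1 h2 h2
  · rw [h1, h2]
  · exact absurd h (infty_ne_coe _)
  · exact absurd h (coe_ne_infty _)
  · exact inv_injective (coe_injective h)

theorem isOpenEmbedding_invChart : IsOpenEmbedding invChart :=
  .of_continuous_injective_isOpenMap continuous_invChart injective_invChart isOpenMap_invChart

theorem invChart_neg_inv {a : ℂ} (ha : a ≠ 0) : invChart (-a⁻¹) = ((-a : ℂ) : OnePoint ℂ) := by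
  rw [invChart_of_ne (neg_ne_zero.2 (inv_ne_zero ha)), inv_neg, inv_inv]

@[simp] theorem ratMap_infty (a : ℂ) : ratMap a ∞ = ((0 : ℂ) : OnePoint ℂ) := rfl

theorem ratMap_coe (a z : ℂ) : ratMap a (z : OnePoint ℂ) =
    if z ^ 2 + 2 * z = 0 then ∞ else ((a / (z ^ 2 + 2 * z) : ℂ) : OnePoint ℂ) := rfl

theorem ratMap_coe_eq {a : ℂ} (ha : a ≠ 0) (z : ℂ) :
    ratMap a (z : OnePoint ℂ) = invChart ((z ^ 2 + 2 * z) / a) := by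
  rw [ratMap_coe]
  split_ifs with h
  · simp [h]
  · rw [invChart_of_ne (div_ne_zero h ha), inv_div]

theorem ratMap_invChart (a : ℂ) {ζ : ℂ} (hζ : 1 + 2 * ζ ≠ 0) :
    ratMap a (invChart ζ) = ((a * ζ ^ 2 / (1 + 2 * ζ) : ℂ) : OnePoint ℂ) := by
  rcases eq_or_ne ζ 0 with rfl | h
  · simp
  · have e : ζ⁻¹ ^ 2 + 2 * ζ⁻¹ = (1 + 2 * ζ) / ζ ^ 2 := by field_simp
    rw [invChart_of_ne h, ratMap_coe, e, if_neg (div_ne_zero hζ (pow_ne_zero 2 h)), div_div_eq_mul_div]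

theorem ratMap_iterate_two_invChart {a : ℂ} (ha : a ≠ 0) {ζ : ℂ} (hζ : 1 + 2 * ζ ≠ 0) :
    (ratMap a)^[2] (invChart ζ) = invChart (hmap a ζ) := by
  rw [Function.iterate_succ_apply, Function.iterate_one, ratMap_invChart a hζ, ratMap_coe_eq ha]
  congr 1
  unfold hmap
  field_simp
  ring

theorem continuousAt_ratMap_uncurry {a : ℂ} (ha : a ≠ 0) (z : OnePoint ℂ) :
    ContinuousAt (fun p : ℂ × OnePoint ℂ => ratMap p.1 p.2) (a, z) := by
  induction z using OnePoint.rec with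
  | infty =>
    have h1 : 𝓝 ((a, ∞) : ℂ × OnePoint ℂ) = map (Prod.map id invChart) (𝓝 (a, (0 : ℂ))) := by
      rw [nhds_prod_eq, nhds_prod_eq, ← Filter.prod_map_map_eq', Filter.map_id, map_invChart_nhds,
        invChart_zero]
    rw [ContinuousAt, h1, tendsto_map'_iff]
    have h2 : ContinuousAt (fun p : ℂ × ℂ =>
        ((p.1 * p.2 ^ 2 / (1 + 2 * p.2) : ℂ) : OnePoint ℂ)) (a, 0) := by
      refine continuous_coe.continuousAt.comp (ContinuousAt.div ?_ ?_ ?_)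
      · fun_prop
      · fun_prop
      · simp
    have h3 : ∀ᶠ p : ℂ × ℂ in 𝓝 (a, 0), 1 + 2 * p.2 ≠ 0 := by
      have : ContinuousAt (fun p : ℂ × ℂ => 1 + 2 * p.2) (a, 0) := by fun_prop
      exact this.eventually_ne (by simp)
    have h4 := h2.tendsto
    simp only [ne_eq, OfNat.ofNat_ne_zero, not_false_eq_true, zero_pow, mul_zero, zero_div] at h4
    refine h4.congr' ?_
    filter_upwards [h3] with p hp
    exact (ratMap_invChart _ hp).symm
  | coe z =>
    have h1 : 𝓝 ((a, (z : OnePoint ℂ)) : ℂ × OnePoint ℂ) =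
        map (Prod.map id (fun z : ℂ => (z : OnePoint ℂ))) (𝓝 (a, z)) := by
      rw [nhds_prod_eq, nhds_prod_eq, ← Filter.prod_map_map_eq', Filter.map_id, nhds_coe_eq]
    rw [ContinuousAt, h1, tendsto_map'_iff]
    have h2 : ContinuousAt (fun p : ℂ × ℂ => invChart ((p.2 ^ 2 + 2 * p.2) / p.1)) (a, z) := by
      refine continuous_invChart.continuousAt.comp (ContinuousAt.div ?_ ?_ ?_)
      · fun_prop
      · fun_prop
      · exact ha
    have h3 : ∀ᶠ p : ℂ × ℂ in 𝓝 (a, z), p.1 ≠ 0 :=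
      (continuousAt_fst (p := (a, z))).eventually_ne ha
    have h4 := h2.tendsto
    simp only [← ratMap_coe_eq ha] at h4
    refine h4.congr' ?_
    filter_upwards [h3] with p hp
    exact (ratMap_coe_eq hp _).symm

theorem continuous_ratMap {a : ℂ} (ha : a ≠ 0) : Continuous (ratMap a) :=
  continuous_iff_continuousAt.2 fun z =>
    ContinuousAt.comp (f := fun z => (a, z)) (continuousAt_ratMap_uncurry ha z) (by fun_prop)

theorem continuousAt_ratMap_iterate_uncurry {a : ℂ} (ha : a ≠ 0) (n : ℕ) (z : OnePoint ℂ) :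
    ContinuousAt (fun p : ℂ × OnePoint ℂ => (ratMap p.1)^[n] p.2) (a, z) := by
  induction n with
  | zero => exact continuousAt_snd
  | succ n ih =>
    simp only [Function.iterate_succ_apply']
    exact ContinuousAt.comp (f := fun p : ℂ × OnePoint ℂ => (p.1, (ratMap p.1)^[n] p.2))
      (continuousAt_ratMap_uncurry ha _) (continuousAt_fst.prodMk ih)

theorem zero_notMem_basin {a : ℂ} : ((0 : ℂ) : OnePoint ℂ) ∉ basin a := by
  intro h
  have h0 : ∀ n : ℕ, (ratMap a)^[2 * n] ((0 : ℂ) : OnePoint ℂ) = ((0 : ℂ) : OnePoint ℂ) := by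
    intro n
    rw [Function.iterate_mul]
    refine Function.iterate_fixed ?_ n
    rw [Function.iterate_succ_apply, Function.iterate_one, ratMap_coe]
    simp
  rw [basin, mem_ofPred_eq] at h
  simp only [h0] at h
  exact coe_ne_infty _ (tendsto_nhds_unique tendsto_const_nhds h)

theorem iterate_mem_basin_iff {a : ℂ} (N : ℕ) {z : OnePoint ℂ} :
    (ratMap a)^[2 * N] z ∈ basin a ↔ z ∈ basin a := by
  unfold basin
  simp only [mem_ofPred_eq, ← Function.iterate_add_apply, ← mul_add]
  exact tendsto_add_atTop_iff_nat (f := fun n => (ratMap a)^[2 * n] z) N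

theorem infty_mem_basin {a : ℂ} : ∞ ∈ basin a := by
  have h0 : ∀ n : ℕ, (ratMap a)^[2 * n] ∞ = ∞ := by
    intro n
    rw [Function.iterate_mul]
    refine Function.iterate_fixed ?_ n
    rw [Function.iterate_succ_apply, Function.iterate_one, ratMap_infty, ratMap_coe]
    simp
  simp only [basin, mem_ofPred_eq, h0]
  exact tendsto_const_nhds

/-- The even iterates of R_a(z) are the R_a-images of those of z, hence tend to R_a(∞) = 0 and not
to ∞. -/
theorem ratMap_notMem_basin {a : ℂ} (ha : a ≠ 0) {z : OnePoint ℂ} (hz : z ∈ basin a) :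
    ratMap a z ∉ basin a := by
  intro h
  have h1 : Tendsto (fun n : ℕ => ratMap a ((ratMap a)^[2 * n] z)) atTop
      (𝓝 ((0 : ℂ) : OnePoint ℂ)) := by
    rw [← ratMap_infty a]
    exact ((continuous_ratMap ha).tendsto ∞).comp hz
  have h2 : Tendsto (fun n : ℕ => ratMap a ((ratMap a)^[2 * n] z)) atTop (𝓝 ∞) := by
    refine Tendsto.congr (fun n => ?_) h
    rw [← Function.iterate_succ_apply, Function.iterate_succ_apply']
  exact coe_ne_infty _ (tendsto_nhds_unique h1 h2)

theorem ratMap_neg {a : ℂ} (ha : a ≠ 0) :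
    ratMap a ((-a : ℂ) : OnePoint ℂ) = invChart (a - 2) := by
  rw [ratMap_coe_eq ha]
  congr 1
  field_simp
  ring

theorem subset_immediateBasin {a : ℂ} {s : Set (OnePoint ℂ)} (hs : IsPreconnected s)
    (h0 : ∞ ∈ s) (h : s ⊆ basin a) : s ⊆ immediateBasin a :=
  hs.subset_connectedComponentIn h0 h

/-! ### The image of the inverse Böttcher coordinate inside the immediate basin. -/

namespace IsInvBottcher

variable {a : ℂ} {r : ℝ} {Y S : ℂ → ℂ}

theorem one_add_gmap_ne_zero (h : IsInvBottcher a r Y S) {u : ℂ} (hu : u ∈ ball (0 : ℂ) r) :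
    1 + 2 * gmap Y u ≠ 0 := by
  have h1 := h.den_ne_zero u hu
  have e : 1 + 2 * gmap Y u = (Y u + u) / (Y u - u) := by
    unfold gmap; field_simp; ring
  rw [e]
  exact div_ne_zero (h.add_ne_zero hu) h1

theorem iterate_invChart_gmap (h : IsInvBottcher a r Y S) (ha : a ≠ 0) {u : ℂ}
    (hu : u ∈ ball (0 : ℂ) r) (n : ℕ) :
    (ratMap a)^[2 * n] (invChart (gmap Y u)) = invChart (gmap Y (u ^ 2 ^ n)) := by
  induction n with
  | zero => simp
  | succ n ih =>
    have hm := pow_mem_ball h.le_one hu n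
    rw [show 2 * (n + 1) = 2 + 2 * n by ring, Function.iterate_add_apply, ih,
      ratMap_iterate_two_invChart ha (h.one_add_gmap_ne_zero hm), h.hmap_gmap hm, ← pow_mul,
      ← pow_succ]

theorem continuousOn_invChart_gmap (h : IsInvBottcher a r Y S) :
    ContinuousOn (fun u => invChart (gmap Y u)) (ball 0 r) :=
  continuous_invChart.comp_continuousOn h.diff_gmap.continuousOn

theorem mem_basin (h : IsInvBottcher a r Y S) (ha : a ≠ 0) {u : ℂ} (hu : u ∈ ball (0 : ℂ) r) :
    invChart (gmap Y u) ∈ basin a := by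
  have hu1 : ‖u‖ < 1 := (mem_ball_zero_iff.1 hu).trans_le h.le_one
  have hc : ContinuousAt (fun u => invChart (gmap Y u)) 0 :=
    h.continuousOn_invChart_gmap.continuousAt h.ball_mem
  have := hc.tendsto.comp (tendsto_pow_two_pow hu1)
  rw [gmap_zero, invChart_zero] at this
  exact this.congr fun n => (h.iterate_invChart_gmap ha hu n).symm

theorem image_subset_immediateBasin (h : IsInvBottcher a r Y S) (ha : a ≠ 0) :
    (fun u => invChart (gmap Y u)) '' ball 0 r ⊆ immediateBasin a := by
  refine subset_immediateBasin
    ((convex_ball (0 : ℂ) r).isPreconnected.image _ h.continuousOn_invChart_gmap)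
    ⟨0, h.zero_mem, by simp [gmap_zero]⟩ ?_
  rintro _ ⟨u, hu, rfl⟩
  exact h.mem_basin ha hu

theorem gmap_ne (h : IsInvBottcher a r Y S) (ha : a ≠ 0)
    (hb : ((-a : ℂ) : OnePoint ℂ) ∈ basin a) {u : ℂ} (hu : u ∈ ball (0 : ℂ) r) :
    gmap Y u ≠ a - 2 := by
  intro h0
  apply ratMap_notMem_basin ha hb
  rw [ratMap_neg ha, ← h0]
  exact h.mem_basin ha hu

theorem Y_ne_zero (h : IsInvBottcher a r Y S) (ha : a ≠ 0)
    (hb : ((-a : ℂ) : OnePoint ℂ) ∈ basin a) : ∀ u ∈ ball (0 : ℂ) r, Y u ≠ 0 := fun _ hu h0 =>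
  h.gmap_ne ha hb (sq_mem_ball h.le_one hu) (h.gmap_sq_eq_of_Y_eq_zero hu h0)

theorem injOn (h : IsInvBottcher a r Y S) (ha : a ≠ 0)
    (hb : ((-a : ℂ) : OnePoint ℂ) ∈ basin a) : InjOn (gmap Y) (ball 0 r) :=
  h.injOn_gmap (h.Y_ne_zero ha hb)

theorem gmap_eq_neg_inv_iff (h : IsInvBottcher a r Y S) (ha : a ≠ 0) {u : ℂ}
    (hu : u ∈ ball (0 : ℂ) r) : gmap Y u = -a⁻¹ ↔ Y u - u + a * u = 0 := by
  rw [gmap, div_eq_iff (h.den_ne_zero u hu)]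
  constructor <;> intro e
  · field_simp at e
    linear_combination e
  · field_simp
    linear_combination e

/-- Two inverse Böttcher coordinates agree on the smaller disc. -/
theorem Y_eq {r' : ℝ} {Y' S' : ℂ → ℂ} (h : IsInvBottcher a r Y S)
    (h' : IsInvBottcher a r' Y' S') {u : ℂ} (hu : u ∈ ball (0 : ℂ) r) (hu' : u ∈ ball (0 : ℂ) r') :
    Y u = Y' u := by
  have hm : 0 < min r r' := lt_min h.pos h'.pos
  refine (h.mono hm (min_le_left _ _)).unique (h'.mono hm (min_le_right _ _)) ?_
  rw [mem_ball] at *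
  exact lt_min hu hu'

end IsInvBottcher

/-- For parameters in the exterior capture component the inverse Böttcher coordinate can be
continued until it attains the critical value. -/
theorem exists_isInvBottcher_critical_value {a : ℂ} (haP : a ∈ exteriorComponent) :
    ∃ (r : ℝ) (Y S : ℂ → ℂ) (u : ℂ), IsInvBottcher a r Y S ∧ u ∈ ball (0 : ℂ) r ∧
      Y u - u + a * u = 0 := by
  obtain ⟨ha, hab⟩ := haP
  have hb : ((-a : ℂ) : OnePoint ℂ) ∈ basin a := connectedComponentIn_subset _ _ hab
  by_contra hcon
  push Not at hcon
  obtain ⟨r₀, Y₀, S₀, h₀⟩ := exists_isInvBottcher a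
  -- If -a is never met, each extension replaces the radius by its square root, so the radii tend to
  -- 1.
  have hext : ∀ n : ℕ, ∃ (ρ : ℝ) (Y S : ℂ → ℂ), IsInvBottcher a ρ Y S ∧ ρ ^ 2 ^ n = r₀ := by
    intro n
    induction n with
    | zero => exact ⟨r₀, Y₀, S₀, h₀, by simp⟩
    | succ n ih =>
      obtain ⟨ρ, Y, S, h, hρ⟩ := ih
      obtain ⟨Y', S', h'⟩ := h.exists_extension (fun t ht => hcon ρ Y S t h ht)
        (fun t ht h0 => absurd h0 (h.gmap_ne ha hb ht))
      refine ⟨√ρ, Y', S', h', ?_⟩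
      rw [pow_succ', pow_mul, Real.sq_sqrt h.pos.le, hρ]
  have hall : ∀ s : ℝ, 0 ≤ s → s < 1 →
      ∃ (ρ : ℝ) (Y S : ℂ → ℂ), IsInvBottcher a ρ Y S ∧ s < ρ := by
    intro s hs0 hs
    have ht : Tendsto (fun n : ℕ => s ^ 2 ^ n) atTop (𝓝 0) :=
      (tendsto_pow_atTop_nhds_zero_of_lt_one hs0 hs).comp
        (tendsto_pow_atTop_atTop_of_one_lt one_lt_two)
    obtain ⟨n, hn⟩ := (ht.eventually_lt_const h₀.pos).exists
    obtain ⟨ρ, Y, S, h, hρ⟩ := hext n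
    refine ⟨ρ, Y, S, h, ?_⟩
    rw [← hρ] at hn
    exact lt_of_pow_lt_pow_left₀ _ h.pos.le hn
  set W : Set (OnePoint ℂ) := {z | ∃ (r : ℝ) (Y S : ℂ → ℂ) (u : ℂ), IsInvBottcher a r Y S ∧
    u ∈ ball (0 : ℂ) r ∧ invChart (gmap Y u) = z} with hW
  have hopen : ∀ {r : ℝ} {Y S : ℂ → ℂ}, IsInvBottcher a r Y S →
      IsOpen (invChart '' (gmap Y '' ball 0 r)) := fun h =>
    isOpenMap_invChart _ (isOpen_image_of_injOn isOpen_ball h.diff_gmap (h.injOn ha hb))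
  have hWo : IsOpen W := by
    rw [isOpen_iff_mem_nhds]
    rintro _ ⟨r, Y, S, u, h, hu, rfl⟩
    refine mem_of_superset ((hopen h).mem_nhds ⟨_, ⟨u, hu, rfl⟩, rfl⟩) ?_
    rintro _ ⟨_, ⟨v, hv, rfl⟩, rfl⟩
    exact ⟨r, Y, S, v, h, hv, rfl⟩
  -- `W`, the union of all images, is open and relatively closed in the connected immediate basin,
  -- hence fills it and contains -a.
  have hsub : immediateBasin a ⊆ W := by
    refine isPreconnected_connectedComponentIn.subset_of_closure_inter_subset hWo
      ⟨∞, mem_connectedComponentIn infty_mem_basin,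
        r₀, Y₀, S₀, 0, h₀, h₀.zero_mem, by simp [IsInvBottcher.gmap_zero]⟩ ?_
    rintro z ⟨hzc, hzi⟩
    have hzb : z ∈ basin a := connectedComponentIn_subset _ _ hzi
    have hε : 0 < r₀ / 2 := half_pos h₀.pos
    have hε1 : r₀ / 2 < 1 := by linarith [h₀.le_one]
    have hh := h₀.mono hε (half_le_self h₀.pos.le)
    set ε := r₀ / 2
    set V := invChart '' (gmap Y₀ '' ball 0 ε)
    have hVo : IsOpen V := hopen hh
    have hV : V ∈ 𝓝 ∞ := hVo.mem_nhds ⟨_, ⟨0, hh.zero_mem, rfl⟩, by simp [IsInvBottcher.gmap_zero]⟩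
    obtain ⟨N, hN⟩ := (Tendsto.eventually hzb hV).exists
    have hcontN : Continuous ((ratMap a)^[2 * N]) := (continuous_ratMap ha).iterate _
    set ρ : ℝ := ε ^ (((2 ^ N : ℕ) : ℝ)⁻¹)
    have hρ0 : 0 ≤ ρ := Real.rpow_nonneg hε.le _
    have hρ1 : ρ < 1 := Real.rpow_lt_one hε.le hε1 (by positivity)
    have hρ : ρ ^ 2 ^ N = ε := Real.rpow_inv_natCast_pow hε.le (by positivity)
    obtain ⟨ρ₁, Y₁, S₁, h₁, hρ₁⟩ := hall ρ hρ0 hρ1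
    have hK : IsClosed ((fun u => invChart (gmap Y₁ u)) '' closedBall 0 ρ) :=
      ((isCompact_closedBall (0 : ℂ) ρ).image_of_continuousOn
        (h₁.continuousOn_invChart_gmap.mono (closedBall_subset_ball hρ₁))).isClosed
    have hz' := (hVo.preimage hcontN).inter_closure ⟨hN, hzc⟩
    -- Points of `W` sent into `V` by the 2N-th iterate satisfy |u|^(2^N) < ε, that is |u| < ρ, and
    -- so lie in a compact image; a limit of such points stays in `W`.
    have hsubK : (ratMap a)^[2 * N] ⁻¹' V ∩ W ⊆
        (fun u => invChart (gmap Y₁ u)) '' closedBall 0 ρ := by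
      rintro _ ⟨hx, r, Y, S, u, h, hu, rfl⟩
      obtain ⟨_, ⟨v, hv, rfl⟩, hvx⟩ := hx
      rw [h.iterate_invChart_gmap ha hu] at hvx
      have hvx := injective_invChart hvx
      have ht := pow_mem_ball h.le_one hu N
      have hlt : ‖u ^ 2 ^ N‖ < ε := by
        rcases le_or_gt r ε with hr | hr
        · exact (mem_ball_zero_iff.1 ht).trans_le hr
        · have hvr : v ∈ ball (0 : ℂ) r := ball_subset_ball hr.le hv
          rw [gmap, hh.Y_eq h hv hvr] at hvx
          rw [← h.injOn ha hb hvr ht hvx]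
          exact mem_ball_zero_iff.1 hv
      rw [norm_pow, ← hρ] at hlt
      have hlt := lt_of_pow_lt_pow_left₀ _ hρ0 hlt
      refine ⟨u, by simpa using hlt.le, ?_⟩
      simp only [gmap, h.Y_eq h₁ hu (by simpa using hlt.trans hρ₁)]
    obtain ⟨u, hu, rfl⟩ := hK.closure_subset_iff.2 hsubK hz'
    exact ⟨ρ₁, Y₁, S₁, u, h₁, closedBall_subset_ball hρ₁ hu, rfl⟩
  obtain ⟨r, Y, S, u, h, hu, hz⟩ := hsub hab
  rw [← invChart_neg_inv ha] at hz
  exact hcon r Y S u h hu ((h.gmap_eq_neg_inv_iff ha hu).1 (injective_invChart hz))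

/-! ### The parameter plane -/

/-- The numerator factor is at most 10/3 and |1 + 2ζ| at least 5/6. With |ζ| ≤ 1/12 the map at least
halves the norm. -/
theorem norm_hmap_le {a ζ : ℂ} (h1 : ‖ζ‖ ≤ 1 / 12) (h2 : ‖a‖ * ‖ζ‖ ^ 2 ≤ 1) :
    ‖hmap a ζ‖ ≤ 6 * ‖ζ‖ ^ 2 := by
  have hn := norm_nonneg ζ
  have hd : 5 / 6 ≤ ‖1 + 2 * ζ‖ := by
    have h3 : (1 : ℂ) = (1 + 2 * ζ) - 2 * ζ := by ring
    have h4 : ‖(1 : ℂ)‖ ≤ ‖1 + 2 * ζ‖ + ‖2 * ζ‖ := by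
      conv_lhs => rw [h3]
      exact norm_sub_le _ _
    norm_num at h4
    linarith
  have hnum : ‖2 + 4 * ζ + a * ζ ^ 2‖ ≤ 10 / 3 := by
    refine norm_add₃_le.trans ?_
    rw [norm_mul a, norm_pow]
    norm_num
    linarith
  unfold hmap
  rw [norm_div, norm_mul, norm_pow, norm_pow, div_le_iff₀ (by positivity)]
  have hd2 : (5 / 6 : ℝ) ^ 2 ≤ ‖1 + 2 * ζ‖ ^ 2 := by gcongr
  nlinarith [sq_nonneg ‖ζ‖, mul_le_mul_of_nonneg_left hnum (sq_nonneg ‖ζ‖),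
    mul_le_mul_of_nonneg_left hd2 (sq_nonneg ‖ζ‖)]

theorem one_add_two_mul_ne_zero {ζ : ℂ} (h1 : ‖ζ‖ ≤ 1 / 12) : 1 + 2 * ζ ≠ 0 := by
  intro h
  have : ‖(-1 : ℂ)‖ = ‖2 * ζ‖ := by
    congr 1
    linear_combination -h
  norm_num at this
  linarith

theorem invChart_ball_subset_immediateBasin {a : ℂ} (ha : a ≠ 0) {δ : ℝ} (hδ0 : 0 < δ)
    (hδ : δ ≤ 1 / 12) (haδ : ‖a‖ * δ ^ 2 ≤ 1) : invChart '' ball 0 δ ⊆ immediateBasin a := by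
  refine subset_immediateBasin
    ((convex_ball (0 : ℂ) δ).isPreconnected.image _ continuous_invChart.continuousOn)
    ⟨0, mem_ball_self hδ0, invChart_zero⟩ ?_
  rintro _ ⟨ζ, hζ, rfl⟩
  have hζ := mem_ball_zero_iff.1 hζ
  have key : ∀ n : ℕ, ‖(hmap a)^[n] ζ‖ ≤ (1 / 2) ^ n * ‖ζ‖ ∧
      (ratMap a)^[2 * n] (invChart ζ) = invChart ((hmap a)^[n] ζ) := by
    intro n
    induction n with
    | zero => simp
    | succ n ih =>
      obtain ⟨h1, h2⟩ := ih
      have hle : ‖(hmap a)^[n] ζ‖ ≤ δ := by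
        refine h1.trans (le_trans ?_ hζ.le)
        exact mul_le_of_le_one_left (norm_nonneg _) (pow_le_one₀ (by norm_num) (by norm_num))
      have h12 : ‖(hmap a)^[n] ζ‖ ≤ 1 / 12 := hle.trans hδ
      have h3 := norm_hmap_le (a := a) h12
        (le_trans (by gcongr) haδ)
      rw [Function.iterate_succ_apply']
      constructor
      · rw [pow_succ]
        nlinarith [norm_nonneg ((hmap a)^[n] ζ)]
      · rw [show 2 * (n + 1) = 2 + 2 * n by ring, Function.iterate_add_apply, h2,
          ratMap_iterate_two_invChart ha (one_add_two_mul_ne_zero h12)]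
  have hlim : Tendsto (fun n => (hmap a)^[n] ζ) atTop (𝓝 0) := by
    refine squeeze_zero_norm (fun n => (key n).1) ?_
    have := (tendsto_pow_atTop_nhds_zero_of_lt_one (r := (1 / 2 : ℝ)) (by norm_num)
      (by norm_num)).mul_const ‖ζ‖
    simpa using this
  have := (continuous_invChart.tendsto 0).comp hlim
  rw [invChart_zero] at this
  exact this.congr fun n => ((key n).2).symm

/-- Iterating 6|h(ζ)| ≤ (6|ζ|)² gives 6|g(t^(2ⁿ))| ≤ (6|g(t)|)^(2ⁿ), while |t^(2ⁿ)| ≤ 4|g(t^(2ⁿ))|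
for some large n; then take 2ⁿ-th roots, which removes the constants. -/
theorem IsInvBottcher.norm_le_six_mul_gmap {a : ℂ} {r : ℝ} {Y S : ℂ → ℂ}
    (h : IsInvBottcher a r Y S) {t : ℂ} (ht : t ∈ ball (0 : ℂ) r) (h1 : ‖gmap Y t‖ ≤ 1 / 12)
    (h2 : ‖a‖ * ‖gmap Y t‖ ^ 2 ≤ 1) : ‖t‖ ≤ 6 * ‖gmap Y t‖ := by
  have key : ∀ n : ℕ, ‖gmap Y (t ^ 2 ^ n)‖ ≤ ‖gmap Y t‖ ∧
      6 * ‖gmap Y (t ^ 2 ^ n)‖ ≤ (6 * ‖gmap Y t‖) ^ 2 ^ n := by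
    intro n
    induction n with
    | zero => simp
    | succ n ih =>
      obtain ⟨k1, k2⟩ := ih
      have k3 := norm_hmap_le (a := a) (k1.trans h1) (le_trans (by gcongr) h2)
      rw [h.hmap_gmap (pow_mem_ball h.le_one ht n), ← pow_mul, ← pow_succ] at k3
      have hn := norm_nonneg (gmap Y (t ^ 2 ^ n))
      refine ⟨by nlinarith, ?_⟩
      rw [pow_succ 2 n, pow_mul (6 * ‖gmap Y t‖)]
      calc 6 * ‖gmap Y (t ^ (2 ^ n * 2))‖ ≤ (6 * ‖gmap Y (t ^ 2 ^ n)‖) ^ 2 := by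
            rw [pow_succ 2 n] at k3
            linarith
        _ ≤ _ := by gcongr
  have ht1 : ‖t‖ < 1 := (mem_ball_zero_iff.1 ht).trans_le h.le_one
  have hev : ∀ᶠ v in 𝓝 (0 : ℂ), ‖Y v - v‖ < 4 := by
    have : ContinuousAt (fun v => ‖Y v - v‖) 0 := (h.continuousAt_Y.sub continuousAt_id).norm
    apply this.eventually_lt_const
    simp [h.Y_zero]; norm_num
  obtain ⟨n, hn⟩ := ((tendsto_pow_two_pow ht1).eventually hev).exists
  have hmem := pow_mem_ball h.le_one ht n
  have hpos : 0 < ‖Y (t ^ 2 ^ n) - t ^ 2 ^ n‖ := norm_pos_iff.2 (h.den_ne_zero _ hmem)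
  have h3 : ‖t ^ 2 ^ n‖ ≤ 4 * ‖gmap Y (t ^ 2 ^ n)‖ := by
    rw [gmap, norm_div, mul_div_assoc', le_div_iff₀ hpos]
    nlinarith [norm_nonneg (t ^ 2 ^ n)]
  have h4 : ‖t‖ ^ 2 ^ n ≤ (6 * ‖gmap Y t‖) ^ 2 ^ n := by
    rw [← norm_pow]
    linarith [(key n).2, norm_nonneg (gmap Y (t ^ 2 ^ n))]
  exact le_of_pow_le_pow_left₀ (by positivity) (by positivity) h4

/-- `u` is the reciprocal of the Böttcher coordinate of the critical value `-a`. -/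
def IsCritCoord (a u : ℂ) : Prop :=
  ∃ (r : ℝ) (Y S : ℂ → ℂ), IsInvBottcher a r Y S ∧ u ∈ ball (0 : ℂ) r ∧ Y u - u + a * u = 0

theorem IsCritCoord.mem_exteriorComponent {a u : ℂ} (ha : a ≠ 0) (h : IsCritCoord a u) :
    a ∈ exteriorComponent := by
  obtain ⟨r, Y, S, h, hu, he⟩ := h
  refine ⟨ha, ?_⟩
  rw [← invChart_neg_inv ha, ← (h.gmap_eq_neg_inv_iff ha hu).2 he]
  exact h.image_subset_immediateBasin ha ⟨u, hu, rfl⟩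

theorem mem_basin_of_mem_exteriorComponent {a : ℂ} (ha : a ∈ exteriorComponent) :
    ((-a : ℂ) : OnePoint ℂ) ∈ basin a := connectedComponentIn_subset _ _ ha.2

theorem IsCritCoord.unique {a u u' : ℂ} (ha : a ∈ exteriorComponent) (h : IsCritCoord a u)
    (h' : IsCritCoord a u') : u = u' := by
  obtain ⟨r, Y, S, h, hu, he⟩ := h
  obtain ⟨r', Y', S', h', hu', he'⟩ := h'
  have hb := mem_basin_of_mem_exteriorComponent ha
  rcases le_total r r' with hr | hr
  · have hu2 := ball_subset_ball hr hu
    rw [h.Y_eq h' hu hu2] at he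
    exact h'.injOn ha.1 hb hu2 hu' (((h'.gmap_eq_neg_inv_iff ha.1 hu2).2 he).trans
      ((h'.gmap_eq_neg_inv_iff ha.1 hu').2 he').symm)
  · have hu2 := ball_subset_ball hr hu'
    rw [h'.Y_eq h hu' hu2] at he'
    exact h.injOn ha.1 hb hu hu2 (((h.gmap_eq_neg_inv_iff ha.1 hu).2 he).trans
      ((h.gmap_eq_neg_inv_iff ha.1 hu2).2 he').symm)

open Classical in
/-- The reciprocal of the Böttcher coordinate of the critical value `-a`, for `a ∈ P_∞`. -/
def critCoord (a : ℂ) : ℂ := if h : ∃ u, IsCritCoord a u then h.choose else 0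

theorem isCritCoord_critCoord {a : ℂ} (ha : a ∈ exteriorComponent) :
    IsCritCoord a (critCoord a) := by
  have h : ∃ u, IsCritCoord a u := by
    obtain ⟨r, Y, S, u, h⟩ := exists_isInvBottcher_critical_value ha
    exact ⟨u, r, Y, S, h⟩
  rw [critCoord, dif_pos h]
  exact h.choose_spec

theorem IsCritCoord.critCoord_eq {a u : ℂ} (ha : a ∈ exteriorComponent) (h : IsCritCoord a u) :
    critCoord a = u := (isCritCoord_critCoord ha).unique ha h

theorem IsCritCoord.ne_zero {a u : ℂ} (h : IsCritCoord a u) : u ≠ 0 := by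
  rintro rfl
  obtain ⟨r, Y, S, h, hu, he⟩ := h
  simp [h.Y_zero] at he

theorem IsCritCoord.norm_lt_one {a u : ℂ} (h : IsCritCoord a u) : ‖u‖ < 1 := by
  obtain ⟨r, Y, S, h, hu, he⟩ := h
  exact (mem_ball_zero_iff.1 hu).trans_le h.le_one

/-- Use a u = u - Y(u) and the radius-free bound with κ = |a||u|². The result reads |a||u|(1 - |u|)
≤ 4 and bounds a while u stays away from 0 and from the unit circle. -/
theorem IsCritCoord.norm_mul_le {a u : ℂ} (h : IsCritCoord a u) :
    ‖a‖ * ‖u‖ ≤ 4 + ‖a‖ * ‖u‖ * ‖u‖ := by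
  have hu1 := h.norm_lt_one
  obtain ⟨r, Y, S, h, hu, he⟩ := h
  have h1 := h.norm_le (κ := ‖a‖ * ‖u‖ ^ 2) (by positivity) u hu le_rfl
  have h2 : a * u = u - Y u := by linear_combination he
  have h3 : ‖a‖ * ‖u‖ ≤ ‖u‖ + ‖Y u‖ := by
    rw [← norm_mul, h2]; exact norm_sub_le _ _
  nlinarith

/-- Injectivity keeps -a out of the image of the open disc of radius |u|, and R_a(-a) is not in the
basin, so one extension is possible. The gain from |u| to √|u| is the margin that the compactness
arguments need. -/
theorem exists_isInvBottcher_sqrt {a : ℂ} (ha : a ∈ exteriorComponent) :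
    ∃ Y S : ℂ → ℂ, IsInvBottcher a (√‖critCoord a‖) Y S ∧
      Y (critCoord a) - critCoord a + a * critCoord a = 0 := by
  have hc := isCritCoord_critCoord ha
  have h0 := hc.ne_zero
  have h1 := hc.norm_lt_one
  obtain ⟨r, Y, S, h, hu, he⟩ := hc
  set u := critCoord a
  have hb := mem_basin_of_mem_exteriorComponent ha
  have hur := mem_ball_zero_iff.1 hu
  have hpos : 0 < ‖u‖ := norm_pos_iff.2 h0
  have h' := h.mono hpos hur.le
  obtain ⟨Y', S', hY'⟩ := h'.exists_extension (by
    intro t ht h2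
    have htr := ball_subset_ball hur.le ht
    have := h.injOn ha.1 hb htr hu (((h.gmap_eq_neg_inv_iff ha.1 htr).2 h2).trans
      ((h.gmap_eq_neg_inv_iff ha.1 hu).2 he).symm)
    rw [this] at ht
    simp at ht) (fun t ht h2 => absurd h2 (h'.gmap_ne ha.1 hb ht))
  refine ⟨Y', S', hY', ?_⟩
  rw [← h.Y_eq hY' hu ?_]
  · exact he
  · rw [mem_ball_zero_iff]
    apply Real.lt_sqrt_of_sq_lt
    nlinarith

theorem lt_sqrt_critCoord {a : ℂ} (ha : a ∈ exteriorComponent) :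
    ‖critCoord a‖ < √‖critCoord a‖ := by
  have hc := isCritCoord_critCoord ha
  apply Real.lt_sqrt_of_sq_lt
  have := norm_pos_iff.2 hc.ne_zero
  nlinarith [hc.norm_lt_one]

/-- This is the Schwarz estimate for Y - 2 on the disc of radius r = √|u|, where |a|r² = |a||u|,
combined with a u = u - Y(u). -/
theorem norm_mul_critCoord_add_two_le {a : ℂ} (ha : a ∈ exteriorComponent) :
    ‖a * critCoord a + 2‖ ≤ (5 + ‖a‖ * ‖critCoord a‖) * √‖critCoord a‖ + ‖critCoord a‖ := by
  obtain ⟨Y, S, h, he⟩ := exists_isInvBottcher_sqrt ha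
  have hlt := lt_sqrt_critCoord ha
  set u := critCoord a
  have hs : √‖u‖ ^ 2 = ‖u‖ := Real.sq_sqrt (norm_nonneg _)
  have h1 := h.norm_sub_two_le (κ := ‖a‖ * ‖u‖) (by rw [hs]) (u := u) (by simpa using hlt)
  have h2 : a * u + 2 = u - (Y u - 2) := by linear_combination he
  rw [h2]
  refine (norm_sub_le _ _).trans ?_
  have h3 : (5 + ‖a‖ * ‖u‖) / √‖u‖ * ‖u‖ = (5 + ‖a‖ * ‖u‖) * √‖u‖ := by
    nth_rewrite 3 [← hs]
    have := h.pos
    field_simp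
  rw [h3] at h1
  linarith

/-- The disc |ζ| < 1/√|a| lies in the immediate basin as soon as 1/√|a| ≤ 1/12, whence 144, and it
contains ζ = -1/a. -/
theorem mem_exteriorComponent_of_large {a : ℂ} (ha : 144 ≤ ‖a‖) : a ∈ exteriorComponent := by
  have ha0 : a ≠ 0 := by
    rintro rfl
    norm_num at ha
  have hpos : 0 < ‖a‖ := by linarith
  have hsq : 12 ≤ √‖a‖ := Real.le_sqrt_of_sq_le (by norm_num; exact ha)
  refine ⟨ha0, ?_⟩
  rw [← invChart_neg_inv ha0]
  refine invChart_ball_subset_immediateBasin ha0 (δ := 1 / √‖a‖) (by positivity) ?_ ?_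
    ⟨_, ?_, rfl⟩
  · exact one_div_le_one_div_of_le (by norm_num) hsq
  · rw [div_pow, Real.sq_sqrt hpos.le]
    field_simp
    norm_num
  · rw [mem_ball_zero_iff, norm_neg, norm_inv, ← one_div]
    apply one_div_lt_one_div_of_lt (by linarith)
    nlinarith [Real.sq_sqrt hpos.le]

theorem norm_critCoord_le {a : ℂ} (ha : 144 ≤ ‖a‖) : ‖critCoord a‖ ≤ 6 / ‖a‖ := by
  have haP := mem_exteriorComponent_of_large ha
  obtain ⟨r, Y, S, h, hu, he⟩ := isCritCoord_critCoord haP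
  have hpos : 0 < ‖a‖ := by linarith
  have hg : ‖gmap Y (critCoord a)‖ = 1 / ‖a‖ := by
    rw [(h.gmap_eq_neg_inv_iff haP.1 hu).2 he, norm_neg, norm_inv, one_div]
  have := h.norm_le_six_mul_gmap hu (by
    rw [hg]; exact one_div_le_one_div_of_le (by norm_num) (by linarith)) (by
    rw [hg]; field_simp; linarith)
  rw [hg] at this
  rwa [mul_one_div] at this

/-- A compact connected set `C` joins ∞ to the critical value inside the basin, and a fixed iterate
sends it into `V`, a disc lying in the basin for all nearby parameters. By compactness this persists
for nearby a; a small ball around -a₀ then connects `C` to -a. -/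
theorem isOpen_exteriorComponent : IsOpen exteriorComponent := by
  rw [isOpen_iff_mem_nhds]
  intro a₀ ha₀
  have hc := isCritCoord_critCoord ha₀
  have hu1 := hc.norm_lt_one
  obtain ⟨r, Y, S, h, hu, he⟩ := hc
  set u₀ := critCoord a₀
  have hur := mem_ball_zero_iff.1 hu
  obtain ⟨δ, hδ0, hδ12, haδ⟩ : ∃ δ : ℝ, 0 < δ ∧ δ ≤ 1 / 12 ∧ (‖a₀‖ + 1) * δ ^ 2 ≤ 1 := by
    have hpos : 0 < ‖a₀‖ + 1 := by positivity
    refine ⟨1 / (12 * (‖a₀‖ + 1)), by positivity, ?_, ?_⟩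
    · apply one_div_le_one_div_of_le (by norm_num)
      linarith [norm_nonneg a₀]
    · rw [div_pow, one_pow, mul_one_div, div_le_one (by positivity)]
      nlinarith [norm_nonneg a₀]
  set V := invChart '' ball 0 δ
  have hVo : IsOpen V := isOpenMap_invChart _ isOpen_ball
  have hg0 : ∀ᶠ t in 𝓝 (0 : ℂ), gmap Y t ∈ ball (0 : ℂ) δ := by
    apply (h.diff_gmap.differentiableAt h.ball_mem).continuousAt
    rw [IsInvBottcher.gmap_zero]
    exact ball_mem_nhds _ hδ0
  obtain ⟨η, hη, hηb⟩ := Metric.mem_nhds_iff.1 hg0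
  have hlim : Tendsto (fun n : ℕ => ‖u₀‖ ^ 2 ^ n) atTop (𝓝 0) :=
    (tendsto_pow_atTop_nhds_zero_of_lt_one (norm_nonneg _) hu1).comp
      (tendsto_pow_atTop_atTop_of_one_lt one_lt_two)
  obtain ⟨N, hN⟩ := (hlim.eventually_lt_const hη).exists
  set C := (fun u => invChart (gmap Y u)) '' closedBall 0 ‖u₀‖
  have hsubr : closedBall (0 : ℂ) ‖u₀‖ ⊆ ball 0 r := closedBall_subset_ball hur
  have hCc : IsCompact C := (isCompact_closedBall _ _).image_of_continuousOn
    (h.continuousOn_invChart_gmap.mono hsubr)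
  have hCp : IsPreconnected C := (convex_closedBall (0 : ℂ) _).isPreconnected.image _
    (h.continuousOn_invChart_gmap.mono hsubr)
  have hC0 : ∞ ∈ C := ⟨0, by simp, by simp [IsInvBottcher.gmap_zero]⟩
  have hCa : ((-a₀ : ℂ) : OnePoint ℂ) ∈ C :=
    ⟨u₀, by simp, by
      simp only [(h.gmap_eq_neg_inv_iff ha₀.1 hu).2 he, invChart_neg_inv ha₀.1]⟩
  have hCV : ∀ z ∈ C, (ratMap a₀)^[2 * N] z ∈ V := by
    rintro _ ⟨u, hu', rfl⟩
    simp only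
    rw [h.iterate_invChart_gmap ha₀.1 (hsubr hu')]
    refine ⟨_, hηb ?_, rfl⟩
    rw [mem_ball_zero_iff, norm_pow]
    refine lt_of_le_of_lt ?_ hN
    gcongr
    simpa using hu'
  have hnear : ∀ z ∈ C, ∀ᶠ p : ℂ × OnePoint ℂ in 𝓝 (a₀, z), (ratMap p.1)^[2 * N] p.2 ∈ V :=
    fun z hz => (continuousAt_ratMap_iterate_uncurry ha₀.1 (2 * N) z).eventually
      (hVo.mem_nhds (hCV z hz))
  have hev1 : ∀ᶠ a in 𝓝 a₀, ∀ z ∈ C, (ratMap a)^[2 * N] z ∈ V :=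
    hCc.eventually_forall_of_forall_eventually hnear
  have hev2 : ∀ᶠ p : ℂ × ℂ in 𝓝 (a₀, -a₀), (ratMap p.1)^[2 * N] (p.2 : OnePoint ℂ) ∈ V := by
    have hcont : ContinuousAt (fun p : ℂ × ℂ => (p.1, (p.2 : OnePoint ℂ))) (a₀, -a₀) :=
      continuousAt_fst.prodMk (continuous_coe.continuousAt.comp continuousAt_snd)
    exact hcont.eventually (hnear _ hCa)
  rw [nhds_prod_eq] at hev2
  obtain ⟨pa, hpa, pb, hpb, hprod⟩ := eventually_prod_iff.1 hev2
  obtain ⟨σ, hσ, hσb⟩ := Metric.eventually_nhds_iff_ball.1 hpb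
  have hneg : ∀ᶠ a in 𝓝 a₀, -a ∈ ball (-a₀) σ :=
    (continuous_neg.tendsto a₀).eventually (ball_mem_nhds _ hσ)
  have hna : ∀ᶠ a in 𝓝 a₀, ‖a‖ < ‖a₀‖ + 1 :=
    continuous_norm.continuousAt.eventually_lt_const (by linarith)
  filter_upwards [hev1, hpa, hneg, hna, isOpen_ne.mem_nhds ha₀.1] with a h1 h2 h3 h4 h5
  have hVb : V ⊆ basin a := (invChart_ball_subset_immediateBasin h5 hδ0 hδ12
    (le_trans (by gcongr) haδ)).trans (connectedComponentIn_subset _ _)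
  refine ⟨h5, ?_⟩
  set B := (fun z : ℂ => (z : OnePoint ℂ)) '' ball (-a₀) σ
  have hBp : IsPreconnected B :=
    (convex_ball (-a₀) σ).isPreconnected.image _ continuous_coe.continuousOn
  have hsub : C ∪ B ⊆ immediateBasin a := by
    refine subset_immediateBasin (IsPreconnected.union _ hCa ⟨_, mem_ball_self hσ, rfl⟩ hCp hBp)
      (Or.inl hC0) ?_
    rintro z (hz | ⟨w, hw, rfl⟩)
    · exact (iterate_mem_basin_iff N).1 (hVb (h1 z hz))
    · exact (iterate_mem_basin_iff N).1 (hVb (hprod h2 (hσb w hw)))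
  exact hsub (Or.inr ⟨_, h3, rfl⟩)

theorem isCompact_compl_exteriorComponent : IsCompact (exteriorComponentᶜ : Set ℂ) := by
  refine Metric.isCompact_of_isClosed_isBounded isOpen_exteriorComponent.isClosed_compl ?_
  refine (isBounded_closedBall (x := (0 : ℂ)) (r := 144)).subset fun a ha => ?_
  rw [mem_closedBall_zero_iff]
  by_contra h
  exact ha (mem_exteriorComponent_of_large (not_le.1 h).le)

/-- Limits of critical value coordinates. -/
theorem exteriorComponent_limit {a : ℕ → ℂ} {a₀ u₀ : ℂ} (ha : ∀ n, a n ∈ exteriorComponent)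
    (hlim : Tendsto a atTop (𝓝 a₀)) (hu : Tendsto (fun n => critCoord (a n)) atTop (𝓝 u₀))
    (hu0 : u₀ ≠ 0) (hu1 : ‖u₀‖ < 1) : a₀ ∈ exteriorComponent ∧ critCoord a₀ = u₀ := by
  have hpos := norm_pos_iff.2 hu0
  have hlt : ‖u₀‖ < √‖u₀‖ := Real.lt_sqrt_of_sq_lt (by nlinarith)
  obtain ⟨ρ, hρ1, hρ2⟩ := exists_between hlt
  have hev : ∀ᶠ n in atTop, ρ < √‖critCoord (a n)‖ :=
    ((Real.continuous_sqrt.tendsto _).comp hu.norm).eventually_const_lt hρ2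
  obtain ⟨n₀, hn₀⟩ := eventually_atTop.1 hev
  -- All these coordinates exist on the common radius ρ, strictly between |u₀| and √|u₀|, so the
  -- critical equation passes to a normal limit at the interior point u₀.
  choose Y S h he using fun n => exists_isInvBottcher_sqrt (ha (n + n₀))
  have hsh : Tendsto (fun n => a (n + n₀)) atTop (𝓝 a₀) := hlim.comp (tendsto_add_atTop_nat n₀)
  have hush : Tendsto (fun n => critCoord (a (n + n₀))) atTop (𝓝 u₀) :=
    hu.comp (tendsto_add_atTop_nat n₀)
  obtain ⟨φ, Y', S', hφ, h', hconv⟩ := exists_isInvBottcher_limit hsh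
    (fun n => (h n).mono (hpos.trans hρ1) (hn₀ (n + n₀) (Nat.le_add_left _ _)).le)
  have hub : u₀ ∈ ball (0 : ℂ) ρ := by simpa using hρ1
  have c1 := hush.comp hφ.tendsto_atTop
  have c2 := hsh.comp hφ.tendsto_atTop
  have c3 := hconv _ u₀ hub c1
  have hlim0 : Y' u₀ - u₀ + a₀ * u₀ = 0 := by
    refine tendsto_nhds_unique ((c3.sub c1).add (c2.mul c1)) ?_
    refine tendsto_const_nhds.congr fun n => ?_
    exact (he (φ n)).symm
  have ha0 : a₀ ≠ 0 := by
    rintro rfl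
    rw [zero_mul, add_zero] at hlim0
    exact h'.den_ne_zero u₀ hub hlim0
  have hcc : IsCritCoord a₀ u₀ := ⟨ρ, Y', S', h', hub, hlim0⟩
  have hP := hcc.mem_exteriorComponent ha0
  exact ⟨hP, hcc.critCoord_eq hP⟩

/-! ### Proper holomorphic maps of degree one -/

/-- `U` need not be known to be connected. The set where f is locally the constant f(z) is open, and
properness makes it closed in ℂ; it would then be all of ℂ, contradicting f'(0) ≠ 0. -/
theorem not_eventually_const_of_proper {U : Set ℂ} {f : ℂ → ℂ} (hU : IsOpen U)
    (hf : DifferentiableOn ℂ f U) (hmaps : MapsTo f U (ball 0 1))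
    (hproper : ∀ b : ℕ → ℂ, (∀ n, b n ∈ U) → ∀ c ∈ ball (0 : ℂ) 1,
      Tendsto (fun n => f (b n)) atTop (𝓝 c) →
      ∃ φ : ℕ → ℕ, StrictMono φ ∧ ∃ b₀ ∈ U, Tendsto (fun n => b (φ n)) atTop (𝓝 b₀) ∧ f b₀ = c)
    (hd : deriv f 0 ≠ 0) {z : ℂ} (hz : z ∈ U) : ¬ ∀ᶠ w in 𝓝 z, f w = f z := by
  intro hconst
  set T : Set ℂ := {b | ∀ᶠ w in 𝓝 b, f w = f z ∧ w ∈ U}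
  have hTz : z ∈ T := hconst.and (hU.mem_nhds hz)
  have hTo : IsOpen T := isOpen_setOfPred_eventually_nhds
  have hTc : IsClosed T := by
    refine IsSeqClosed.isClosed fun b b₁ hb hb₁ => ?_
    have hbU : ∀ n, f (b n) = f z ∧ b n ∈ U := fun n => (hb n).self_of_nhds
    obtain ⟨φ, hφ, b₀, hb₀, hlim, hfb⟩ := hproper b (fun n => (hbU n).2) (f z) (hmaps hz)
      (tendsto_const_nhds.congr fun n => ((hbU n).1).symm)
    obtain rfl : b₀ = b₁ := tendsto_nhds_unique hlim (hb₁.comp hφ.tendsto_atTop)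
    have han : AnalyticAt ℂ f b₀ := hf.analyticAt (hU.mem_nhds hb₀)
    have hfreq : ∃ᶠ w in 𝓝[≠] b₀, f w = f z := by
      intro hne
      obtain ⟨s, hs, hso, hbs⟩ := _root_.eventually_nhds_iff.1 (eventually_nhdsWithin_iff.1 hne)
      obtain ⟨n, hn⟩ := (hb₁.eventually (hso.mem_nhds hbs)).exists
      have h1 : ∀ᶠ w in 𝓝[≠] (b n), w ∈ s ∧ f w = f z :=
        eventually_nhdsWithin_of_eventually_nhds
          (Filter.Eventually.and (hso.mem_nhds hn) (Filter.Eventually.mono (hb n) fun w hw => hw.1))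
      have h2 : ∀ᶠ w in 𝓝[≠] (b n), w ≠ b₀ := by
        rcases eq_or_ne (b n) b₀ with h | h
        · rw [h]; exact self_mem_nhdsWithin
        · exact eventually_nhdsWithin_of_eventually_nhds (isOpen_ne.mem_nhds h)
      obtain ⟨w, ⟨hw1, hw2⟩, hw3⟩ := (h1.and h2).exists
      exact hs w hw1 hw3 hw2
    have := (han.frequently_eq_iff_eventually_eq analyticAt_const).1 hfreq
    exact this.and (hU.mem_nhds hb₀)
  have hTu : T = univ := IsClopen.eq_univ ⟨hTc, hTo⟩ ⟨z, hTz⟩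
  have h0 : (0 : ℂ) ∈ T := hTu ▸ mem_univ _
  apply hd
  have : f =ᶠ[𝓝 0] fun _ => f z := Filter.Eventually.mono h0 fun w hw => hw.1
  rw [this.deriv_eq, deriv_const]

/-- A proper holomorphic map onto the unit disc that attains the value `0` exactly once, with
nonzero derivative, is bijective. -/
theorem bijOn_of_proper {U : Set ℂ} {f : ℂ → ℂ} (hU : IsOpen U)
    (hf : DifferentiableOn ℂ f U) (hmaps : MapsTo f U (ball 0 1))
    (hproper : ∀ b : ℕ → ℂ, (∀ n, b n ∈ U) → ∀ c ∈ ball (0 : ℂ) 1,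
      Tendsto (fun n => f (b n)) atTop (𝓝 c) →
      ∃ φ : ℕ → ℕ, StrictMono φ ∧ ∃ b₀ ∈ U, Tendsto (fun n => b (φ n)) atTop (𝓝 b₀) ∧ f b₀ = c)
    (h0U : (0 : ℂ) ∈ U) (hf0 : f 0 = 0) (hd : deriv f 0 ≠ 0) (huniq : ∀ b ∈ U, f b = 0 → b = 0) :
    BijOn f U (ball 0 1) := by
  have hnc : ∀ z ∈ U, ¬ ∀ᶠ w in 𝓝 z, f w = f z := fun z hz =>
    not_eventually_const_of_proper hU hf hmaps hproper hd hz
  -- The values taken exactly once and with nonzero derivative form a set containing 0; properness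
  -- makes it open and relatively closed in the disc, which replaces a degree count.
  set S : Set ℂ := {c | c ∈ ball (0 : ℂ) 1 ∧ ∃ a ∈ U, f a = c ∧ deriv f a ≠ 0 ∧
    ∀ b ∈ U, f b = c → b = a}
  have hSo : IsOpen S := by
    rw [isOpen_iff_mem_nhds]
    rintro _ ⟨hcb, a, ha, rfl, hda, hua⟩
    have han : AnalyticAt ℂ f a := hf.analyticAt (hU.mem_nhds ha)
    obtain ⟨s₁, hs₁, hinj⟩ := exists_injOn_nhds_of_deriv_ne_zero han hda
    have hdev : ∀ᶠ w in 𝓝 a, deriv f w ≠ 0 := han.deriv.continuousAt.eventually_ne hda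
    set s := s₁ ∩ ({w | deriv f w ≠ 0} ∩ U)
    have hs : s ∈ 𝓝 a := inter_mem hs₁ (inter_mem hdev (hU.mem_nhds ha))
    have hfs : f '' s ∈ 𝓝 (f a) := by
      rw [← han.hasStrictDerivAt.map_nhds_eq hda]
      exact image_mem_map hs
    by_contra hS
    have hfreq : ∃ᶠ c in 𝓝 (f a), c ∉ S ∧ c ∈ f '' s ∧ c ∈ ball (0 : ℂ) 1 :=
      Filter.Frequently.and_eventually (fun h => hS (Filter.mem_of_superset h fun c hc => not_not.1 hc))
        (Filter.Eventually.and hfs (isOpen_ball.mem_nhds hcb))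
    obtain ⟨c, hc, hcp⟩ := exists_seq_forall_of_frequently hfreq
    have hb : ∀ n, ∃ b ∈ U, f b = c n ∧ b ∉ s := by
      intro n
      obtain ⟨h1, ⟨x, hx, hxc⟩, h3⟩ := hcp n
      by_contra hcon
      push Not at hcon
      exact h1 ⟨h3, x, hx.2.2, hxc, hx.2.1, fun b hb hbc =>
        hinj (hcon b hb hbc).1 hx.1 (hbc.trans hxc.symm)⟩
    choose b hbU hbc hbs using hb
    obtain ⟨φ, hφ, b₀, hb₀, hlim, hfb⟩ := hproper b hbU (f a) hcb (by simpa only [hbc] using hc)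
    obtain rfl := hua b₀ hb₀ hfb
    obtain ⟨n, hn⟩ := (hlim.eventually hs).exists
    exact hbs _ hn
  have hsub : ball (0 : ℂ) 1 ⊆ S := by
    refine (convex_ball (0 : ℂ) 1).isPreconnected.subset_of_closure_inter_subset hSo
      ⟨0, mem_ball_self one_pos, mem_ball_self one_pos, 0, h0U, hf0, hd, huniq⟩ ?_
    rintro c₀ ⟨hcl, hcb⟩
    obtain ⟨c, hcS, hc⟩ := mem_closure_iff_seq_limit.1 hcl
    choose hcb' a haU hac hda hua using hcS
    obtain ⟨φ, hφ, a₀, ha₀, hlim, hfa⟩ := hproper a haU c₀ hcb (by simpa only [hac] using hc)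
    refine ⟨hcb, a₀, ha₀, hfa, ?_, ?_⟩
    · refine deriv_ne_zero_of_tendsto hU hf ha₀ (hnc a₀ ha₀) hlim ?_ (fun n => hda (φ n))
      intro n b hb h
      exact hua (φ n) b hb (h.trans (hac _))
    -- A second preimage b of the limit value would, by openness of f near b, supply preimages of
    -- the approximating values near b and away from their unique preimages, which converge to `a₀`.
    · intro b hb hbc
      by_contra hne
      obtain ⟨A, B, hA, hB, hAb, hBb, hdis⟩ := t2_separation hne
      have hmap := ((hf.analyticAt (hU.mem_nhds hb)).eventually_constant_or_nhds_le_map_nhds).resolve_left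
        (hnc b hb)
      have himg : f '' (A ∩ U) ∈ 𝓝 (f b) :=
        hmap (image_mem_map (inter_mem (hA.mem_nhds hAb) (hU.mem_nhds hb)))
      rw [hbc] at himg
      obtain ⟨n, ⟨x, hx, hxc⟩, hn2⟩ := (((hc.comp hφ.tendsto_atTop).eventually himg).and
        (hlim.eventually (hB.mem_nhds hBb))).exists
      have := hua (φ n) x hx.2 hxc
      rw [this] at hx
      exact Set.disjoint_left.1 hdis hx.1 hn2
  refine ⟨hmaps, ?_, ?_⟩
  · intro x hx y hy hxy
    obtain ⟨-, a, -, -, -, hua⟩ := hsub (hmaps hx)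
    rw [hua x hx rfl, hua y hy hxy.symm]
  · intro c hc
    obtain ⟨-, a, ha, hac, -⟩ := hsub hc
    exact ⟨a, ha, hac⟩

/-! ### The critical value coordinate depends holomorphically on the parameter -/

theorem hmap_iterate_neg_inv {a : ℂ} {r : ℝ} {Y S : ℂ → ℂ} (h : IsInvBottcher a r Y S)
    (ha : a ≠ 0) {u : ℂ} (hu : u ∈ ball (0 : ℂ) r) (he : Y u - u + a * u = 0) (n : ℕ) :
    (hmap a)^[n] (-a⁻¹) = gmap Y (u ^ 2 ^ n) := by
  induction n with
  | zero => simpa using ((h.gmap_eq_neg_inv_iff ha hu).2 he).symm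
  | succ n ih =>
    rw [Function.iterate_succ_apply', ih, h.hmap_gmap (pow_mem_ball h.le_one hu n), ← pow_mul,
      ← pow_succ]

theorem differentiableOn_hmap_iterate (n : ℕ) :
    DifferentiableOn ℂ (fun a => (hmap a)^[n] (-a⁻¹)) exteriorComponent := by
  induction n with
  | zero =>
    simp only [Function.iterate_zero, id]
    exact (differentiableOn_id.inv fun a ha => ha.1).neg
  | succ n ih =>
    simp only [Function.iterate_succ_apply', hmap]
    refine DifferentiableOn.div (by fun_prop) (by fun_prop) ?_
    intro a ha
    obtain ⟨r, Y, S, h, hu, he⟩ := isCritCoord_critCoord ha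
    rw [hmap_iterate_neg_inv h ha.1 hu he]
    exact pow_ne_zero 2 (h.one_add_gmap_ne_zero (pow_mem_ball h.le_one hu n))

theorem hmap_iterate_ne_zero {a : ℂ} (ha : a ∈ exteriorComponent) (n : ℕ) :
    (hmap a)^[n] (-a⁻¹) ≠ 0 := by
  have h0 := (isCritCoord_critCoord ha).ne_zero
  obtain ⟨r, Y, S, h, hu, he⟩ := isCritCoord_critCoord ha
  rw [hmap_iterate_neg_inv h ha.1 hu he]
  exact div_ne_zero (pow_ne_zero _ h0) (h.den_ne_zero _ (pow_mem_ball h.le_one hu n))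

/-- By the conjugacy the quotient equals Y(t) - t at t = u^(2ⁿ), so it tends to Y(0) = 2 at the
Schwarz rate. -/
theorem norm_pow_div_hmap_iterate_sub_two_le {a : ℂ} (ha : a ∈ exteriorComponent) (n : ℕ) :
    ‖critCoord a ^ 2 ^ n / (hmap a)^[n] (-a⁻¹) - 2‖ ≤
      ((5 + ‖a‖ * ‖critCoord a‖) / √‖critCoord a‖ + 1) * ‖critCoord a‖ ^ 2 ^ n := by
  obtain ⟨Y, S, h, he⟩ := exists_isInvBottcher_sqrt ha
  have h0 := (isCritCoord_critCoord ha).ne_zero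
  have hlt := lt_sqrt_critCoord ha
  set u := critCoord a
  have hu : u ∈ ball (0 : ℂ) (√‖u‖) := by simpa using hlt
  have hm := pow_mem_ball h.le_one hu n
  have hs : √‖u‖ ^ 2 = ‖u‖ := Real.sq_sqrt (norm_nonneg _)
  have h1 := h.norm_sub_two_le (κ := ‖a‖ * ‖u‖) (by rw [hs]) hm
  rw [hmap_iterate_neg_inv h ha.1 hu he, gmap, div_div_cancel₀ (pow_ne_zero _ h0)]
  rw [norm_pow] at h1
  have e : Y (u ^ 2 ^ n) - u ^ 2 ^ n - 2 = (Y (u ^ 2 ^ n) - 2) - u ^ 2 ^ n := by ring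
  rw [e]
  refine (norm_sub_le _ _).trans ?_
  rw [norm_pow, add_mul, one_mul]
  linarith

/-- A fixed even iterate sends -a into |ζ| < 1/12 for all nearby a, where |t| ≤ 6|g(t)| ≤ 1/2 for t
= u^(2^N). This keeps u locally away from the unit circle. -/
theorem eventually_norm_critCoord_pow_le {a₀ : ℂ} (ha₀ : a₀ ∈ exteriorComponent) :
    ∃ N : ℕ, ∀ᶠ a in 𝓝 a₀, a ∈ exteriorComponent ∧ ‖critCoord a‖ ^ 2 ^ N ≤ 1 / 2 := by
  obtain ⟨δ, hδ0, hδ12, haδ⟩ : ∃ δ : ℝ, 0 < δ ∧ δ ≤ 1 / 12 ∧ (‖a₀‖ + 1) * δ ^ 2 ≤ 1 := by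
    have hpos : 0 < ‖a₀‖ + 1 := by positivity
    refine ⟨1 / (12 * (‖a₀‖ + 1)), by positivity, ?_, ?_⟩
    · apply one_div_le_one_div_of_le (by norm_num)
      linarith [norm_nonneg a₀]
    · rw [div_pow, one_pow, mul_one_div, div_le_one (by positivity)]
      nlinarith [norm_nonneg a₀]
  set V := invChart '' ball 0 δ
  have hVo : IsOpen V := isOpenMap_invChart _ isOpen_ball
  have hV : V ∈ 𝓝 ∞ := hVo.mem_nhds ⟨0, mem_ball_self hδ0, invChart_zero⟩
  obtain ⟨N, hN⟩ := (Tendsto.eventually (mem_basin_of_mem_exteriorComponent ha₀) hV).exists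
  refine ⟨N, ?_⟩
  have hcont : ContinuousAt (fun a : ℂ => (a, ((-a : ℂ) : OnePoint ℂ))) a₀ :=
    continuousAt_id.prodMk (continuous_coe.continuousAt.comp continuous_neg.continuousAt)
  have hev : ∀ᶠ a in 𝓝 a₀, (ratMap a)^[2 * N] ((-a : ℂ) : OnePoint ℂ) ∈ V :=
    hcont.eventually ((continuousAt_ratMap_iterate_uncurry ha₀.1 (2 * N) _).eventually
      (hVo.mem_nhds hN))
  have hna : ∀ᶠ a in 𝓝 a₀, ‖a‖ < ‖a₀‖ + 1 :=
    continuous_norm.continuousAt.eventually_lt_const (by linarith)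
  filter_upwards [hev, hna, isOpen_exteriorComponent.mem_nhds ha₀] with a h1 h2 ha
  refine ⟨ha, ?_⟩
  obtain ⟨r, Y, S, h, hu, he⟩ := isCritCoord_critCoord ha
  obtain ⟨ζ, hζ, hζe⟩ := h1
  have hζ := mem_ball_zero_iff.1 hζ
  rw [← invChart_neg_inv ha.1, ← (h.gmap_eq_neg_inv_iff ha.1 hu).2 he,
    h.iterate_invChart_gmap ha.1 hu] at hζe
  have hζe := injective_invChart hζe
  have hm := pow_mem_ball h.le_one hu N
  have := h.norm_le_six_mul_gmap hm (by rw [← hζe]; linarith) (by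
    rw [← hζe]
    exact le_trans (by gcongr) haδ)
  rw [← hζe, norm_pow] at this
  linarith

theorem continuousOn_critCoord : ContinuousOn critCoord exteriorComponent := by
  intro a₀ ha₀
  apply ContinuousAt.continuousWithinAt
  obtain ⟨N, hN⟩ := eventually_norm_critCoord_pow_le ha₀
  refine tendsto_of_subseq_tendsto fun x hx => ?_
  obtain ⟨n₀, hn₀⟩ := eventually_atTop.1 (hx.eventually hN)
  have hP : ∀ n, x (n + n₀) ∈ exteriorComponent := fun n => (hn₀ _ (Nat.le_add_left _ _)).1
  have hb : ∀ n, ‖critCoord (x (n + n₀))‖ ^ 2 ^ N ≤ 1 / 2 :=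
    fun n => (hn₀ _ (Nat.le_add_left _ _)).2
  have hx' : Tendsto (fun n => x (n + n₀)) atTop (𝓝 a₀) := hx.comp (tendsto_add_atTop_nat n₀)
  obtain ⟨u, -, φ, hφ, hu⟩ := (isCompact_closedBall (0 : ℂ) 1).tendsto_subseq
    (x := fun n => critCoord (x (n + n₀)))
    (fun n => by simpa using (isCritCoord_critCoord (hP n)).norm_lt_one.le)
  have hxφ := hx'.comp hφ.tendsto_atTop
  have hu1 : ‖u‖ < 1 := by
    have := le_of_tendsto' (hu.norm.pow (2 ^ N)) (fun n => hb (φ n))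
    by_contra h
    have := one_le_pow₀ (not_lt.1 h) (n := 2 ^ N)
    linarith
  -- With a bounded and u → 0, the left side of the estimate for |a u + 2| tends to 2 and the right
  -- side to 0.
  have hu0 : u ≠ 0 := by
    rintro rfl
    have h1 := fun n => norm_mul_critCoord_add_two_le (hP (φ n))
    have l1 : Tendsto (fun n => ‖x (φ n + n₀) * critCoord (x (φ n + n₀)) + 2‖) atTop
        (𝓝 ‖a₀ * 0 + 2‖) := ((hxφ.mul hu).add_const 2).norm
    have l2 : Tendsto (fun n => (5 + ‖x (φ n + n₀)‖ * ‖critCoord (x (φ n + n₀))‖) *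
        √‖critCoord (x (φ n + n₀))‖ + ‖critCoord (x (φ n + n₀))‖) atTop
        (𝓝 ((5 + ‖a₀‖ * ‖(0 : ℂ)‖) * √‖(0 : ℂ)‖ + ‖(0 : ℂ)‖)) :=
      ((tendsto_const_nhds.add (hxφ.norm.mul hu.norm)).mul
        ((Real.continuous_sqrt.tendsto _).comp hu.norm)).add hu.norm
    have := le_of_tendsto_of_tendsto' l1 l2 h1
    norm_num at this
  obtain ⟨-, hcc⟩ := exteriorComponent_limit (fun n => hP (φ n)) hxφ hu hu0 hu1
  refine ⟨fun n => φ n + n₀, ?_⟩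
  rw [hcc]
  exact hu

/-- Continuity keeps Im(k(f - f(z))) below π near z, so the principal logarithm of the quotient of
exponentials recovers f. -/
theorem differentiableAt_of_exp_mul {f : ℂ → ℂ} {z k : ℂ} (hk : k ≠ 0) (hf : ContinuousAt f z)
    (hd : DifferentiableAt ℂ (fun w => Complex.exp (k * f w)) z) : DifferentiableAt ℂ f z := by
  have hc : ContinuousAt (fun w => (k * (f w - f z)).im) z :=
    Complex.continuous_im.continuousAt.comp (continuousAt_const.mul (hf.sub continuousAt_const))
  have h1 : ∀ᶠ w in 𝓝 z, |(k * (f w - f z)).im| < Real.pi := by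
    apply hc.abs.eventually_lt_const
    simp [Real.pi_pos]
  have h2 : f =ᶠ[𝓝 z] fun w =>
      f z + Complex.log (Complex.exp (k * f w) * Complex.exp (-(k * f z))) / k := by
    filter_upwards [h1] with w hw
    rw [← Complex.exp_add, ← sub_eq_add_neg, ← mul_sub,
      Complex.log_exp (abs_lt.1 hw).1 (abs_lt.1 hw).2.le, mul_div_cancel_left₀ _ hk]
    ring
  refine DifferentiableAt.congr_of_eventuallyEq ?_ h2
  refine ((DifferentiableAt.clog (hd.mul_const _) ?_).div_const k).const_add _
  rw [← Complex.exp_add]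
  simp

theorem differentiableOn_critCoord : DifferentiableOn ℂ critCoord exteriorComponent := by
  intro a₀ ha₀
  apply DifferentiableAt.differentiableWithinAt
  set u₀ := critCoord a₀ with hu₀
  have hu₀0 : u₀ ≠ 0 := (isCritCoord_critCoord ha₀).ne_zero
  have hu₀1 : ‖u₀‖ < 1 := (isCritCoord_critCoord ha₀).norm_lt_one
  have hcont : ContinuousAt critCoord a₀ :=
    continuousOn_critCoord.continuousAt (isOpen_exteriorComponent.mem_nhds ha₀)
  obtain ⟨q, hq0, hq1⟩ := exists_between hu₀1
  have hq : 0 < q := (norm_nonneg _).trans_lt hq0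
  have hp0 := norm_pos_iff.2 hu₀0
  have e1 : ∀ᶠ a in 𝓝 a₀, ‖critCoord a‖ < q := hcont.norm.eventually_lt_const hq0
  have e2 : ∀ᶠ a in 𝓝 a₀, ‖u₀‖ / 2 < ‖critCoord a‖ :=
    hcont.norm.eventually_const_lt (by simp only [← hu₀]; linarith)
  have e3 : ∀ᶠ a in 𝓝 a₀, ‖a‖ < ‖a₀‖ + 1 :=
    continuous_norm.continuousAt.eventually_lt_const (by linarith)
  have e4 : ∀ᶠ a in 𝓝 a₀, ‖critCoord a / u₀ - 1‖ < 1 / 2 := by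
    have : ContinuousAt (fun a => ‖critCoord a / u₀ - 1‖) a₀ :=
      ((hcont.div_const u₀).sub continuousAt_const).norm
    apply this.eventually_lt_const
    simp [← hu₀, div_self hu₀0]
  obtain ⟨ρ, hρ, hB⟩ := Metric.eventually_nhds_iff_ball.1
    (e1.and (e2.and (e3.and (e4.and (isOpen_exteriorComponent.mem_nhds ha₀)))))
  set B := ball a₀ ρ
  have hBP : B ⊆ exteriorComponent := fun a ha => (hB a ha).2.2.2.2
  have hcB : ContinuousOn critCoord B := continuousOn_critCoord.mono hBP
  have hne : ∀ a ∈ B, critCoord a ≠ 0 := fun a ha => (isCritCoord_critCoord (hBP ha)).ne_zero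
  have hslit : ∀ x : ℂ, ‖x - 1‖ < 1 → x ∈ Complex.slitPlane := by
    intro x hx
    left
    have := (Complex.abs_re_le_norm (x - 1)).trans_lt hx
    simp at this
    linarith [(abs_lt.1 this).1]
  set L : ℂ → ℂ := fun a => Complex.log (critCoord a / u₀) with hL
  have hLc : ContinuousOn L B := by
    refine ContinuousOn.clog (hcB.div_const _) fun a ha => hslit _ ?_
    linarith [(hB a ha).2.2.2.1]
  set C : ℝ := (5 + (‖a₀‖ + 1) * 1) / √(‖u₀‖ / 2) + 1 with hC
  have hC0 : 0 ≤ C := by positivity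
  have hest : ∀ n : ℕ, ∀ a ∈ B, ‖critCoord a ^ 2 ^ n / (hmap a)^[n] (-a⁻¹) - 2‖ ≤ C * q ^ 2 ^ n := by
    intro n a ha
    obtain ⟨h1, h2, h3, h4, h5⟩ := hB a ha
    refine (norm_pow_div_hmap_iterate_sub_two_le h5 n).trans ?_
    have hle1 : ‖critCoord a‖ ≤ 1 := by linarith
    have : 0 < √(‖u₀‖ / 2) := Real.sqrt_pos.2 (by linarith)
    rw [hC]
    gcongr
  have hlim : Tendsto (fun n : ℕ => C * q ^ 2 ^ n) atTop (𝓝 0) := by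
    have := ((tendsto_pow_atTop_nhds_zero_of_lt_one hq.le hq1).comp
      (tendsto_pow_atTop_atTop_of_one_lt one_lt_two)).const_mul C
    simpa using this
  have hsmall : ∀ᶠ n : ℕ in atTop, C * q ^ 2 ^ n < 1 / 2 :=
    hlim.eventually_lt_const (by norm_num)
  set ξ : ℕ → ℂ → ℂ := fun n a => 2 * (hmap a)^[n] (-a⁻¹) / critCoord a ^ 2 ^ n with hξ
  have hξb : ∀ n : ℕ, C * q ^ 2 ^ n < 1 / 2 → ∀ a ∈ B, ‖ξ n a - 1‖ ≤ 1 / 2 := by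
    intro n hn a ha
    have h1 := (hest n a ha).trans hn.le
    have hz := hmap_iterate_ne_zero (hBP ha) n
    have hu := pow_ne_zero (2 ^ n) (hne a ha)
    set x := critCoord a ^ 2 ^ n / (hmap a)^[n] (-a⁻¹) with hx
    have hx0 : x ≠ 0 := div_ne_zero hu hz
    have e : ξ n a - 1 = (2 - x) / x := by
      simp only [hx, hξ]
      generalize (hmap a)^[n] (-a⁻¹) = z at hz
      field_simp
    have hxn : 3 / 2 ≤ ‖x‖ := by
      have h2 : ‖(2 : ℂ)‖ ≤ ‖x‖ + ‖x - 2‖ := by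
        have : (2 : ℂ) = x - (x - 2) := by ring
        conv_lhs => rw [this]
        exact norm_sub_le _ _
      norm_num at h2
      linarith
    rw [e, norm_div, norm_sub_rev, div_le_iff₀ (by linarith)]
    linarith
  -- This is a continuous 2ⁿ-th part of a logarithm of 2hⁿ(-1/a)/u₀^(2ⁿ), hence holomorphic although
  -- `L` is not yet known to be. Since ξ is within 1/2 of 1, the correction vanishes uniformly.
  set Q : ℕ → ℂ → ℂ := fun n a => L a + Complex.log (ξ n a) / 2 ^ n with hQ
  have hξc : ∀ n, ContinuousOn (ξ n) B := by
    intro n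
    refine ContinuousOn.div (continuousOn_const.mul
      ((differentiableOn_hmap_iterate n).mono hBP).continuousOn) (hcB.pow _) ?_
    exact fun a ha => pow_ne_zero _ (hne a ha)
  have hQd : ∀ᶠ n in atTop, DifferentiableOn ℂ (Q n) B := by
    filter_upwards [hsmall] with n hn a ha
    have hB' : B ∈ 𝓝 a := isOpen_ball.mem_nhds ha
    have hξs : ∀ a ∈ B, ξ n a ∈ Complex.slitPlane := fun a ha =>
      hslit _ (by linarith [hξb n hn a ha])
    refine (differentiableAt_of_exp_mul (k := 2 ^ n) (pow_ne_zero n two_ne_zero) ?_ ?_).differentiableWithinAt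
    · exact ((hLc.add (((hξc n).clog hξs).div_const _)).continuousAt hB')
    · have hdd : DifferentiableAt ℂ (fun a => 2 * (hmap a)^[n] (-a⁻¹) / u₀ ^ 2 ^ n) a :=
        ((((differentiableOn_hmap_iterate n).mono hBP).differentiableAt hB').const_mul 2).div_const _
      refine hdd.congr_of_eventuallyEq ?_
      filter_upwards [hB'] with b hb
      have hub := hne b hb
      have h2n : (2 : ℂ) ^ n ≠ 0 := pow_ne_zero n two_ne_zero
      rw [hQ]
      simp only
      rw [mul_add, mul_div_cancel₀ _ h2n, Complex.exp_add,
        Complex.exp_log (Complex.slitPlane_ne_zero (hξs b hb)), hL]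
      have : (2 : ℂ) ^ n = ((2 ^ n : ℕ) : ℂ) := by push_cast; rfl
      rw [this, Complex.exp_nat_mul, Complex.exp_log (div_ne_zero hub hu₀0), div_pow, hξ]
      have := pow_ne_zero (2 ^ n) hub
      field_simp
  have hQL : TendstoUniformlyOn Q L atTop B := by
    rw [Metric.tendstoUniformlyOn_iff]
    intro ε hε
    have hpow : Tendsto (fun n : ℕ => (4 : ℝ) * (1 / 2) ^ n) atTop (𝓝 0) := by
      have := (tendsto_pow_atTop_nhds_zero_of_lt_one (r := (1 / 2 : ℝ)) (by norm_num)
        (by norm_num)).const_mul 4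
      simpa using this
    filter_upwards [hsmall, hpow.eventually_lt_const hε] with n hn hn2 a ha
    rw [dist_eq_norm, hQ]
    simp only [sub_add_cancel_left, norm_neg, norm_div, norm_pow]
    have hlog : ‖Complex.log (ξ n a)‖ ≤ 4 := by
      have h1 := hξb n hn a ha
      have := Complex.norm_log_one_add_half_le_self (z := ξ n a - 1) h1
      rw [add_sub_cancel] at this
      linarith
    calc ‖Complex.log (ξ n a)‖ / ‖(2 : ℂ)‖ ^ n ≤ 4 / 2 ^ n := by
          norm_num
          gcongr
      _ = 4 * (1 / 2) ^ n := by rw [div_pow, one_pow, mul_one_div]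
      _ < ε := hn2
  have hLd : DifferentiableOn ℂ L B :=
    hQL.tendstoLocallyUniformlyOn.differentiableOn hQd isOpen_ball
  have ha₀B : a₀ ∈ B := mem_ball_self hρ
  have hexp : DifferentiableAt ℂ (fun a => u₀ * Complex.exp (L a)) a₀ :=
    ((hLd.differentiableAt (isOpen_ball.mem_nhds ha₀B)).cexp).const_mul _
  refine hexp.congr_of_eventuallyEq ?_
  filter_upwards [isOpen_ball.mem_nhds ha₀B] with a ha
  simp only [hL]
  rw [Complex.exp_log (div_ne_zero (hne a ha) hu₀0), mul_div_cancel₀ _ hu₀0]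

/-! ### The parameter disc -/

/-- The image of `P_∞ ∪ {∞}` under `a ↦ 1 / a`. -/
def extDomain : Set ℂ := {b | b = 0 ∨ b⁻¹ ∈ exteriorComponent}

/-- The reciprocal of the Böttcher coordinate of the critical value, as a function of `1 / a`. -/
def extCoord (b : ℂ) : ℂ := critCoord b⁻¹

theorem zero_mem_extDomain : (0 : ℂ) ∈ extDomain := Or.inl rfl

/-- For a = 0 the critical equation would be Y(u) = u, which never holds, so the default value
applies. With 0⁻¹ = 0 this is exactly the right value of `extCoord` at a = ∞. -/
theorem critCoord_zero : critCoord 0 = 0 := by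
  rw [critCoord, dif_neg]
  rintro ⟨u, r, Y, S, h, hu, he⟩
  exact h.den_ne_zero u hu (by simpa using he)

theorem extCoord_zero : extCoord 0 = 0 := by rw [extCoord, inv_zero, critCoord_zero]

theorem le_norm_inv_of_norm_lt {b : ℂ} (hb : b ≠ 0) (h : ‖b‖ < 1 / 144) :
    144 ≤ ‖b⁻¹‖ := by
  rw [norm_inv, le_inv_comm₀ (by norm_num) (norm_pos_iff.2 hb)]
  norm_num at h ⊢
  exact h.le

theorem ball_subset_extDomain : ball (0 : ℂ) (1 / 144) ⊆ extDomain := by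
  intro b hb
  rcases eq_or_ne b 0 with h | h
  · exact Or.inl h
  · exact Or.inr (mem_exteriorComponent_of_large
      (le_norm_inv_of_norm_lt h (mem_ball_zero_iff.1 hb)))

theorem isOpen_extDomain : IsOpen extDomain := by
  rw [isOpen_iff_mem_nhds]
  rintro b hb
  rcases eq_or_ne b 0 with rfl | h
  · exact Filter.mem_of_superset (ball_mem_nhds _ (by norm_num)) ball_subset_extDomain
  · have hbP := hb.resolve_left h
    exact Filter.mem_of_superset
      ((continuousAt_inv₀ h).preimage_mem_nhds (isOpen_exteriorComponent.mem_nhds hbP))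
      fun x hx => Or.inr hx

theorem norm_extCoord_le {b : ℂ} (h : ‖b‖ < 1 / 144) : ‖extCoord b‖ ≤ 6 * ‖b‖ := by
  rcases eq_or_ne b 0 with rfl | hb
  · simp [extCoord_zero]
  · have := norm_critCoord_le (le_norm_inv_of_norm_lt hb h)
    rwa [norm_inv, div_inv_eq_mul] at this

theorem mapsTo_extCoord : MapsTo extCoord extDomain (ball 0 1) := by
  rintro b (rfl | hb)
  · simp [extCoord_zero]
  · exact mem_ball_zero_iff.2 (isCritCoord_critCoord hb).norm_lt_one

theorem eq_zero_of_extCoord_eq_zero {b : ℂ} (hb : b ∈ extDomain) (h : extCoord b = 0) : b = 0 :=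
  hb.resolve_right fun hb => (isCritCoord_critCoord hb).ne_zero h

theorem continuousAt_extCoord_zero : ContinuousAt extCoord 0 := by
  rw [ContinuousAt, extCoord_zero, tendsto_zero_iff_norm_tendsto_zero]
  refine squeeze_zero' (Eventually.of_forall fun _ => norm_nonneg _)
    (g := fun b : ℂ => 6 * ‖b‖) ?_ ?_
  · filter_upwards [ball_mem_nhds (0 : ℂ) (show (0 : ℝ) < 1 / 144 by norm_num)] with b hb
    exact norm_extCoord_le (mem_ball_zero_iff.1 hb)
  · have : Continuous fun b : ℂ => 6 * ‖b‖ := by fun_prop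
    simpa using this.tendsto 0

theorem differentiableOn_extCoord : DifferentiableOn ℂ extCoord extDomain := by
  have h1 : DifferentiableOn ℂ extCoord (extDomain \ {0}) := by
    refine differentiableOn_critCoord.comp (differentiableOn_inv.mono ?_) ?_
    · intro b hb
      exact hb.2
    · intro b hb
      exact hb.1.resolve_left hb.2
  exact (Complex.differentiableOn_compl_singleton_and_continuousAt_iff
    (isOpen_extDomain.mem_nhds zero_mem_extDomain)).1 ⟨h1, continuousAt_extCoord_zero⟩

theorem tendsto_mul_critCoord :
    Tendsto (fun a => a * critCoord a) (Bornology.cobounded ℂ) (𝓝 (-2)) := by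
  have hn : Tendsto (fun a : ℂ => ‖a‖) (Bornology.cobounded ℂ) atTop := tendsto_norm_cobounded_atTop
  have hev : ∀ᶠ a in Bornology.cobounded ℂ, 144 ≤ ‖a‖ := hn.eventually_ge_atTop 144
  have hu : Tendsto (fun a => ‖critCoord a‖) (Bornology.cobounded ℂ) (𝓝 0) := by
    refine squeeze_zero' (Eventually.of_forall fun _ => norm_nonneg _)
      (hev.mono fun a ha => norm_critCoord_le ha) ?_
    exact hn.const_div_atTop 6
  have hsub : Tendsto (fun a => a * critCoord a - (-2)) (Bornology.cobounded ℂ) (𝓝 0) := by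
    rw [tendsto_zero_iff_norm_tendsto_zero]
    refine squeeze_zero' (Eventually.of_forall fun _ => norm_nonneg _)
      -- Here 11 = 5 + 6, using |a||u| ≤ 6 for |a| ≥ 144.
      (g := fun a => 11 * √‖critCoord a‖ + ‖critCoord a‖) ?_ ?_
    · filter_upwards [hev] with a ha
      have h1 := norm_mul_critCoord_add_two_le (mem_exteriorComponent_of_large ha)
      have h2 := norm_critCoord_le ha
      rw [le_div_iff₀ (by linarith), mul_comm] at h2
      rw [sub_neg_eq_add]
      refine h1.trans ?_
      gcongr
      linarith
    · have := (((Real.continuous_sqrt.tendsto 0).comp hu).const_mul 11).add hu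
      simpa using this
  simpa using hsub.add_const (-2)

theorem hasDerivAt_extCoord_zero : HasDerivAt extCoord (-2) 0 := by
  rw [hasDerivAt_iff_tendsto_slope]
  have := tendsto_mul_critCoord.comp (Filter.tendsto_inv₀_nhdsNE_zero (α := ℂ))
  refine this.congr fun b => ?_
  simp [slope_def_field, extCoord, critCoord_zero, div_eq_mul_inv, mul_comm]

/-- For √|u| ≤ 1/20, assuming |a u| < 1 would give |a u + 2| < 1, against 2 ≤ |a u + 2| + |a u|. It
serves properness over the value 0. -/
theorem one_le_norm_mul_critCoord {a : ℂ} (ha : a ∈ exteriorComponent)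
    (hu : ‖critCoord a‖ ≤ 1 / 400) : 1 ≤ ‖a‖ * ‖critCoord a‖ := by
  have h1 := norm_mul_critCoord_add_two_le ha
  have hs : √‖critCoord a‖ ≤ 1 / 20 := by
    rw [Real.sqrt_le_left (by norm_num)]
    norm_num at hu ⊢
    exact hu
  by_contra! hlt
  have h2 : ‖(2 : ℂ)‖ ≤ ‖a * critCoord a + 2‖ + ‖a * critCoord a‖ := by
    have : (2 : ℂ) = (a * critCoord a + 2) - a * critCoord a := by ring
    conv_lhs => rw [this]
    exact norm_sub_le _ _
  rw [norm_mul] at h2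
  norm_num at h2
  nlinarith [Real.sqrt_nonneg ‖critCoord a‖, norm_nonneg (critCoord a), norm_nonneg a]

theorem norm_le_norm_extCoord {b : ℂ} (hb : b ∈ extDomain) (hu : ‖extCoord b‖ ≤ 1 / 400) :
    ‖b‖ ≤ ‖extCoord b‖ := by
  rcases eq_or_ne b 0 with rfl | h
  · simp
  · have := one_le_norm_mul_critCoord (hb.resolve_left h) hu
    rw [norm_inv] at this
    rwa [le_inv_mul_iff₀ (norm_pos_iff.2 h), mul_one] at this

/-- Over c = 0, |b| is at most the coordinate itself. Over c ≠ 0, `IsCritCoord.norm_mul_le` bounds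
the parameters, and a convergent subsequence has its limit in P_∞ by `exteriorComponent_limit`. -/
theorem extCoord_proper (b : ℕ → ℂ) (hb : ∀ n, b n ∈ extDomain) (c : ℂ)
    (hc : c ∈ ball (0 : ℂ) 1) (hlim : Tendsto (fun n => extCoord (b n)) atTop (𝓝 c)) :
    ∃ φ : ℕ → ℕ, StrictMono φ ∧ ∃ b₀ ∈ extDomain, Tendsto (fun n => b (φ n)) atTop (𝓝 b₀) ∧
      extCoord b₀ = c := by
  rcases eq_or_ne c 0 with rfl | hc0
  · refine ⟨id, strictMono_id, 0, zero_mem_extDomain, ?_, extCoord_zero⟩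
    have hn := hlim.norm
    rw [norm_zero] at hn
    rw [tendsto_zero_iff_norm_tendsto_zero]
    refine squeeze_zero' (Eventually.of_forall fun _ => norm_nonneg _) ?_ hn
    filter_upwards [hn.eventually_le_const (show (0 : ℝ) < 1 / 400 by norm_num)] with n h
    exact norm_le_norm_extCoord (hb n) h
  · have hc1 := mem_ball_zero_iff.1 hc
    have hcp := norm_pos_iff.2 hc0
    obtain ⟨q, hq, hq1⟩ := exists_between hc1
    have e1 := hlim.norm.eventually_lt_const hq
    have e2 := hlim.norm.eventually_const_lt (show ‖c‖ / 2 < ‖c‖ by linarith)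
    obtain ⟨n₀, hn₀⟩ := eventually_atTop.1 (e1.and e2)
    set a : ℕ → ℂ := fun n => (b (n + n₀))⁻¹ with haa
    have haP : ∀ n, a n ∈ exteriorComponent := by
      intro n
      refine (hb _).resolve_left fun h => ?_
      have := (hn₀ (n + n₀) (Nat.le_add_left _ _)).2
      rw [h, extCoord_zero, norm_zero] at this
      linarith
    have hbd : ∀ n, a n ∈ closedBall (0 : ℂ) (4 / (‖c‖ / 2 * (1 - q))) := by
      intro n
      obtain ⟨h1, h2⟩ := hn₀ (n + n₀) (Nat.le_add_left _ _)
      have h3 := (isCritCoord_critCoord (haP n)).norm_mul_le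
      change ‖critCoord (a n)‖ < q at h1
      change _ < ‖critCoord (a n)‖ at h2
      rw [mem_closedBall_zero_iff, le_div_iff₀ (by
        have : 0 < 1 - q := by linarith
        positivity)]
      have h4 : ‖a n‖ * (‖c‖ / 2 * (1 - q)) ≤ ‖a n‖ * (‖critCoord (a n)‖ *
          (1 - ‖critCoord (a n)‖)) := by
        gcongr
      nlinarith
    obtain ⟨a₀, -, φ, hφ, hφa⟩ := (isCompact_closedBall _ _).tendsto_subseq hbd
    have hu : Tendsto (fun n => critCoord (a (φ n))) atTop (𝓝 c) :=
      (hlim.comp (tendsto_add_atTop_nat n₀)).comp hφ.tendsto_atTop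
    obtain ⟨h1, h2⟩ := exteriorComponent_limit (fun n => haP (φ n)) hφa hu hc0 hc1
    refine ⟨fun n => φ n + n₀, fun m n h => Nat.add_lt_add_right (hφ h) _, a₀⁻¹,
      Or.inr (by rwa [inv_inv]), ?_, by rw [extCoord, inv_inv, h2]⟩
    refine (hφa.inv₀ h1.1).congr fun n => ?_
    simp [haa]

theorem bijOn_extCoord : BijOn extCoord extDomain (ball 0 1) :=
  bijOn_of_proper isOpen_extDomain differentiableOn_extCoord mapsTo_extCoord extCoord_proper
    zero_mem_extDomain extCoord_zero (by rw [hasDerivAt_extCoord_zero.deriv]; norm_num)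
    fun _ => eq_zero_of_extCoord_eq_zero

/-! ### The inverse parametrization -/

/-- The inverse of `extCoord`. -/
def extParam : ℂ → ℂ := Function.invFunOn extCoord extDomain

theorem invOn_extParam : InvOn extParam extCoord extDomain (ball 0 1) :=
  bijOn_extCoord.invOn_invFunOn

theorem bijOn_extParam : BijOn extParam (ball 0 1) extDomain :=
  (bijOn_extCoord.symm invOn_extParam.symm)

theorem extParam_zero : extParam 0 = 0 := by
  have := invOn_extParam.1 zero_mem_extDomain
  rwa [extCoord_zero] at this

theorem extParam_ne_zero {c : ℂ} (hc : c ∈ ball (0 : ℂ) 1) (h : c ≠ 0) : extParam c ≠ 0 := by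
  intro h0
  apply h
  rw [← invOn_extParam.2 hc, h0, extCoord_zero]

theorem differentiableOn_extParam : DifferentiableOn ℂ extParam (ball 0 1) := by
  have := differentiableOn_inverse isOpen_extDomain differentiableOn_extCoord
    bijOn_extCoord.injOn (fun z hz => invOn_extParam.1 hz)
  rwa [bijOn_extCoord.image_eq] at this

theorem hasDerivAt_extParam_zero : HasDerivAt extParam (-1 / 2) 0 := by
  have hd : DifferentiableAt ℂ extParam 0 :=
    differentiableOn_extParam.differentiableAt (ball_mem_nhds _ one_pos)
  have h1 : HasDerivAt extCoord (-2) (extParam 0) := by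
    rw [extParam_zero]
    exact hasDerivAt_extCoord_zero
  have h2 := h1.comp 0 hd.hasDerivAt
  have h3 : (extCoord ∘ extParam) =ᶠ[𝓝 0] id := by
    filter_upwards [ball_mem_nhds (0 : ℂ) one_pos] with c hc
    exact invOn_extParam.2 hc
  have h4 := (h2.congr_of_eventuallyEq h3.symm).unique (hasDerivAt_id 0)
  have h5 : deriv extParam 0 = -1 / 2 := by linear_combination (-1 / 2 : ℂ) * h4
  exact h5 ▸ hd.hasDerivAt

/-! ### Consequences in the parameter plane -/

theorem invChart_image_extDomain :
    invChart '' extDomain = insert ∞ ((fun a : ℂ => (a : OnePoint ℂ)) '' exteriorComponent) := by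
  ext x
  constructor
  · rintro ⟨b, hb, rfl⟩
    rcases eq_or_ne b 0 with rfl | h
    · left
      exact invChart_zero
    · right
      exact ⟨b⁻¹, hb.resolve_left h, (invChart_of_ne h).symm⟩
  · rintro (rfl | ⟨a, ha, rfl⟩)
    · exact ⟨0, zero_mem_extDomain, invChart_zero⟩
    · refine ⟨a⁻¹, Or.inr (by rwa [inv_inv]), ?_⟩
      rw [invChart_of_ne (inv_ne_zero ha.1), inv_inv]

theorem isSimplyConnected_extDomain : IsSimplyConnected extDomain := by
  let e : ball (0 : ℂ) 1 ≃ₜ extDomain :=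
    { toFun := fun c => ⟨extParam c, bijOn_extParam.mapsTo c.2⟩
      invFun := fun b => ⟨extCoord b, mapsTo_extCoord b.2⟩
      left_inv := fun c => Subtype.ext (invOn_extParam.2 c.2)
      right_inv := fun b => Subtype.ext (invOn_extParam.1 b.2)
      continuous_toFun := (continuousOn_iff_continuous_domRestrict.1
        differentiableOn_extParam.continuousOn).subtype_mk _
      continuous_invFun := (continuousOn_iff_continuous_domRestrict.1
        differentiableOn_extCoord.continuousOn).subtype_mk _ }
  have : ContractibleSpace (ball (0 : ℂ) 1) :=
    (convex_ball (0 : ℂ) 1).contractibleSpace ⟨0, mem_ball_self one_pos⟩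
  have : ContractibleSpace extDomain := e.symm.contractibleSpace
  exact SimplyConnectedSpace.ofContractible _

theorem isSimplyConnected_insert_exteriorComponent : IsSimplyConnected
    (insert ∞ ((fun a : ℂ => (a : OnePoint ℂ)) '' exteriorComponent)) := by
  rw [← invChart_image_extDomain]
  exact isOpenEmbedding_invChart.isEmbedding.isSimplyConnected_image.2 isSimplyConnected_extDomain

theorem bijOn_inv_critCoord :
    BijOn (fun a => (critCoord a)⁻¹) exteriorComponent {w | 1 < ‖w‖} := by
  refine ⟨?_, ?_, ?_⟩
  · intro a ha
    have h := isCritCoord_critCoord ha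
    change 1 < ‖(critCoord a)⁻¹‖
    rw [norm_inv]
    exact (one_lt_inv₀ (norm_pos_iff.2 h.ne_zero)).2 h.norm_lt_one
  · intro a ha a' ha' h
    have h := inv_injective h
    apply inv_injective
    apply bijOn_extCoord.injOn (Or.inr (by rwa [inv_inv])) (Or.inr (by rwa [inv_inv]))
    simpa [extCoord] using h
  · intro w hw
    have hw : 1 < ‖w‖ := hw
    have hw0 : w ≠ 0 := norm_pos_iff.1 (one_pos.trans hw)
    obtain ⟨b, hb, hbw⟩ := bijOn_extCoord.surjOn (mem_ball_zero_iff.2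
      (show ‖w⁻¹‖ < 1 by rw [norm_inv]; exact inv_lt_one_of_one_lt₀ hw))
    have hb0 : b ≠ 0 := by
      rintro rfl
      rw [extCoord_zero] at hbw
      exact inv_ne_zero hw0 hbw.symm
    exact ⟨b⁻¹, hb.resolve_left hb0, by simp only; rw [← extCoord, hbw, inv_inv]⟩

theorem differentiableOn_inv_critCoord :
    DifferentiableOn ℂ (fun a => (critCoord a)⁻¹) exteriorComponent :=
  differentiableOn_critCoord.inv fun _ ha => (isCritCoord_critCoord ha).ne_zero

theorem tendsto_inv_critCoord_div :
    Tendsto (fun a => (critCoord a)⁻¹ / a) (Bornology.cobounded ℂ) (𝓝 (-1 / 2)) := by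
  have := tendsto_mul_critCoord.inv₀ (by norm_num)
  refine (this.congr fun a => ?_).trans (by norm_num)
  rw [mul_inv, div_eq_mul_inv, mul_comm]

/-! ### Comparison with the Böttcher coordinate -/

namespace IsInvBottcher

variable {a : ℂ} {r : ℝ} {Y S : ℂ → ℂ}

theorem gmap_ne_zero (h : IsInvBottcher a r Y S) {u : ℂ} (hu : u ∈ ball (0 : ℂ) r) (h0 : u ≠ 0) :
    gmap Y u ≠ 0 := div_ne_zero h0 (h.den_ne_zero u hu)

theorem invChart_gmap (h : IsInvBottcher a r Y S) {u : ℂ} (hu : u ∈ ball (0 : ℂ) r) (h0 : u ≠ 0) :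
    invChart (gmap Y u) = (((gmap Y u)⁻¹ : ℂ) : OnePoint ℂ) := invChart_of_ne (h.gmap_ne_zero hu h0)

theorem map_gmap_nhdsNE (h : IsInvBottcher a r Y S) :
    map (fun u => (gmap Y u)⁻¹) (𝓝[≠] 0) = Bornology.cobounded ℂ := by
  have hs : map (gmap Y) (𝓝 0) = 𝓝 0 := by
    have := (h.diff_gmap.analyticAt h.ball_mem).hasStrictDerivAt.map_nhds_eq
      (by rw [h.hasDerivAt_gmap_zero.deriv]; norm_num)
    rwa [gmap_zero] at this
  have hNE : map (gmap Y) (𝓝[≠] 0) = 𝓝[≠] 0 := by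
    apply le_antisymm
    · refine tendsto_nhdsWithin_iff.2 ⟨tendsto_nhdsWithin_of_tendsto_nhds hs.le, ?_⟩
      filter_upwards [self_mem_nhdsWithin, mem_nhdsWithin_of_mem_nhds h.ball_mem] with u h1 h2
      exact h.gmap_ne_zero h2 h1
    · have e : 𝓝[≠] (0 : ℂ) = map (gmap Y) (𝓝 0 ⊓ 𝓟 (gmap Y ⁻¹' {0}ᶜ)) := by
        rw [← comap_principal, Filter.push_pull, hs, nhdsWithin]
      refine e.le.trans ?_
      refine Filter.map_mono (inf_le_inf le_rfl (principal_mono.2 fun u hu h0 => hu ?_))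
      rw [h0]
      exact gmap_zero
  rw [← map_inv_nhdsNE_zero]
  conv_rhs => rw [← hNE, Filter.map_map]
  rfl

/-- The inverse of u ↦ 1/g(u) on the punctured disc of radius r, followed by inversion, is a
Böttcher coordinate onto |w| > 1/r, with derivative 1/2 at ∞. -/
theorem exists_isBottcher (h : IsInvBottcher a r Y S) (haP : a ∈ exteriorComponent) {u₀ : ℂ}
    (hu₀ : u₀ ∈ ball (0 : ℂ) r) (hu₀0 : u₀ ≠ 0) :
    IsBottcherValue a (gmap Y u₀)⁻¹ u₀⁻¹ := by
  have ha := haP.1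
  have hinj := h.injOn ha (mem_basin_of_mem_exteriorComponent haP)
  set D : Set ℂ := ball 0 r \ {0}
  have hDo : IsOpen D := isOpen_ball.sdiff isClosed_singleton
  set ψ : ℂ → ℂ := fun u => (gmap Y u)⁻¹ with hψ
  have hψi : InjOn ψ D := fun x hx y hy hxy => hinj hx.1 hy.1 (inv_injective hxy)
  have hψd : DifferentiableOn ℂ ψ D :=
    (h.diff_gmap.mono sdiff_subset).inv fun u hu => h.gmap_ne_zero hu.1 hu.2
  set g : ℂ → ℂ := Function.invFunOn ψ D
  have hg : ∀ u ∈ D, g (ψ u) = u := fun u hu => hψi.leftInvOn_invFunOn hu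
  have hDN : D ∈ 𝓝[≠] (0 : ℂ) := inter_mem (mem_nhdsWithin_of_mem_nhds h.ball_mem) self_mem_nhdsWithin
  refine ⟨r⁻¹, ψ '' D, fun z => (g z)⁻¹, ?_, ⟨u₀, ⟨hu₀, hu₀0⟩, rfl⟩, by
    simp only; rw [hg u₀ ⟨hu₀, hu₀0⟩]⟩
  refine ⟨(one_le_inv₀ h.pos).2 h.le_one, isOpen_image_of_injOn hDo hψd hψi, ?_, ?_, ?_, ?_, ?_, ?_⟩
  · rw [← h.map_gmap_nhdsNE]
    exact image_mem_map hDN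
  · rintro _ ⟨u, hu, rfl⟩
    rw [hψ]
    simp only
    rw [← h.invChart_gmap hu.1 hu.2]
    exact h.image_subset_immediateBasin ha ⟨u, hu.1, rfl⟩
  · refine (differentiableOn_inverse hDo hψd hψi hg).inv ?_
    rintro _ ⟨u, hu, rfl⟩
    rw [hg u hu]
    exact hu.2
  · refine ⟨?_, ?_, ?_⟩
    · rintro _ ⟨u, hu, rfl⟩
      simp only [mem_ofPred_eq]
      rw [hg u hu, norm_inv]
      exact inv_strictAnti₀ (norm_pos_iff.2 hu.2) (mem_ball_zero_iff.1 hu.1)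
    · rintro _ ⟨u, hu, rfl⟩ _ ⟨v, hv, rfl⟩ huv
      simp only at huv
      rw [hg u hu, hg v hv] at huv
      rw [inv_injective huv]
    · intro w hw
      have hw : r⁻¹ < ‖w‖ := hw
      have hw0 : w ≠ 0 := norm_pos_iff.1 ((inv_pos.2 h.pos).trans hw)
      have hD : w⁻¹ ∈ D := ⟨by
        rw [mem_ball_zero_iff, norm_inv]
        exact inv_lt_of_inv_lt₀ h.pos hw, inv_ne_zero hw0⟩
      exact ⟨ψ w⁻¹, ⟨_, hD, rfl⟩, by simp only; rw [hg _ hD, inv_inv]⟩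
  · rintro _ ⟨u, hu, rfl⟩
    have hu2 : u ^ 2 ∈ D := ⟨sq_mem_ball h.le_one hu.1, pow_ne_zero 2 hu.2⟩
    refine ⟨ψ (u ^ 2), ⟨_, hu2, rfl⟩, ?_, ?_⟩
    · have := h.iterate_invChart_gmap ha hu.1 1
      rwa [pow_one, mul_one, h.invChart_gmap hu.1 hu.2, h.invChart_gmap hu2.1 hu2.2] at this
    · rw [hg _ hu2, hg _ hu, inv_pow]
  · refine ⟨1 / 2, by norm_num, ?_⟩
    rw [← h.map_gmap_nhdsNE, tendsto_map'_iff]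
    have h1 : Tendsto (fun u => (Y u - u)⁻¹) (𝓝[≠] 0) (𝓝 (((1 / 2 : ℝ) : ℂ))) := by
      have : ContinuousAt (fun u => (Y u - u)⁻¹) 0 :=
        (h.continuousAt_Y.sub continuousAt_id).inv₀ (by simp [h.Y_zero])
      have := this.tendsto.mono_left (nhdsWithin_le_nhds (s := {0}ᶜ))
      simpa [h.Y_zero] using this
    refine h1.congr' ?_
    filter_upwards [hDN] with u hu
    simp only [Function.comp]
    rw [show (gmap Y u)⁻¹ = ψ u from rfl, hg u hu, hψ]
    have := h.den_ne_zero u hu.1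
    have hu0 : u ≠ 0 := hu.2
    simp only [gmap]
    field_simp

theorem bottcher_sq (h : IsInvBottcher a r Y S) (ha : a ≠ 0) {r' : ℝ} {U : Set ℂ} {Φ : ℂ → ℂ}
    (hB : IsBottcher a r' U Φ) {u : ℂ} (hu : u ∈ ball (0 : ℂ) r) (h0 : u ≠ 0)
    (hU : (gmap Y u)⁻¹ ∈ U) :
    (gmap Y (u ^ 2))⁻¹ ∈ U ∧ Φ (gmap Y (u ^ 2))⁻¹ = Φ (gmap Y u)⁻¹ ^ 2 := by
  obtain ⟨z', hz', he, hΦ⟩ := hB.conj _ hU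
  have := h.iterate_invChart_gmap ha hu 1
  rw [pow_one, mul_one, h.invChart_gmap hu h0,
    h.invChart_gmap (sq_mem_ball h.le_one hu) (pow_ne_zero 2 h0), he] at this
  obtain rfl := OnePoint.coe_injective this
  exact ⟨hz', hΦ⟩

theorem bottcher_pow (h : IsInvBottcher a r Y S) (ha : a ≠ 0) {r' : ℝ} {U : Set ℂ} {Φ : ℂ → ℂ}
    (hB : IsBottcher a r' U Φ) {u : ℂ} (hu : u ∈ ball (0 : ℂ) r) (h0 : u ≠ 0)
    (hU : (gmap Y u)⁻¹ ∈ U) (n : ℕ) :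
    (gmap Y (u ^ 2 ^ n))⁻¹ ∈ U ∧ Φ (gmap Y (u ^ 2 ^ n))⁻¹ = Φ (gmap Y u)⁻¹ ^ 2 ^ n := by
  induction n with
  | zero => simpa using hU
  | succ n ih =>
    have := h.bottcher_sq ha hB (pow_mem_ball h.le_one hu n) (pow_ne_zero _ h0) ih.1
    rw [ih.2, ← pow_mul, ← pow_succ, ← pow_mul, ← pow_succ] at this
    exact this

end IsInvBottcher

/-- From x² - 1 = (x - 1)(x + 1) with |x + 1| ≥ 3/2, any deviation from 1 would grow geometrically
under squaring. -/
theorem eq_one_of_norm_pow_sub_one_le {k : ℂ} (h : ∀ n : ℕ, ‖k ^ 2 ^ n - 1‖ ≤ 1 / 2) : k = 1 := by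
  by_contra hk
  have hpos : 0 < ‖k - 1‖ := norm_pos_iff.2 (sub_ne_zero.2 hk)
  have key : ∀ n : ℕ, (3 / 2) ^ n * ‖k - 1‖ ≤ ‖k ^ 2 ^ n - 1‖ := by
    intro n
    induction n with
    | zero => simp
    | succ n ih =>
      set x := k ^ 2 ^ n
      have hx : k ^ 2 ^ (n + 1) - 1 = (x - 1) * (x + 1) := by
        rw [pow_succ, pow_mul]; ring
      have hx1 : 3 / 2 ≤ ‖x + 1‖ := by
        have h2 : ‖(2 : ℂ)‖ ≤ ‖x + 1‖ + ‖x - 1‖ := by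
          have : (2 : ℂ) = (x + 1) - (x - 1) := by ring
          conv_lhs => rw [this]
          exact norm_sub_le _ _
        have := h n
        norm_num at h2
        linarith
      rw [hx, norm_mul, pow_succ]
      nlinarith [norm_nonneg (x - 1)]
  obtain ⟨n, hn⟩ := pow_unbounded_of_one_lt (1 / ‖k - 1‖) (show (1 : ℝ) < 3 / 2 by norm_num)
  rw [div_lt_iff₀ hpos] at hn
  linarith [key n, h n]

theorem IsInvBottcher.eventually_bottcher_eq {a : ℂ} {r : ℝ} {Y S : ℂ → ℂ}
    (h : IsInvBottcher a r Y S) (ha : a ≠ 0) {r' : ℝ} {U : Set ℂ} {Φ : ℂ → ℂ}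
    (hB : IsBottcher a r' U Φ) :
    ∀ᶠ u in 𝓝[≠] 0, (gmap Y u)⁻¹ ∈ U ∧ Φ (gmap Y u)⁻¹ = u⁻¹ := by
  obtain ⟨c, hc, hlim⟩ := hB.normalized
  have hψ : Tendsto (fun u => (gmap Y u)⁻¹) (𝓝[≠] 0) (Bornology.cobounded ℂ) :=
    h.map_gmap_nhdsNE.le
  have hU := hψ.eventually hB.nhds_infty
  have hDN : ∀ᶠ u in 𝓝[≠] (0 : ℂ), u ∈ ball (0 : ℂ) r ∧ u ≠ 0 :=
    Filter.Eventually.and (mem_nhdsWithin_of_mem_nhds h.ball_mem) self_mem_nhdsWithin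
  set k : ℂ → ℂ := fun u => Φ (gmap Y u)⁻¹ * u with hk
  have hk2 : Tendsto k (𝓝[≠] 0) (𝓝 (c * 2)) := by
    have h1 : Tendsto (fun u => Y u - u) (𝓝[≠] 0) (𝓝 2) := by
      have h1 : ContinuousAt (fun u => Y u - u) 0 := h.continuousAt_Y.sub continuousAt_id
      have := h1.tendsto.mono_left (nhdsWithin_le_nhds (s := {0}ᶜ))
      simpa [h.Y_zero] using this
    refine ((hlim.comp hψ).mul h1).congr' ?_
    filter_upwards [hDN] with u hu
    have := h.den_ne_zero u hu.1
    have hu0 := hu.2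
    simp only [hk, Function.comp, gmap, inv_div]
    field_simp
  have hsq : Tendsto (fun u : ℂ => u ^ 2) (𝓝[≠] 0) (𝓝[≠] 0) := by
    refine tendsto_nhdsWithin_iff.2 ⟨?_, ?_⟩
    · have := ((continuous_pow 2).tendsto (0 : ℂ)).mono_left (nhdsWithin_le_nhds (s := {0}ᶜ))
      simpa using this
    · filter_upwards [self_mem_nhdsWithin] with u hu using pow_ne_zero 2 hu
  -- The function k = Φ(1/g(u))·u satisfies k(u²) = k(u)², so its limit 2c at 0 equals its own
  -- square, and it is nonzero because c > 0.
  have hc1 : (c : ℂ) * 2 = 1 := by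
    have e : (c : ℂ) * 2 = (c * 2) ^ 2 := by
      refine tendsto_nhds_unique (hk2.comp hsq) ((hk2.pow 2).congr' ?_)
      filter_upwards [hDN, hU] with u hu huU
      simp only [hk, Function.comp]
      rw [(h.bottcher_sq ha hB hu.1 hu.2 huU).2]
      ring
    have hne : (c : ℂ) * 2 ≠ 0 := by
      have : (c : ℂ) ≠ 0 := by exact_mod_cast hc.ne'
      simpa using this
    apply mul_left_cancel₀ hne
    linear_combination -e
  rw [hc1] at hk2
  have hk3 : ∀ᶠ u in 𝓝[≠] 0, ‖k u - 1‖ ≤ 1 / 2 := by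
    have := (hk2.sub_const 1).norm
    rw [sub_self, norm_zero] at this
    exact this.eventually_le_const (by norm_num)
  have hev := hDN.and (hU.and hk3)
  obtain ⟨δ, hδ, hδb⟩ := Metric.eventually_nhds_iff_ball.1 (eventually_nhdsWithin_iff.1 hev)
  have hmin : ball (0 : ℂ) (min δ 1) ∈ 𝓝[≠] (0 : ℂ) :=
    mem_nhdsWithin_of_mem_nhds (ball_mem_nhds _ (lt_min hδ one_pos))
  filter_upwards [hmin, self_mem_nhdsWithin] with u hu hu0
  have hu0 : u ≠ 0 := hu0
  have hball : ∀ n : ℕ, u ^ 2 ^ n ∈ ball (0 : ℂ) δ := fun n =>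
    ball_subset_ball (min_le_left _ _) (pow_mem_ball (min_le_right _ _) hu n)
  have hb := hball 0
  rw [pow_zero, pow_one] at hb
  obtain ⟨⟨h1, -⟩, h2, -⟩ := hδb u hb hu0
  refine ⟨h2, ?_⟩
  have hk1 : k u = 1 := by
    apply eq_one_of_norm_pow_sub_one_le
    intro n
    have := (hδb _ (hball n) (pow_ne_zero _ hu0)).2.2
    simp only [hk] at this ⊢
    rw [(h.bottcher_pow ha hB h1 hu0 h2 n).2, ← mul_pow] at this
    exact this
  exact eq_inv_of_mul_eq_one_left hk1

/-- `U` may meet the image of g in a disconnected set, so analytic continuation is done on inverses: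
both live on a disc in the u-plane. The modulus of Φ, read off from a high iterate, shows that u is
in that disc. -/
theorem IsInvBottcher.bottcher_eq {a : ℂ} {r : ℝ} {Y S : ℂ → ℂ}
    (h : IsInvBottcher a r Y S) (ha : a ≠ 0) {r' : ℝ} {U : Set ℂ} {Φ : ℂ → ℂ}
    (hB : IsBottcher a r' U Φ) {u : ℂ} (hu : u ∈ ball (0 : ℂ) r) (hu0 : u ≠ 0)
    (huU : (gmap Y u)⁻¹ ∈ U) : Φ (gmap Y u)⁻¹ = u⁻¹ := by
  have hev := h.eventually_bottcher_eq ha hB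
  have hr' : 0 < r' := one_pos.trans_le hB.one_le
  have hu1 : ‖u‖ < 1 := (mem_ball_zero_iff.1 hu).trans_le h.le_one
  have hnorm : ‖Φ (gmap Y u)⁻¹‖ = ‖u‖⁻¹ := by
    have ht : Tendsto (fun n : ℕ => u ^ 2 ^ n) atTop (𝓝[≠] 0) :=
      tendsto_nhdsWithin_iff.2 ⟨tendsto_pow_two_pow hu1,
        Eventually.of_forall fun n => pow_ne_zero _ hu0⟩
    obtain ⟨n, hn⟩ := (ht.eventually hev).exists
    have h1 := hn.2
    rw [(h.bottcher_pow ha hB hu hu0 huU n).2, ← inv_pow] at h1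
    have h2 := congrArg norm h1
    rw [norm_pow, norm_pow, norm_inv] at h2
    exact (pow_left_inj₀ (norm_nonneg _) (inv_nonneg.2 (norm_nonneg _))
      (pow_ne_zero n two_ne_zero)).1 h2
  have hur' : ‖u‖ < r'⁻¹ := by
    have : r' < ‖Φ (gmap Y u)⁻¹‖ := hB.bijOn.mapsTo huU
    rw [hnorm] at this
    exact lt_inv_of_lt_inv₀ hr' this
  set g : ℂ → ℂ := Function.invFunOn Φ U
  have hg : ∀ z ∈ U, g (Φ z) = z := fun z hz => hB.bijOn.injOn.leftInvOn_invFunOn hz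
  have hgd : DifferentiableOn ℂ g {w | r' < ‖w‖} := by
    have := differentiableOn_inverse hB.isOpen hB.holomorphic hB.bijOn.injOn hg
    rwa [hB.bijOn.image_eq] at this
  have hgU : MapsTo g {w | r' < ‖w‖} U := (hB.bijOn.symm (hB.bijOn.invOn_invFunOn).symm).mapsTo
  have h0U : (0 : ℂ) ∉ U := fun h0 =>
    zero_notMem_basin (connectedComponentIn_subset _ _ (hB.subset_basin 0 h0))
  set s := min r r'⁻¹
  have hs : 0 < s := lt_min h.pos (inv_pos.2 hr')
  set G : ℂ → ℂ := fun v => if v = 0 then 0 else (g v⁻¹)⁻¹ with hG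
  have hGev : G =ᶠ[𝓝 0] gmap Y := by
    have := eventually_nhdsWithin_iff.1 hev
    filter_upwards [this] with v hv
    rcases eq_or_ne v 0 with rfl | hv0
    · simp [hG, IsInvBottcher.gmap_zero]
    · obtain ⟨h1, h2⟩ := hv hv0
      simp only [hG, if_neg hv0]
      rw [← h2, hg _ h1, inv_inv]
  have hinv : ∀ v ∈ ball (0 : ℂ) s, v ≠ 0 → v⁻¹ ∈ {w : ℂ | r' < ‖w‖} := by
    intro v hv hv0
    have hv := mem_ball_zero_iff.1 hv
    change r' < ‖v⁻¹‖
    rw [norm_inv]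
    exact lt_inv_of_lt_inv₀ (norm_pos_iff.2 hv0) (hv.trans_le (min_le_right _ _))
  have hGd : DifferentiableOn ℂ G (ball 0 s) := by
    intro v hv
    apply DifferentiableAt.differentiableWithinAt
    rcases eq_or_ne v 0 with rfl | hv0
    · exact (h.diff_gmap.differentiableAt h.ball_mem).congr_of_eventuallyEq hGev
    · have e : G =ᶠ[𝓝 v] fun v => (g v⁻¹)⁻¹ := by
        filter_upwards [isOpen_ne.mem_nhds hv0] with x hx
        simp only [hG, if_neg hx]
      refine DifferentiableAt.congr_of_eventuallyEq ?_ e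
      have hm := hinv v hv hv0
      have ho : IsOpen {w : ℂ | r' < ‖w‖} := isOpen_lt continuous_const continuous_norm
      have h1 : DifferentiableAt ℂ g v⁻¹ := hgd.differentiableAt (ho.mem_nhds hm)
      refine (h1.comp v (differentiableAt_inv hv0)).inv ?_
      intro h2
      have := hgU hm
      simp only [Function.comp] at h2
      rw [h2] at this
      exact h0U this
  have hus : u ∈ ball (0 : ℂ) s := mem_ball_zero_iff.2 (lt_min (mem_ball_zero_iff.1 hu) hur')
  have heq := (hGd.analyticOnNhd isOpen_ball).eqOn_of_preconnected_of_eventuallyEq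
    ((h.diff_gmap.mono (ball_subset_ball (min_le_left _ _))).analyticOnNhd isOpen_ball)
    (convex_ball (0 : ℂ) s).isPreconnected (mem_ball_self hs) hGev hus
  rw [← heq, hG]
  simp only [if_neg hu0, inv_inv]
  exact hB.bijOn.invOn_invFunOn.2 (hinv u hus hu0)

theorem isBottcherValue_iff {a : ℂ} (ha : a ∈ exteriorComponent) (w : ℂ) :
    IsBottcherValue a (-a) w ↔ w = (critCoord a)⁻¹ := by
  have h0 := (isCritCoord_critCoord ha).ne_zero
  obtain ⟨r, Y, S, h, hu, he⟩ := isCritCoord_critCoord ha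
  have e : (gmap Y (critCoord a))⁻¹ = -a := by
    rw [(h.gmap_eq_neg_inv_iff ha.1 hu).2 he, inv_neg, inv_inv]
  constructor
  · rintro ⟨r', U, Φ, hB, hU, rfl⟩
    rw [← e] at hU ⊢
    rw [h.bottcher_eq ha.1 hB hu h0 hU]
  · rintro rfl
    rw [← e]
    exact h.exists_isBottcher ha hu h0

/-! ### Logarithmic energy -/

theorem toENNReal_add_ofReal {x : EReal} {D : ℝ} (hD : 0 ≤ D) (hx : -(D : EReal) ≤ x) :
    x.toENNReal + ENNReal.ofReal D = (x + D).toENNReal + (-x).toENNReal := by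
  induction x using EReal.rec with
  | bot =>
    exfalso
    rw [← EReal.coe_neg, le_bot_iff] at hx
    exact EReal.coe_ne_bot _ hx
  | top => simp
  | coe x =>
    have hx : -D ≤ x := by exact_mod_cast hx
    rw [← EReal.coe_add, ← EReal.coe_neg]
    simp only [EReal.real_coe_toENNReal]
    rcases le_total 0 x with h | h
    · rw [ENNReal.ofReal_of_nonpos (neg_nonpos.2 h), add_zero, ENNReal.ofReal_add h hD]
    · rw [ENNReal.ofReal_of_nonpos h, zero_add, ← ENNReal.ofReal_add (by linarith) (by linarith)]
      congr 1
      ring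

theorem measurable_neg_log_edist :
    Measurable fun p : ℂ × ℂ => -ENNReal.log (edist p.1 p.2) :=
  ((measurable_fst.edist measurable_snd).ennreal_log).neg

theorem ae_prod_mem {μ ν : Measure ℂ} [SFinite μ] [SFinite ν] {C C' : Set ℂ}
    (h : μ Cᶜ = 0) (h' : ν C'ᶜ = 0) :
    ∀ᵐ p ∂μ.prod ν, p.1 ∈ C ∧ p.2 ∈ C' := by
  have h1 : ∀ᵐ z ∂μ, z ∈ C := h
  have h2 : ∀ᵐ z ∂ν, z ∈ C' := h'
  exact (Measure.quasiMeasurePreserving_fst.ae h1).and (Measure.quasiMeasurePreserving_snd.ae h2)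

theorem neg_le_neg_log_edist {z w : ℂ} {D : ℝ} (h : dist z w ≤ Real.exp D) :
    -(D : EReal) ≤ -ENNReal.log (edist z w) := by
  rw [EReal.neg_le_neg_iff]
  calc ENNReal.log (edist z w) ≤ ENNReal.log (ENNReal.ofReal (Real.exp D)) := by
        apply ENNReal.log_le_log
        rw [edist_dist]
        exact ENNReal.ofReal_le_ofReal h
    _ = D := by rw [ENNReal.log_ofReal_of_pos (Real.exp_pos D), Real.log_exp]

/-- On a set of diameter at most e^D, adding D makes the kernel nonnegative, so the difference of
two extended integrals becomes a single lower integral and no ∞ - ∞ can arise. -/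
theorem logEnergy_eq {μ : Measure ℂ} [IsProbabilityMeasure μ] {C : Set ℂ}
    (hμ : μ Cᶜ = 0) {D : ℝ} (hD : 0 ≤ D) (hd : ∀ z ∈ C, ∀ w ∈ C, dist z w ≤ Real.exp D) :
    logEnergy μ = ((∫⁻ p, (-ENNReal.log (edist p.1 p.2) + D).toENNReal ∂(μ.prod μ) : ENNReal) :
      EReal) - (D : EReal) := by
  have hm := measurable_neg_log_edist
  have hae := ae_prod_mem hμ hμ
  have e1 : (∫⁻ z, ∫⁻ w, (-ENNReal.log (edist z w)).toENNReal ∂μ ∂μ) =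
      ∫⁻ p, (-ENNReal.log (edist p.1 p.2)).toENNReal ∂(μ.prod μ) :=
    (lintegral_prod (fun p : ℂ × ℂ => (-ENNReal.log (edist p.1 p.2)).toENNReal)
      hm.ereal_toENNReal.aemeasurable).symm
  have e2 : (∫⁻ z, ∫⁻ w, (ENNReal.log (edist z w)).toENNReal ∂μ ∂μ) =
      ∫⁻ p, (- -ENNReal.log (edist p.1 p.2)).toENNReal ∂(μ.prod μ) := by
    simp only [neg_neg]
    exact (lintegral_prod (fun p : ℂ × ℂ => (ENNReal.log (edist p.1 p.2)).toENNReal)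
      (measurable_fst.edist measurable_snd).ennreal_log.ereal_toENNReal.aemeasurable).symm
  set A := ∫⁻ p, (-ENNReal.log (edist p.1 p.2)).toENNReal ∂(μ.prod μ)
  set B := ∫⁻ p, (- -ENNReal.log (edist p.1 p.2)).toENNReal ∂(μ.prod μ)
  set G := ∫⁻ p, (-ENNReal.log (edist p.1 p.2) + D).toENNReal ∂(μ.prod μ)
  have hAG : A + ENNReal.ofReal D = G + B := by
    have h1 : A + ENNReal.ofReal D =
        ∫⁻ p, ((-ENNReal.log (edist p.1 p.2)).toENNReal + ENNReal.ofReal D) ∂(μ.prod μ) := by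
      rw [lintegral_add_right _ measurable_const, lintegral_const, measure_univ, mul_one]
    have h2 : G + B = ∫⁻ p, ((-ENNReal.log (edist p.1 p.2) + D).toENNReal +
        (- -ENNReal.log (edist p.1 p.2)).toENNReal) ∂(μ.prod μ) := by
      have hm' : Measurable fun p : ℂ × ℂ => (- -ENNReal.log (edist p.1 p.2)).toENNReal :=
        hm.neg.ereal_toENNReal
      rw [lintegral_add_right _ hm']
    rw [h1, h2]
    refine lintegral_congr_ae ?_
    filter_upwards [hae] with p hp
    exact toENNReal_add_ofReal hD (neg_le_neg_log_edist (hd _ hp.1 _ hp.2))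
  have hB : B ≤ ENNReal.ofReal D := by
    have : B ≤ ∫⁻ _, ENNReal.ofReal D ∂(μ.prod μ) := by
      refine lintegral_mono_ae ?_
      filter_upwards [hae] with p hp
      have := neg_le_neg_log_edist (hd _ hp.1 _ hp.2)
      rw [← EReal.real_coe_toENNReal]
      exact EReal.toENNReal_le_toENNReal (EReal.neg_le_of_neg_le this)
    simpa using this
  have hBt : B ≠ ⊤ := (hB.trans_lt ENNReal.ofReal_lt_top).ne
  have hBr : ((B : ENNReal) : EReal) = ((B.toReal : ℝ) : EReal) := (EReal.coe_ennreal_toReal hBt).symm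
  have hcoe := congrArg (fun x : ENNReal => (x : EReal)) hAG
  simp only [EReal.coe_ennreal_add, EReal.coe_ennreal_ofReal, max_eq_left hD] at hcoe
  rw [logEnergy, e1, e2]
  rw [hBr] at hcoe ⊢
  have h3 : (A : EReal) = G + B.toReal - D := by rw [← hcoe, EReal.add_sub_cancel_right]
  rw [h3, sub_eq_add_neg, sub_eq_add_neg, add_right_comm, ← sub_eq_add_neg (_ + _) (_ : EReal),
    ← sub_eq_add_neg, EReal.add_sub_cancel_right]

theorem integral_le_logEnergy {μ : Measure ℂ} [IsProbabilityMeasure μ] {C : Set ℂ}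
    (hC : IsCompact C) (hμ : μ Cᶜ = 0) {k : ℂ × ℂ → ℝ} (hk : Integrable k (μ.prod μ))
    (hle : ∀ z ∈ C, ∀ w ∈ C, (k (z, w) : EReal) ≤ -ENNReal.log (edist z w)) :
    ((∫ p, k p ∂(μ.prod μ) : ℝ) : EReal) ≤ logEnergy μ := by
  obtain ⟨R, hR⟩ := hC.isBounded.exists_norm_le
  set D := max 0 (Real.log (2 * max R 1))
  have hD : 0 ≤ D := le_max_left _ _
  have hd : ∀ z ∈ C, ∀ w ∈ C, dist z w ≤ Real.exp D := by
    intro z hz w hw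
    have h0 : 0 < 2 * max R 1 := by
      have := le_max_right R 1
      linarith
    calc dist z w ≤ ‖z‖ + ‖w‖ := by rw [dist_eq_norm]; exact norm_sub_le _ _
      _ ≤ 2 * max R 1 := by linarith [hR z hz, hR w hw, le_max_left R 1]
      _ = Real.exp (Real.log (2 * max R 1)) := (Real.exp_log h0).symm
      _ ≤ Real.exp D := Real.exp_le_exp.2 (le_max_right _ _)
  rw [logEnergy_eq hμ hD hd]
  have hkD : Integrable (fun p => max (k p + D) 0) (μ.prod μ) :=
    (hk.add (integrable_const D)).sup (integrable_const 0)
  have h1 : ∫ p, k p ∂(μ.prod μ) + D ≤ ∫ p, max (k p + D) 0 ∂(μ.prod μ) := by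
    have : ∫ p, k p ∂(μ.prod μ) + D = ∫ p, (k p + D) ∂(μ.prod μ) := by
      rw [integral_add hk (integrable_const D)]
      simp
    rw [this]
    exact integral_mono (hk.add (integrable_const D)) hkD fun p => le_max_left _ _
  have h2 : ENNReal.ofReal (∫ p, max (k p + D) 0 ∂(μ.prod μ)) ≤
      ∫⁻ p, (-ENNReal.log (edist p.1 p.2) + D).toENNReal ∂(μ.prod μ) := by
    rw [ofReal_integral_eq_lintegral_ofReal hkD (Eventually.of_forall fun p => le_max_right _ _)]
    refine lintegral_mono_ae ?_
    filter_upwards [ae_prod_mem hμ hμ] with p hp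
    rw [ENNReal.ofReal_max, ENNReal.ofReal_zero, max_eq_left zero_le, ← EReal.real_coe_toENNReal, EReal.coe_add]
    exact EReal.toENNReal_le_toENNReal (add_le_add (hle _ hp.1 _ hp.2) le_rfl)
  have h3 : ((∫ p, k p ∂(μ.prod μ) : ℝ) : EReal) =
      ((∫ p, k p ∂(μ.prod μ) + D : ℝ) : EReal) - (D : EReal) := by
    rw [← EReal.coe_sub, add_sub_cancel_right]
  rw [h3]
  refine EReal.sub_le_sub ?_ le_rfl
  calc ((∫ p, k p ∂(μ.prod μ) + D : ℝ) : EReal)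
      ≤ ((∫ p, max (k p + D) 0 ∂(μ.prod μ) : ℝ) : EReal) := by exact_mod_cast h1
    _ ≤ (ENNReal.ofReal (∫ p, max (k p + D) 0 ∂(μ.prod μ)) : EReal) := by
        rw [EReal.coe_ennreal_ofReal]
        exact_mod_cast le_max_left _ _
    _ ≤ _ := EReal.coe_ennreal_le_coe_ennreal_iff.2 h2

/-- The logarithmic kernel, truncated from above and from below. -/
def clampLog (D : ℝ) (n : ℕ) (p : ℂ × ℂ) : ℝ :=
  -Real.log (max (Real.exp (-n)) (min (dist p.1 p.2) (Real.exp D)))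

theorem continuous_clampLog (D : ℝ) (n : ℕ) : Continuous (clampLog D n) := by
  unfold clampLog
  refine (Continuous.log (by fun_prop) fun p => ?_).neg
  exact ((Real.exp_pos _).trans_le (le_max_left _ _)).ne'

theorem neg_le_clampLog {D : ℝ} (hD : 0 ≤ D) (n : ℕ) (p : ℂ × ℂ) : -D ≤ clampLog D n p := by
  unfold clampLog
  rw [neg_le_neg_iff]
  rw [Real.log_le_iff_le_exp ((Real.exp_pos _).trans_le (le_max_left _ _))]
  refine max_le (Real.exp_le_exp.2 ?_) (min_le_right _ _)
  have : (0 : ℝ) ≤ n := Nat.cast_nonneg n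
  linarith

theorem clampLog_le (D : ℝ) (n : ℕ) (p : ℂ × ℂ) : clampLog D n p ≤ n := by
  unfold clampLog
  rw [neg_le, Real.le_log_iff_exp_le ((Real.exp_pos _).trans_le (le_max_left _ _))]
  exact le_max_left _ _

theorem clampLog_le_neg_log {D : ℝ} {n : ℕ} {z w : ℂ} (h : z ≠ w) (hd : dist z w ≤ Real.exp D) :
    clampLog D n (z, w) ≤ -Real.log (dist z w) := by
  unfold clampLog
  rw [neg_le_neg_iff]
  exact Real.log_le_log (dist_pos.2 h) ((le_min le_rfl hd).trans (le_max_right _ _))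

theorem tendsto_clampLog {D : ℝ} {z w : ℂ} (hd : dist z w ≤ Real.exp D) :
    Tendsto (fun n => ENNReal.ofReal (clampLog D n (z, w) + D)) atTop
      (𝓝 (-ENNReal.log (edist z w) + D).toENNReal) := by
  rcases eq_or_ne z w with rfl | h
  · simp only [edist_self, ENNReal.log_zero, EReal.neg_bot, EReal.top_add_coe,
      EReal.toENNReal_top]
    have e : ∀ n : ℕ, clampLog D n (z, z) = n := by
      intro n
      unfold clampLog
      rw [dist_self, min_eq_left (Real.exp_pos D).le, max_eq_left (Real.exp_pos _).le, Real.log_exp,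
        neg_neg]
    simp only [e]
    refine ENNReal.tendsto_ofReal_atTop.comp ?_
    exact tendsto_atTop_add_const_right _ _ tendsto_natCast_atTop_atTop
  · have hpos := dist_pos.2 h
    rw [edist_dist, ENNReal.log_ofReal_of_pos hpos, ← EReal.coe_neg, ← EReal.coe_add,
      EReal.real_coe_toENNReal]
    have hev : ∀ᶠ n : ℕ in atTop, Real.exp (-n) < dist z w := by
      have : Tendsto (fun n : ℕ => Real.exp (-n)) atTop (𝓝 0) :=
        Real.tendsto_exp_neg_atTop_nhds_zero.comp tendsto_natCast_atTop_atTop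
      exact this.eventually_lt_const hpos
    refine tendsto_const_nhds.congr' ?_
    filter_upwards [hev] with n hn
    simp only [clampLog]
    rw [min_eq_left hd, max_eq_right hn.le]

theorem integrable_clampLog {D : ℝ} (hD : 0 ≤ D) (n : ℕ) (μ : Measure (ℂ × ℂ)) [IsFiniteMeasure μ] :
    Integrable (clampLog D n) μ := by
  refine Integrable.of_bound (continuous_clampLog D n).aestronglyMeasurable (D + n)
    (Eventually.of_forall fun p => ?_)
  have h1 := neg_le_clampLog hD n p
  have h2 := clampLog_le D n p
  have : (0 : ℝ) ≤ n := Nat.cast_nonneg n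
  rw [Real.norm_eq_abs, abs_le]
  constructor <;> linarith

/-- Fatou's lemma for the truncated kernels, which tend to the logarithmic kernel, with the constant
D added to ensure positivity. -/
theorem logEnergy_le {μ : Measure ℂ} [IsProbabilityMeasure μ] {C : Set ℂ}
    (hμ : μ Cᶜ = 0) {D : ℝ} (hD : 0 ≤ D) (hd : ∀ z ∈ C, ∀ w ∈ C, dist z w ≤ Real.exp D) {x : ℝ}
    (hx : ∀ n, ∫ p, clampLog D n p ∂(μ.prod μ) ≤ x) : logEnergy μ ≤ x := by
  rw [logEnergy_eq hμ hD hd]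
  have h1 : ∫⁻ p, (-ENNReal.log (edist p.1 p.2) + D).toENNReal ∂(μ.prod μ) ≤
      ENNReal.ofReal (x + D) := by
    calc ∫⁻ p, (-ENNReal.log (edist p.1 p.2) + D).toENNReal ∂(μ.prod μ)
        = ∫⁻ p, liminf (fun n => ENNReal.ofReal (clampLog D n p + D)) atTop ∂(μ.prod μ) := by
          refine lintegral_congr_ae ?_
          filter_upwards [ae_prod_mem hμ hμ] with p hp
          exact ((tendsto_clampLog (hd _ hp.1 _ hp.2)).liminf_eq).symm
      _ ≤ liminf (fun n => ∫⁻ p, ENNReal.ofReal (clampLog D n p + D) ∂(μ.prod μ)) atTop :=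
          lintegral_liminf_le fun n =>
            ((continuous_clampLog D n).measurable.add_const D).ennreal_ofReal
      _ ≤ liminf (fun _ : ℕ => ENNReal.ofReal (x + D)) atTop := by
          refine liminf_le_liminf (Eventually.of_forall fun n => ?_)
          have hi := integrable_clampLog hD n (μ.prod μ)
          have hi' : Integrable (fun p => clampLog D n p + D) (μ.prod μ) :=
            hi.add (integrable_const D)
          rw [← ofReal_integral_eq_lintegral_ofReal hi' (Eventually.of_forall fun p => by
              have := neg_le_clampLog hD n p
              simp only [Pi.zero_apply]
              linarith), integral_add hi (integrable_const D)]
          apply ENNReal.ofReal_le_ofReal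
          simpa using hx n
      _ = ENNReal.ofReal (x + D) := by simp
  have hxD : 0 ≤ x + D := by
    have h2 : -D ≤ ∫ p, clampLog D 0 p ∂(μ.prod μ) := by
      have := integral_mono (μ := μ.prod μ) (integrable_const (-D)) (integrable_clampLog hD 0 _)
        fun p => neg_le_clampLog hD 0 p
      simpa using this
    linarith [hx 0]
  calc _ ≤ ((ENNReal.ofReal (x + D) : ENNReal) : EReal) - (D : EReal) :=
        EReal.sub_le_sub (EReal.coe_ennreal_le_coe_ennreal_iff.2 h1) le_rfl
    _ = x := by
        rw [EReal.coe_ennreal_ofReal, max_eq_left hxD, ← EReal.coe_sub, add_sub_cancel_right]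

/-! ### Conditional positive definiteness of the logarithmic kernel -/

/-- The stereographic image of `z` on the unit sphere, preceded by the constant `1`. -/
def sphereCoord (z : ℂ) : Fin 4 → ℝ :=
  ![1, 2 * z.re / (1 + ‖z‖ ^ 2), 2 * z.im / (1 + ‖z‖ ^ 2), (‖z‖ ^ 2 - 1) / (1 + ‖z‖ ^ 2)]

/-- One minus the square of the chordal distance of `z` and `w`, scaled to the diameter `1`. -/
def sphereKernel (z w : ℂ) : ℝ := (∑ i, sphereCoord z i * sphereCoord w i) / 2

theorem continuous_sphereCoord (i : Fin 4) : Continuous fun z => sphereCoord z i := by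
  have h : ∀ z : ℂ, 1 + ‖z‖ ^ 2 ≠ 0 := fun z => by positivity
  have h1 : Continuous fun z : ℂ => 2 * z.re / (1 + ‖z‖ ^ 2) :=
    (continuous_const.mul Complex.continuous_re).div (by fun_prop) h
  have h2 : Continuous fun z : ℂ => 2 * z.im / (1 + ‖z‖ ^ 2) :=
    (continuous_const.mul Complex.continuous_im).div (by fun_prop) h
  have h3 : Continuous fun z : ℂ => (‖z‖ ^ 2 - 1) / (1 + ‖z‖ ^ 2) :=
    Continuous.div (by fun_prop) (by fun_prop) h
  fin_cases i
  · exact continuous_const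
  · exact h1
  · exact h2
  · exact h3

theorem continuous_sphereKernel : Continuous fun p : ℂ × ℂ => sphereKernel p.1 p.2 := by
  unfold sphereKernel
  refine (continuous_finsetSum _ fun i _ => ?_).div_const 2
  exact ((continuous_sphereCoord i).comp continuous_fst).mul
    ((continuous_sphereCoord i).comp continuous_snd)

/-- With x, y the stereographic images, the kernel T is (1 + x·y)/2 = 1 - |x - y|²/4. Hence -log|z -
w| is -½ log(1 - T) up to one-variable terms, and these cancel for measures of equal mass. -/
theorem norm_sub_sq_eq (z w : ℂ) :
    ‖z - w‖ ^ 2 = (1 + ‖z‖ ^ 2) * (1 + ‖w‖ ^ 2) * (1 - sphereKernel z w) := by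
  have h1 : 1 + ‖z‖ ^ 2 ≠ 0 := by positivity
  have h2 : 1 + ‖w‖ ^ 2 ≠ 0 := by positivity
  simp only [sphereKernel, sphereCoord, Fin.sum_univ_four]
  simp
  field_simp
  simp only [Complex.sq_norm, Complex.normSq_apply, Complex.sub_re, Complex.sub_im]
  ring

theorem sphereKernel_nonneg (z w : ℂ) : 0 ≤ sphereKernel z w := by
  have h1 : 0 < 1 + ‖z‖ ^ 2 := by positivity
  have h2 : 0 < 1 + ‖w‖ ^ 2 := by positivity
  have e : (1 + ‖z‖ ^ 2) * (1 + ‖w‖ ^ 2) * sphereKernel z w =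
      (1 + z.re * w.re + z.im * w.im) ^ 2 + (z.im * w.re - z.re * w.im) ^ 2 := by
    have := norm_sub_sq_eq z w
    simp only [Complex.sq_norm, Complex.normSq_apply, Complex.sub_re, Complex.sub_im] at this ⊢
    linear_combination this
  by_contra! h
  have : (1 + ‖z‖ ^ 2) * (1 + ‖w‖ ^ 2) * sphereKernel z w < 0 := mul_neg_of_pos_of_neg
    (mul_pos h1 h2) h
  rw [e] at this
  nlinarith [sq_nonneg (1 + z.re * w.re + z.im * w.im), sq_nonneg (z.im * w.re - z.re * w.im)]

theorem sphereKernel_le_one (z w : ℂ) : sphereKernel z w ≤ 1 := by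
  have h1 : 0 < (1 + ‖z‖ ^ 2) * (1 + ‖w‖ ^ 2) := by positivity
  have h2 := norm_sub_sq_eq z w
  by_contra! h
  have := mul_neg_of_pos_of_neg h1 (show 1 - sphereKernel z w < 0 by linarith)
  rw [← h2] at this
  linarith [sq_nonneg ‖z - w‖]

theorem sphereKernel_lt_one {z w : ℂ} (h : z ≠ w) : sphereKernel z w < 1 := by
  refine lt_of_le_of_ne (sphereKernel_le_one z w) fun he => ?_
  have h2 := norm_sub_sq_eq z w
  rw [he, sub_self, mul_zero] at h2
  exact h (sub_eq_zero.1 (norm_eq_zero.1 (pow_eq_zero_iff two_ne_zero |>.1 h2)))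

theorem integrable_prod_sphereCoord (μ : Measure ℂ) [IsFiniteMeasure μ] {n : ℕ}
    (I : Fin n → Fin 4) : Integrable (fun z => ∏ j, sphereCoord z (I j)) μ := by
  refine Integrable.of_bound (continuous_finsetProd _ fun j _ =>
    continuous_sphereCoord (I j)).aestronglyMeasurable 1 (Eventually.of_forall fun z => ?_)
  rw [norm_prod]
  refine Finset.prod_le_one (fun _ _ => norm_nonneg _) fun j _ => ?_
  have h1 : 0 < 1 + ‖z‖ ^ 2 := by positivity
  have hre : z.re ^ 2 + z.im ^ 2 = ‖z‖ ^ 2 := by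
    rw [Complex.sq_norm, Complex.normSq_apply]; ring
  rw [Real.norm_eq_abs]
  generalize I j = i
  fin_cases i
  · simp [sphereCoord]
  · change |2 * z.re / (1 + ‖z‖ ^ 2)| ≤ 1
    rw [abs_le, le_div_iff₀ h1, div_le_iff₀ h1]
    constructor <;> nlinarith [sq_nonneg (z.re - 1), sq_nonneg (z.re + 1), sq_nonneg z.im]
  · change |2 * z.im / (1 + ‖z‖ ^ 2)| ≤ 1
    rw [abs_le, le_div_iff₀ h1, div_le_iff₀ h1]
    constructor <;> nlinarith [sq_nonneg (z.im - 1), sq_nonneg (z.im + 1), sq_nonneg z.re]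
  · change |(‖z‖ ^ 2 - 1) / (1 + ‖z‖ ^ 2)| ≤ 1
    rw [abs_le, le_div_iff₀ h1, div_le_iff₀ h1]
    constructor <;> nlinarith [sq_nonneg ‖z‖]

/-- The n-th power of an inner product is an inner product of n-fold tensors, so its double integral
is a positive multiple of a sum of products of moments. -/
theorem integral_sphereKernel_pow (μ ν : Measure ℂ) [IsFiniteMeasure μ] [IsFiniteMeasure ν]
    (n : ℕ) : ∫ p, sphereKernel p.1 p.2 ^ n ∂(μ.prod ν) =
      (1 / 2) ^ n * ∑ I : Fin n → Fin 4, (∫ z, ∏ j, sphereCoord z (I j) ∂μ) *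
        ∫ w, ∏ j, sphereCoord w (I j) ∂ν := by
  have e : ∀ p : ℂ × ℂ, sphereKernel p.1 p.2 ^ n = (1 / 2) ^ n * ∑ I : Fin n → Fin 4,
      (∏ j, sphereCoord p.1 (I j)) * ∏ j, sphereCoord p.2 (I j) := by
    intro p
    rw [sphereKernel, div_eq_mul_inv, mul_pow, Fintype.sum_pow, mul_comm, one_div]
    simp only [Finset.prod_mul_distrib]
  simp only [e]
  rw [integral_const_mul, integral_finsetSum]
  · congr 1
    refine Finset.sum_congr rfl fun I _ => ?_
    exact integral_prod_mul (fun z => ∏ j, sphereCoord z (I j)) fun w => ∏ j, sphereCoord w (I j)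
  · intro I _
    exact (integrable_prod_sphereCoord μ I).mul_prod (integrable_prod_sphereCoord ν I)

theorem hasSum_integral_log_sphereKernel (μ ν : Measure ℂ) [IsProbabilityMeasure μ]
    [IsProbabilityMeasure ν] {θ : ℝ} (h0 : 0 ≤ θ) (h1 : θ < 1) :
    HasSum (fun n : ℕ => θ ^ (n + 1) / (n + 1) * ∫ p, sphereKernel p.1 p.2 ^ (n + 1) ∂(μ.prod ν))
      (∫ p, -Real.log (1 - θ * sphereKernel p.1 p.2) ∂(μ.prod ν)) := by
  have hlt : ∀ p : ℂ × ℂ, |θ * sphereKernel p.1 p.2| ≤ θ := by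
    intro p
    rw [abs_of_nonneg (mul_nonneg h0 (sphereKernel_nonneg _ _))]
    exact mul_le_of_le_one_right h0 (sphereKernel_le_one _ _)
  set F : ℕ → ℂ × ℂ → ℝ := fun n p => (θ * sphereKernel p.1 p.2) ^ (n + 1) / (n + 1)
  have hF : ∀ n p, ‖F n p‖ ≤ θ ^ (n + 1) := by
    intro n p
    simp only [F]
    rw [norm_div, norm_pow, Real.norm_eq_abs, Real.norm_eq_abs,
      abs_of_nonneg (by positivity : (0 : ℝ) ≤ (n : ℝ) + 1)]
    refine (div_le_self (by positivity) (by linarith [(Nat.cast_nonneg n : (0 : ℝ) ≤ n)])).trans ?_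
    gcongr
    exact hlt p
  have hc : ∀ n, Continuous (F n) := fun n =>
    ((continuous_const.mul continuous_sphereKernel).pow _).div_const _
  have hint : ∀ n, Integrable (F n) (μ.prod ν) := fun n =>
    Integrable.of_bound (hc n).aestronglyMeasurable (θ ^ (n + 1)) (Eventually.of_forall (hF n))
  have hsum : Summable fun n => ∫ p, ‖F n p‖ ∂(μ.prod ν) := by
    refine Summable.of_nonneg_of_le (fun n => integral_nonneg fun _ => norm_nonneg _)
      (fun n => ?_) ((summable_geometric_of_lt_one h0 h1).mul_left θ)
    have := integral_mono (hint n).norm (integrable_const (θ ^ (n + 1))) (hF n)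
    simpa [pow_succ'] using this
  have key := hasSum_integral_of_summable_integral_norm hint hsum
  have e1 : ∀ p : ℂ × ℂ, ∑' n, F n p = -Real.log (1 - θ * sphereKernel p.1 p.2) := fun p =>
    (Real.hasSum_pow_div_log_of_abs_lt_one ((hlt p).trans_lt h1)).tsum_eq
  simp only [e1] at key
  have e2 : ∀ n : ℕ, θ ^ (n + 1) / (n + 1) * ∫ p, sphereKernel p.1 p.2 ^ (n + 1) ∂(μ.prod ν) =
      ∫ p, F n p ∂(μ.prod ν) := by
    intro n
    rw [← integral_const_mul]
    congr 1 with p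
    simp only [F]
    rw [mul_pow, mul_div_right_comm]
  simpa only [e2] using key

/-- In -log(1 - θT) = Σ θⁿTⁿ/n all coefficients are nonnegative; termwise the claim is 2xy ≤ x² + y²
for the moments. -/
theorem integral_log_sphereKernel_nonneg (μ ν : Measure ℂ) [IsProbabilityMeasure μ]
    [IsProbabilityMeasure ν] {θ : ℝ} (h0 : 0 ≤ θ) (h1 : θ < 1) :
    2 * ∫ p, -Real.log (1 - θ * sphereKernel p.1 p.2) ∂(μ.prod ν) ≤
      ∫ p, -Real.log (1 - θ * sphereKernel p.1 p.2) ∂(μ.prod μ) +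
        ∫ p, -Real.log (1 - θ * sphereKernel p.1 p.2) ∂(ν.prod ν) := by
  refine hasSum_le (fun n => ?_) ((hasSum_integral_log_sphereKernel μ ν h0 h1).mul_left 2)
    ((hasSum_integral_log_sphereKernel μ μ h0 h1).add (hasSum_integral_log_sphereKernel ν ν h0 h1))
  rw [← mul_add, mul_left_comm]
  refine mul_le_mul_of_nonneg_left ?_ (by positivity)
  simp only [integral_sphereKernel_pow]
  rw [← mul_add, mul_left_comm, Finset.mul_sum, ← Finset.sum_add_distrib]
  refine mul_le_mul_of_nonneg_left (Finset.sum_le_sum fun I _ => ?_) (by positivity)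
  nlinarith [sq_nonneg ((∫ z, ∏ j, sphereCoord z (I j) ∂μ) - ∫ z, ∏ j, sphereCoord z (I j) ∂ν)]

/-- A continuous, conditionally positive definite kernel that increases to `-log |z - w|` as
`θ → 1`. -/
def regLog (θ : ℝ) (p : ℂ × ℂ) : ℝ :=
  -Real.log (1 - θ * sphereKernel p.1 p.2) / 2 - Real.log (1 + ‖p.1‖ ^ 2) / 2 -
    Real.log (1 + ‖p.2‖ ^ 2) / 2

theorem one_sub_mul_sphereKernel_pos {θ : ℝ} (h0 : 0 ≤ θ) (h1 : θ < 1) (z w : ℂ) :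
    0 < 1 - θ * sphereKernel z w := by
  have := mul_le_of_le_one_right h0 (sphereKernel_le_one z w)
  linarith

theorem continuous_log_sphereKernel {θ : ℝ} (h0 : 0 ≤ θ) (h1 : θ < 1) :
    Continuous fun p : ℂ × ℂ => -Real.log (1 - θ * sphereKernel p.1 p.2) :=
  (Continuous.log (continuous_const.sub (continuous_const.mul continuous_sphereKernel))
    fun _ => (one_sub_mul_sphereKernel_pos h0 h1 _ _).ne').neg

theorem continuous_log_one_add_sq : Continuous fun z : ℂ => Real.log (1 + ‖z‖ ^ 2) :=
  Continuous.log (by fun_prop) fun z => by positivity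

theorem continuous_regLog {θ : ℝ} (h0 : 0 ≤ θ) (h1 : θ < 1) : Continuous (regLog θ) :=
  (((continuous_log_sphereKernel h0 h1).div_const 2).sub
    ((continuous_log_one_add_sq.comp continuous_fst).div_const 2)).sub
    ((continuous_log_one_add_sq.comp continuous_snd).div_const 2)

theorem neg_log_dist_eq {z w : ℂ} (h : z ≠ w) : -Real.log (dist z w) =
    -Real.log (1 - sphereKernel z w) / 2 - Real.log (1 + ‖z‖ ^ 2) / 2 -
      Real.log (1 + ‖w‖ ^ 2) / 2 := by
  have h1 : 1 - sphereKernel z w ≠ 0 := by linarith [sphereKernel_lt_one h]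
  have h2 := congrArg Real.log (norm_sub_sq_eq z w)
  rw [Real.log_mul (by positivity) h1, Real.log_mul (by positivity) (by positivity), Real.log_pow]
    at h2
  rw [dist_eq_norm]
  push_cast at h2
  linarith

theorem regLog_le {θ : ℝ} (h1 : θ ≤ 1) {z w : ℂ} (h : z ≠ w) :
    regLog θ (z, w) ≤ -Real.log (dist z w) := by
  rw [neg_log_dist_eq h, regLog]
  have h2 := sphereKernel_lt_one h
  have h3 := mul_le_of_le_one_left (sphereKernel_nonneg z w) h1
  have := Real.log_le_log (show 0 < 1 - sphereKernel z w by linarith)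
    (show 1 - sphereKernel z w ≤ 1 - θ * sphereKernel z w by linarith)
  simp only
  linarith

/-- For points at chordal distance bounded below, log(1 + x) ≤ x controls the loss due to θ < 1 by a
term vanishing as θ → 1. -/
theorem le_regLog {θ δ : ℝ} (h1 : θ ≤ 1) (hδ : 0 < δ) {z w : ℂ}
    (h : sphereKernel z w ≤ 1 - δ) : -Real.log (dist z w) - (1 - θ) / δ / 2 ≤ regLog θ (z, w) := by
  have hne : z ≠ w := by
    rintro rfl
    have := norm_sub_sq_eq z z
    rw [sub_self, norm_zero] at this
    have : 0 < (1 + ‖z‖ ^ 2) * (1 + ‖z‖ ^ 2) * (1 - sphereKernel z z) := by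
      have : 0 < 1 - sphereKernel z z := by linarith
      positivity
    linarith
  rw [neg_log_dist_eq hne, regLog]
  have h2 := sphereKernel_nonneg z w
  have h3 := sphereKernel_le_one z w
  set T := sphereKernel z w
  have hx : 0 < 1 - T := by linarith
  have hy : 0 ≤ (1 - θ) * T := mul_nonneg (by linarith) h2
  have e : 1 - θ * T = (1 - T) * (1 + (1 - θ) * T / (1 - T)) := by field_simp; ring
  have hpos : 0 < 1 + (1 - θ) * T / (1 - T) := by positivity
  have h4 : Real.log (1 - θ * T) ≤ Real.log (1 - T) + (1 - θ) / δ := by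
    rw [e, Real.log_mul hx.ne' hpos.ne']
    have h5 := Real.log_le_sub_one_of_pos hpos
    have h6 : (1 - θ) * T / (1 - T) ≤ (1 - θ) / δ := by
      have : (1 - θ) * T ≤ (1 - θ) := mul_le_of_le_one_right (by linarith) h3
      exact div_le_div₀ (by linarith) this hδ (by linarith)
    linarith
  simp only
  linarith

theorem integrable_of_continuous {X : Type*} [TopologicalSpace X] [MeasurableSpace X]
    [OpensMeasurableSpace X] [T2Space X] {μ : Measure X} [IsFiniteMeasure μ] {C : Set X}
    (hC : IsCompact C) (h : μ Cᶜ = 0) {f : X → ℝ} (hf : Continuous f) : Integrable f μ := by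
  have := hf.continuousOn.integrableOn_compact (μ := μ) hC
  rwa [IntegrableOn, Measure.restrict_eq_self_of_ae_mem (show ∀ᵐ x ∂μ, x ∈ C from h)] at this

theorem integrable_prod_of_continuous {μ ν : Measure ℂ} [IsFiniteMeasure μ] [IsFiniteMeasure ν]
    {C C' : Set ℂ} (hC : IsCompact C) (hC' : IsCompact C') (h : μ Cᶜ = 0) (h' : ν C'ᶜ = 0)
    {f : ℂ × ℂ → ℝ} (hf : Continuous f) : Integrable f (μ.prod ν) :=
  integrable_of_continuous (hC.prod hC') (ae_prod_mem h h') hf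

theorem integral_regLog {μ ν : Measure ℂ} [IsProbabilityMeasure μ] [IsProbabilityMeasure ν]
    {C C' : Set ℂ} (hC : IsCompact C) (hC' : IsCompact C') (h : μ Cᶜ = 0) (h' : ν C'ᶜ = 0)
    {θ : ℝ} (h0 : 0 ≤ θ) (h1 : θ < 1) : ∫ p, regLog θ p ∂(μ.prod ν) =
      (∫ p, -Real.log (1 - θ * sphereKernel p.1 p.2) ∂(μ.prod ν)) / 2 -
        (∫ z, Real.log (1 + ‖z‖ ^ 2) ∂μ) / 2 - (∫ z, Real.log (1 + ‖z‖ ^ 2) ∂ν) / 2 := by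
  have i1 := (integrable_prod_of_continuous hC hC' h h' (continuous_log_sphereKernel h0 h1)).div_const 2
  have i2 := (integrable_prod_of_continuous hC hC' h h'
    (continuous_log_one_add_sq.comp continuous_fst)).div_const 2
  have i3 := (integrable_prod_of_continuous hC hC' h h'
    (continuous_log_one_add_sq.comp continuous_snd)).div_const 2
  simp only [Function.comp] at i2 i3
  have i4 : Integrable (fun p : ℂ × ℂ => -Real.log (1 - θ * sphereKernel p.1 p.2) / 2 -
      Real.log (1 + ‖p.1‖ ^ 2) / 2) (μ.prod ν) := i1.sub i2
  unfold regLog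
  rw [integral_sub i4 i3, integral_sub i1 i2, integral_div, integral_div, integral_div,
    integral_fun_fst (fun z : ℂ => Real.log (1 + ‖z‖ ^ 2)),
    integral_fun_snd (fun z : ℂ => Real.log (1 + ‖z‖ ^ 2))]
  simp

theorem integral_regLog_le {μ ν : Measure ℂ} [IsProbabilityMeasure μ] [IsProbabilityMeasure ν]
    {C C' : Set ℂ} (hC : IsCompact C) (hC' : IsCompact C') (h : μ Cᶜ = 0) (h' : ν C'ᶜ = 0)
    {θ : ℝ} (h0 : 0 ≤ θ) (h1 : θ < 1) : 2 * ∫ p, regLog θ p ∂(μ.prod ν) ≤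
      ∫ p, regLog θ p ∂(μ.prod μ) + ∫ p, regLog θ p ∂(ν.prod ν) := by
  rw [integral_regLog hC hC' h h' h0 h1, integral_regLog hC hC h h h0 h1,
    integral_regLog hC' hC' h' h' h0 h1]
  linarith [integral_log_sphereKernel_nonneg μ ν h0 h1]

/-! ### Equipotential measures of the parameter plane -/

/-- The inverse of `a ↦ critCoord a`, as a map from the punctured unit disc onto `P_∞`. -/
def extPsi (c : ℂ) : ℂ := (extParam c)⁻¹

theorem sphere_subset_ball_one {s : ℝ} (h1 : s < 1) : sphere (0 : ℂ) s ⊆ ball 0 1 :=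
  sphere_subset_closedBall.trans (closedBall_subset_ball h1)

theorem ne_zero_of_mem_sphere_zero {s : ℝ} (h0 : 0 < s) {c : ℂ} (hc : c ∈ sphere (0 : ℂ) s) :
    c ≠ 0 := ne_of_mem_sphere hc h0.ne'

theorem extPsi_mem {c : ℂ} (hc : c ∈ ball (0 : ℂ) 1) (h : c ≠ 0) : extPsi c ∈ exteriorComponent :=
  (bijOn_extParam.mapsTo hc).resolve_left (extParam_ne_zero hc h)

theorem injOn_extPsi : InjOn extPsi (ball 0 1) := fun _ hx _ hy h =>
  bijOn_extParam.injOn hx hy (inv_injective h)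

theorem differentiableOn_extPsi : DifferentiableOn ℂ extPsi (ball 0 1 \ {0}) :=
  (differentiableOn_extParam.mono sdiff_subset).inv fun _ hc => extParam_ne_zero hc.1 hc.2

theorem exists_extPsi_eq {a : ℂ} (ha : a ∈ exteriorComponent) :
    ∃ c ∈ ball (0 : ℂ) 1, c ≠ 0 ∧ extPsi c = a := by
  have h : a⁻¹ ∈ extDomain := Or.inr (by rwa [inv_inv])
  refine ⟨extCoord a⁻¹, mapsTo_extCoord h, ?_, ?_⟩
  · rw [extCoord, inv_inv]
    exact (isCritCoord_critCoord ha).ne_zero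
  · rw [extPsi, invOn_extParam.1 h, inv_inv]

theorem critCoord_extPsi {c : ℂ} (hc : c ∈ ball (0 : ℂ) 1) : critCoord (extPsi c) = c :=
  invOn_extParam.2 hc

theorem continuousOn_extPsi_sphere {s : ℝ} (h0 : 0 < s) (h1 : s < 1) :
    ContinuousOn extPsi (sphere 0 s) :=
  differentiableOn_extPsi.continuousOn.mono fun _ hc =>
    ⟨sphere_subset_ball_one h1 hc, ne_zero_of_mem_sphere_zero h0 hc⟩

theorem differentiableOn_dslope_extParam {c₀ : ℂ} (hc₀ : c₀ ∈ ball (0 : ℂ) 1) :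
    DifferentiableOn ℂ (dslope extParam c₀) (ball 0 1) :=
  (Complex.differentiableOn_dslope (isOpen_ball.mem_nhds hc₀)).2 differentiableOn_extParam

theorem dslope_extParam_ne_zero {c₀ c : ℂ} (hc₀ : c₀ ∈ ball (0 : ℂ) 1) (hc : c ∈ ball (0 : ℂ) 1) :
    dslope extParam c₀ c ≠ 0 := by
  rcases eq_or_ne c c₀ with rfl | h
  · rw [dslope_same]
    exact deriv_ne_zero_of_injOn isOpen_ball differentiableOn_extParam bijOn_extParam.injOn hc
  · rw [dslope_of_ne _ h, slope_def_field]
    exact div_ne_zero (sub_ne_zero.2 fun he => h (bijOn_extParam.injOn hc hc₀ he))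
      (sub_ne_zero.2 h)

theorem extParam_sub_eq (c₀ c : ℂ) :
    extParam c - extParam c₀ = (c - c₀) * dslope extParam c₀ c := by
  have := sub_smul_dslope extParam c₀ c
  rw [smul_eq_mul] at this
  exact this.symm

theorem extParam_eq (c : ℂ) : extParam c = c * dslope extParam 0 c := by
  have := extParam_sub_eq 0 c
  rwa [extParam_zero, sub_zero, sub_zero] at this

theorem dslope_extParam_zero : dslope extParam 0 0 = -1 / 2 := by
  rw [dslope_same, hasDerivAt_extParam_zero.deriv]

theorem circleAverage_log_norm_of_ball {H : ℂ → ℂ} (hH : DifferentiableOn ℂ H (ball 0 1))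
    (hne : ∀ c ∈ ball (0 : ℂ) 1, H c ≠ 0) {s : ℝ} (h0 : 0 < s) (h1 : s < 1) :
    CircleIntegrable (fun c => Real.log ‖H c‖) 0 s ∧
      Real.circleAverage (fun c => Real.log ‖H c‖) 0 s = Real.log ‖H 0‖ := by
  have hsub : closedBall (0 : ℂ) |s| ⊆ ball 0 1 := by
    rw [abs_of_pos h0]
    exact closedBall_subset_ball h1
  have han := (hH.analyticOnNhd isOpen_ball).mono hsub
  refine ⟨?_, AnalyticOnNhd.circleAverage_log_norm_of_ne_zero han fun c hc => hne c (hsub hc)⟩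
  refine ContinuousOn.circleIntegrable h0.le (ContinuousOn.log ?_ ?_)
  · exact (hH.continuousOn.mono (sphere_subset_ball_one h1)).norm
  · exact fun c hc => norm_ne_zero_iff.2 (hne c (sphere_subset_ball_one h1 hc))

/-- For z outside P_∞, c(ψ(c) - z) extends to a zero-free holomorphic function on the disc with
value -2 at 0; the mean value property for its log modulus gives log 2, and |c| = s contributes -log
s. -/
theorem circleAverage_log_norm_extPsi_sub {z : ℂ} (hz : z ∉ exteriorComponent) {s : ℝ} (h0 : 0 < s)
    (h1 : s < 1) :
    Real.circleAverage (fun c => Real.log ‖extPsi c - z‖) 0 s = Real.log 2 - Real.log s := by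
  set W := dslope extParam 0
  have hW := differentiableOn_dslope_extParam (mem_ball_self one_pos)
  have hW0 : ∀ c ∈ ball (0 : ℂ) 1, W c ≠ 0 := fun c hc =>
    dslope_extParam_ne_zero (mem_ball_self one_pos) hc
  have hn : ∀ c ∈ ball (0 : ℂ) 1, 1 - z * extParam c ≠ 0 := by
    intro c hc he
    rcases eq_or_ne c 0 with rfl | hc0
    · simp [extParam_zero] at he
    · apply hz
      have : z = extPsi c := by
        apply eq_inv_of_mul_eq_one_left
        linear_combination -he
      rw [this]
      exact extPsi_mem hc hc0
  set H : ℂ → ℂ := fun c => (1 - z * extParam c) / W c with hH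
  obtain ⟨hi, ha⟩ := circleAverage_log_norm_of_ball (H := H)
    (((differentiableOn_const 1).sub (differentiableOn_extParam.const_mul z)).div hW hW0)
    (fun c hc => div_ne_zero (hn c hc) (hW0 c hc)) h0 h1
  have hval : Real.log ‖H 0‖ = Real.log 2 := by
    simp only [hH, W]
    rw [extParam_zero, dslope_extParam_zero]
    norm_num
  have hcongr : Real.circleAverage (fun c => Real.log ‖extPsi c - z‖) 0 s =
      Real.circleAverage (fun c => Real.log ‖H c‖ - Real.log s) 0 s := by
    refine Real.circleAverage_congr_sphere ?_
    rw [abs_of_pos h0]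
    intro c hc
    have hcb := sphere_subset_ball_one h1 hc
    have hc0 := ne_zero_of_mem_sphere_zero h0 hc
    have hcs : ‖c‖ = s := by simpa using hc
    have e : extPsi c - z = H c / c := by
      simp only [hH]
      rw [extPsi, extParam_eq c]
      change (c * W c)⁻¹ - z = (1 - z * (c * W c)) / W c / c
      have := hW0 c hcb
      field_simp
    simp only
    rw [e, norm_div, Real.log_div (norm_ne_zero_iff.2 (div_ne_zero (hn c hcb) (hW0 c hcb)))
      (norm_ne_zero_iff.2 hc0), hcs]
  rw [hcongr, Real.circleAverage_fun_sub hi (circleIntegrable_const _ _ _), ha, hval,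
    Real.circleAverage_const]

/-- For a point ψ(c₀) on the level curve, ψ(c₀) - ψ(c) = H(c)(c - c₀)/c with H zero-free and |H(0)|
= 2/s. The average of log|c - c₀| is log s, so the potential is again log s - log 2; the singular
point c₀ is negligible. -/
theorem circleAverage_le_of_le_neg_log {s : ℝ} (h0 : 0 < s) (h1 : s < 1) {c₀ : ℂ}
    (hc₀ : c₀ ∈ sphere (0 : ℂ) s) {g : ℂ → ℝ} (hg : Continuous g)
    (hle : ∀ c ∈ sphere (0 : ℂ) s, c ≠ c₀ →
      g (extPsi c) ≤ -Real.log (dist (extPsi c₀) (extPsi c))) :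
    Real.circleAverage (fun c => g (extPsi c)) 0 s ≤ Real.log s - Real.log 2 := by
  have hc₀b := sphere_subset_ball_one h1 hc₀
  have hc₀0 := ne_zero_of_mem_sphere_zero h0 hc₀
  have hc₀s : ‖c₀‖ = s := by simpa using hc₀
  have hV0 := extParam_ne_zero hc₀b hc₀0
  set W := dslope extParam 0
  have hW := differentiableOn_dslope_extParam (mem_ball_self one_pos)
  have hW0 : ∀ c ∈ ball (0 : ℂ) 1, W c ≠ 0 := fun c hc =>
    dslope_extParam_ne_zero (mem_ball_self one_pos) hc
  have hQ := differentiableOn_dslope_extParam hc₀b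
  have hQ0 : ∀ c ∈ ball (0 : ℂ) 1, dslope extParam c₀ c ≠ 0 := fun c hc =>
    dslope_extParam_ne_zero hc₀b hc
  set Q := dslope extParam c₀ with hQdef
  set H : ℂ → ℂ := fun c => Q c / (W c * extParam c₀) with hH
  have hHne : ∀ c ∈ ball (0 : ℂ) 1, H c ≠ 0 := fun c hc =>
    div_ne_zero (hQ0 c hc) (mul_ne_zero (hW0 c hc) hV0)
  obtain ⟨hi, ha⟩ := circleAverage_log_norm_of_ball (H := H)
    (hQ.div (hW.mul_const _) fun c hc => mul_ne_zero (hW0 c hc) hV0) hHne h0 h1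
  have hval : Real.log ‖H 0‖ = Real.log 2 - Real.log s := by
    have e : H 0 = -2 / c₀ := by
      have h2 : _ = (0 - c₀) * Q 0 := extParam_sub_eq c₀ 0
      rw [extParam_zero] at h2
      have h3 : Q 0 = extParam c₀ / c₀ := by
        rw [eq_div_iff hc₀0]
        linear_combination h2
      simp only [hH, W]
      rw [h3, dslope_extParam_zero]
      field_simp
    rw [e, norm_div, hc₀s, norm_neg, Real.log_div (by norm_num) h0.ne']
    norm_num
  have hi2 : CircleIntegrable (fun c => Real.log ‖c - c₀‖) 0 s :=
    circleIntegrable_log_norm_sub_const s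
  have ha2 : Real.circleAverage (fun c => Real.log ‖c - c₀‖) 0 s = Real.log s := by
    apply circleAverage_log_norm_sub_const_of_mem_closedBall
    rw [abs_of_pos h0]
    exact sphere_subset_closedBall hc₀
  set f : ℂ → ℝ := fun c => Real.log s - (Real.log ‖H c‖ + Real.log ‖c - c₀‖) with hf
  have hi3 : CircleIntegrable (fun c => Real.log ‖H c‖ + Real.log ‖c - c₀‖) 0 s := hi.add hi2
  have hfi : CircleIntegrable f 0 s := (circleIntegrable_const _ _ _).sub hi3
  have hfa : Real.circleAverage f 0 s = Real.log s - Real.log 2 := by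
    rw [hf, Real.circleAverage_fun_sub (circleIntegrable_const _ _ _) hi3,
      Real.circleAverage_fun_add hi hi2, ha, ha2, hval, Real.circleAverage_const]
    ring
  have hgi : CircleIntegrable (fun c => g (extPsi c)) 0 s :=
    ContinuousOn.circleIntegrable h0.le (hg.comp_continuousOn (continuousOn_extPsi_sphere h0 h1))
  have hpt : ∀ c ∈ sphere (0 : ℂ) s, c ≠ c₀ → g (extPsi c) ≤ f c := by
    intro c hc hne
    refine (hle c hc hne).trans_eq ?_
    have hcb := sphere_subset_ball_one h1 hc
    have hc0 := ne_zero_of_mem_sphere_zero h0 hc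
    have hcs : ‖c‖ = s := by simpa using hc
    have e : extPsi c₀ - extPsi c = H c * (c - c₀) / c := by
      have h2 : _ = (c - c₀) * Q c := extParam_sub_eq c₀ c
      have h3 := extParam_eq c
      have h4 := hW0 c hcb
      have h5 := extParam_ne_zero hcb hc0
      have h6 : extPsi c₀ - extPsi c = (extParam c - extParam c₀) / (extParam c * extParam c₀) := by
        rw [extPsi, extPsi]
        field_simp
      rw [h6, h2, h3]
      simp only [hH]
      change _ / (c * W c * _) = _
      field_simp
    rw [dist_eq_norm, e, norm_div, norm_mul, Real.log_div _ (norm_ne_zero_iff.2 hc0),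
      Real.log_mul (norm_ne_zero_iff.2 (hHne c hcb)) (norm_ne_zero_iff.2 (sub_ne_zero.2 hne)), hcs]
    · simp only [hf]
      ring
    · exact mul_ne_zero (norm_ne_zero_iff.2 (hHne c hcb)) (norm_ne_zero_iff.2 (sub_ne_zero.2 hne))
  rw [← hfa, Real.circleAverage, Real.circleAverage]
  refine smul_le_smul_of_nonneg_left ?_ (inv_nonneg.2 Real.two_pi_pos.le)
  refine intervalIntegral.integral_mono_ae Real.two_pi_pos.le hgi hfi ?_
  have hcount : (circleMap 0 s ⁻¹' {c₀}).Countable :=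
    (countable_singleton c₀).preimage_circleMap 0 h0.ne'
  filter_upwards [hcount.ae_notMem volume] with t ht
  exact hpt _ (circleMap_mem_sphere 0 h0.le t) ht

/-- The push-forward to the parameter plane of the uniform measure on the circle `|c| = s`. -/
def equipotential (s : ℝ) : Measure ℂ :=
  Measure.map (fun t => extPsi (circleMap 0 s t))
    ((ENNReal.ofReal (2 * Real.pi))⁻¹ • volume.restrict (Ioc 0 (2 * Real.pi)))

theorem continuous_extPsi_circleMap {s : ℝ} (h0 : 0 < s) (h1 : s < 1) :
    Continuous fun t => extPsi (circleMap 0 s t) :=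
  (continuousOn_extPsi_sphere h0 h1).comp_continuous (continuous_circleMap 0 s)
    fun t => circleMap_mem_sphere 0 h0.le t

theorem isProbabilityMeasure_equipotential {s : ℝ} (h0 : 0 < s) (h1 : s < 1) :
    IsProbabilityMeasure (equipotential s) := by
  have : IsProbabilityMeasure
      ((ENNReal.ofReal (2 * Real.pi))⁻¹ • volume.restrict (Ioc 0 (2 * Real.pi))) := by
    constructor
    rw [Measure.smul_apply, Measure.restrict_apply_univ, Real.volume_Ioc, sub_zero, smul_eq_mul]
    exact ENNReal.inv_mul_cancel (ENNReal.ofReal_pos.2 Real.two_pi_pos).ne' ENNReal.ofReal_ne_top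
  exact Measure.isProbabilityMeasure_map (continuous_extPsi_circleMap h0 h1).aemeasurable

theorem isCompact_extPsi_sphere {s : ℝ} (h0 : 0 < s) (h1 : s < 1) :
    IsCompact (extPsi '' sphere 0 s) :=
  (isCompact_sphere 0 s).image_of_continuousOn (continuousOn_extPsi_sphere h0 h1)

theorem equipotential_compl {s : ℝ} (h0 : 0 < s) (h1 : s < 1) :
    equipotential s (extPsi '' sphere 0 s)ᶜ = 0 := by
  rw [equipotential, Measure.map_apply (continuous_extPsi_circleMap h0 h1).measurable
    (isCompact_extPsi_sphere h0 h1).measurableSet.compl]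
  refine measure_mono_null (t := ∅) (fun t ht => ht ?_) measure_empty
  exact ⟨_, circleMap_mem_sphere 0 h0.le t, rfl⟩

theorem integral_equipotential {s : ℝ} (h0 : 0 < s) (h1 : s < 1) {g : ℂ → ℝ} (hg : Continuous g) :
    ∫ w, g w ∂(equipotential s) = Real.circleAverage (fun c => g (extPsi c)) 0 s := by
  rw [equipotential, integral_map (continuous_extPsi_circleMap h0 h1).aemeasurable
    hg.aestronglyMeasurable, integral_smul_measure, Real.circleAverage,
    intervalIntegral.integral_of_le Real.two_pi_pos.le, ENNReal.toReal_inv,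
    ENNReal.toReal_ofReal Real.two_pi_pos.le]

theorem integral_prod_equipotential_le {s : ℝ} (h0 : 0 < s) (h1 : s < 1) {k : ℂ × ℂ → ℝ}
    (hk : Continuous k) (hle : ∀ z ∈ extPsi '' sphere 0 s, ∀ w ∈ extPsi '' sphere 0 s, z ≠ w →
      k (z, w) ≤ -Real.log (dist z w)) :
    ∫ p, k p ∂((equipotential s).prod (equipotential s)) ≤ Real.log s - Real.log 2 := by
  have := isProbabilityMeasure_equipotential h0 h1
  have hC := isCompact_extPsi_sphere h0 h1
  have hν := equipotential_compl h0 h1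
  have hint := integrable_prod_of_continuous hC hC hν hν hk
  rw [integral_prod k hint]
  have h2 : ∫ z, ∫ w, k (z, w) ∂(equipotential s) ∂(equipotential s) ≤
      ∫ _, (Real.log s - Real.log 2) ∂(equipotential s) := by
    refine integral_mono_ae hint.integral_prod_left (integrable_const _) ?_
    have hae : ∀ᵐ z ∂(equipotential s), z ∈ extPsi '' sphere 0 s := hν
    filter_upwards [hae] with z hz
    obtain ⟨c₀, hc₀, rfl⟩ := hz
    have hkc : Continuous fun w => k (extPsi c₀, w) := hk.comp (by fun_prop)
    rw [integral_equipotential h0 h1 hkc]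
    refine circleAverage_le_of_le_neg_log h0 h1 hc₀ hkc fun c hc hne => ?_
    refine hle _ ⟨c₀, hc₀, rfl⟩ _ ⟨c, hc, rfl⟩ fun he => hne ?_
    exact (injOn_extPsi (sphere_subset_ball_one h1 hc₀) (sphere_subset_ball_one h1 hc) he).symm
  simpa using h2

/-! ### The capacity of the complement of `P_∞` -/

/-- The mutual energy is the average of the constant potential of the level curve. Compactness
separates `C` from the curve by a δ uniform in θ, so the regularisation error vanishes as θ → 1. -/
theorem le_integral_regLog {μ : Measure ℂ} [IsProbabilityMeasure μ] {C : Set ℂ} (hC : IsCompact C)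
    (hCK : C ⊆ exteriorComponentᶜ) (hμ : μ Cᶜ = 0) {s : ℝ} (h0 : 0 < s) (h1 : s < 1) :
    ∃ δ : ℝ, 0 < δ ∧ ∀ θ : ℝ, 0 ≤ θ → θ < 1 → Real.log s - Real.log 2 - (1 - θ) / δ / 2 ≤
      ∫ p, regLog θ p ∂(μ.prod (equipotential s)) := by
  have := isProbabilityMeasure_equipotential h0 h1
  have hC' := isCompact_extPsi_sphere h0 h1
  have hν := equipotential_compl h0 h1
  have hP : ∀ c ∈ sphere (0 : ℂ) s, extPsi c ∈ exteriorComponent := fun c hc =>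
    extPsi_mem (sphere_subset_ball_one h1 hc) (ne_zero_of_mem_sphere_zero h0 hc)
  obtain ⟨δ, hδ, hδle⟩ := (hC.prod hC').exists_forall_le' (a := (0 : ℝ))
    (f := fun p : ℂ × ℂ => 1 - sphereKernel p.1 p.2)
    (continuous_const.sub continuous_sphereKernel).continuousOn (by
      rintro ⟨z, w⟩ ⟨hz, c, hc, rfl⟩
      have : z ≠ extPsi c := fun h => hCK hz (h ▸ hP c hc)
      linarith [sphereKernel_lt_one this])
  refine ⟨δ, hδ, fun θ hθ0 hθ1 => ?_⟩
  have hk := continuous_regLog hθ0 hθ1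
  have hint := integrable_prod_of_continuous hC hC' hμ hν hk
  rw [integral_prod _ hint]
  have h2 : ∫ _, (Real.log s - Real.log 2 - (1 - θ) / δ / 2) ∂μ ≤
      ∫ z, ∫ w, regLog θ (z, w) ∂(equipotential s) ∂μ := by
    refine integral_mono_ae (integrable_const _) hint.integral_prod_left ?_
    have hae : ∀ᵐ z ∂μ, z ∈ C := hμ
    filter_upwards [hae] with z hz
    have hkc : Continuous fun w => regLog θ (z, w) := hk.comp (by fun_prop)
    rw [integral_equipotential h0 h1 hkc]
    have hcont := continuousOn_extPsi_sphere h0 h1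
    have hne : ∀ c ∈ sphere (0 : ℂ) s, extPsi c ≠ z := fun c hc h => hCK hz (h ▸ hP c hc)
    have hi1 : CircleIntegrable (fun c => Real.log ‖extPsi c - z‖) 0 s :=
      ContinuousOn.circleIntegrable h0.le (ContinuousOn.log (hcont.sub continuousOn_const).norm
        fun c hc => norm_ne_zero_iff.2 (sub_ne_zero.2 (hne c hc)))
    have hi2 : CircleIntegrable (fun c => -(1 - θ) / δ / 2 - Real.log ‖extPsi c - z‖) 0 s :=
      (circleIntegrable_const _ _ _).sub hi1
    have hi3 : CircleIntegrable (fun c => regLog θ (z, extPsi c)) 0 s :=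
      ContinuousOn.circleIntegrable h0.le (hkc.comp_continuousOn hcont)
    have h3 : Real.log s - Real.log 2 - (1 - θ) / δ / 2 =
        Real.circleAverage (fun c => -(1 - θ) / δ / 2 - Real.log ‖extPsi c - z‖) 0 s := by
      rw [Real.circleAverage_fun_sub (circleIntegrable_const _ _ _) hi1,
        circleAverage_log_norm_extPsi_sub (hCK hz) h0 h1, Real.circleAverage_const]
      ring
    rw [h3]
    refine Real.circleAverage_mono hi2 hi3 fun c hc => ?_
    rw [abs_of_pos h0] at hc
    have h4 := hδle (z, extPsi c) ⟨hz, c, hc, rfl⟩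
    simp only at h4
    have h5 := le_regLog hθ1.le hδ (z := z) (w := extPsi c) (by linarith)
    rw [dist_comm, dist_eq_norm] at h5
    refine le_trans (le_of_eq ?_) h5
    ring
  simpa using h2

/-- Positive definiteness applied to μ and an equipotential measure gives I(μ) ≥ 2(log s - log 2) -
(log s - log 2) up to the regularisation error; then θ → 1, and afterwards s → 1. -/
theorem neg_log_two_le_logEnergy {μ : Measure ℂ} [IsProbabilityMeasure μ] {C : Set ℂ}
    (hC : IsCompact C) (hCK : C ⊆ exteriorComponentᶜ) (hμ : μ Cᶜ = 0) :
    ((-Real.log 2 : ℝ) : EReal) ≤ logEnergy μ := by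
  have key : ∀ s : ℝ, 0 < s → s < 1 → ((Real.log s - Real.log 2 : ℝ) : EReal) ≤ logEnergy μ := by
    intro s h0 h1
    have := isProbabilityMeasure_equipotential h0 h1
    have hC' := isCompact_extPsi_sphere h0 h1
    have hν := equipotential_compl h0 h1
    obtain ⟨δ, hδ, hle⟩ := le_integral_regLog hC hCK hμ h0 h1
    have h2 : ∀ θ : ℝ, 0 ≤ θ → θ < 1 →
        ((Real.log s - Real.log 2 - (1 - θ) / δ : ℝ) : EReal) ≤ logEnergy μ := by
      intro θ hθ0 hθ1
      have hk := continuous_regLog hθ0 hθ1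
      have e1 := hle θ hθ0 hθ1
      have e2 := integral_regLog_le hC hC' hμ hν hθ0 hθ1
      have e3 := integral_prod_equipotential_le h0 h1 hk fun z _ w _ hzw => regLog_le hθ1.le hzw
      have e4 : Real.log s - Real.log 2 - (1 - θ) / δ ≤ ∫ p, regLog θ p ∂(μ.prod μ) := by
        linarith
      refine le_trans (by exact_mod_cast e4) (integral_le_logEnergy hC hμ
        (integrable_prod_of_continuous hC hC hμ hμ hk) fun z _ w _ => ?_)
      rcases eq_or_ne z w with rfl | hzw
      · simp
      · rw [edist_dist, ENNReal.log_ofReal_of_pos (dist_pos.2 hzw)]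
        exact_mod_cast regLog_le hθ1.le hzw
    have hlim : Tendsto (fun θ : ℝ => ((Real.log s - Real.log 2 - (1 - θ) / δ : ℝ) : EReal))
        (𝓝[<] 1) (𝓝 ((Real.log s - Real.log 2 : ℝ) : EReal)) := by
      refine (continuous_coe_real_ereal.tendsto _).comp ?_
      have : Continuous fun θ : ℝ => Real.log s - Real.log 2 - (1 - θ) / δ := by fun_prop
      have := (this.tendsto 1).mono_left (nhdsWithin_le_nhds (s := Iio 1))
      simpa using this
    refine le_of_tendsto hlim ?_
    filter_upwards [Ico_mem_nhdsLT (zero_lt_one' ℝ)] with θ hθ using h2 θ hθ.1 hθ.2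
  have hlim : Tendsto (fun s : ℝ => ((Real.log s - Real.log 2 : ℝ) : EReal)) (𝓝[<] 1)
      (𝓝 ((-Real.log 2 : ℝ) : EReal)) := by
    refine (continuous_coe_real_ereal.tendsto _).comp ?_
    have := ((Real.continuousAt_log one_ne_zero).tendsto.sub_const (Real.log 2)).mono_left
      (nhdsWithin_le_nhds (s := Iio 1))
    simpa using this
  refine le_of_tendsto hlim ?_
  filter_upwards [Ioo_mem_nhdsLT (zero_lt_one' ℝ)] with s hs using key s hs.1 hs.2

theorem norm_extPsi_le {c : ℂ} (hc : c ∈ ball (0 : ℂ) 1) (h : 1 / 2 ≤ ‖c‖) : ‖extPsi c‖ ≤ 144 := by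
  by_contra! hlt
  have := norm_critCoord_le hlt.le
  rw [critCoord_extPsi hc, le_div_iff₀ (by linarith)] at this
  nlinarith

theorem compl_exteriorComponent_subset : exteriorComponentᶜ ⊆ closedBall (0 : ℂ) 144 := by
  intro a ha
  rw [mem_closedBall_zero_iff]
  by_contra! h
  exact ha (mem_exteriorComponent_of_large h.le)

theorem exists_logEnergy_le : ∃ μ : Measure ℂ, IsProbabilityMeasure μ ∧
    μ exteriorComponent = 0 ∧ logEnergy μ ≤ ((-Real.log 2 : ℝ) : EReal) := by
  set s : ℕ → ℝ := fun n => 1 - 1 / ((n : ℝ) + 2)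
  have hs1 : ∀ n, s n < 1 := fun n => by
    have : 0 < 1 / ((n : ℝ) + 2) := by positivity
    simp only [s]
    linarith
  have hs2 : ∀ n, 1 / 2 ≤ s n := fun n => by
    have : 1 / ((n : ℝ) + 2) ≤ 1 / 2 := one_div_le_one_div_of_le (by norm_num) (by
      linarith [(Nat.cast_nonneg n : (0 : ℝ) ≤ n)])
    simp only [s]
    linarith
  have hs0 : ∀ n, 0 < s n := fun n => by linarith [hs2 n]
  have hslim : Tendsto s atTop (𝓝 1) := by
    have : Tendsto (fun n : ℕ => (n : ℝ) + 2) atTop atTop :=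
      tendsto_atTop_add_const_right _ _ tendsto_natCast_atTop_atTop
    have := (this.const_div_atTop 1).const_sub 1
    simpa [s] using this
  set ν : ℕ → ProbabilityMeasure ℂ := fun n =>
    ⟨equipotential (s n), isProbabilityMeasure_equipotential (hs0 n) (hs1 n)⟩ with hνdef
  have hsupp : ∀ n, extPsi '' sphere 0 (s n) ⊆ closedBall 0 144 := by
    rintro n _ ⟨c, hc, rfl⟩
    have hcs : ‖c‖ = s n := by simpa using hc
    rw [mem_closedBall_zero_iff]
    exact norm_extPsi_le (sphere_subset_ball_one (hs1 n) hc) (hcs ▸ hs2 n)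
  have hcomp := isCompact_setOfPred_probabilityMeasure_mass_eq_compl_isCompact_le (E := ℂ)
    (u := fun _ => 0) (K := fun _ => closedBall 0 144) tendsto_const_nhds
    (fun _ => isCompact_closedBall _ _) (Or.inl inferInstance)
  have hmem : ∀ n, ν n ∈ {μ : ProbabilityMeasure ℂ | ∀ _ : ℕ, μ (closedBall 0 144)ᶜ ≤ 0} := by
    intro n _
    have h1 : (ν n : Measure ℂ) (closedBall 0 144)ᶜ = 0 :=
      measure_mono_null (compl_subset_compl.2 (hsupp n)) (equipotential_compl (hs0 n) (hs1 n))
    have h2 : (ν n) (closedBall 0 144)ᶜ = 0 := by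
      rw [ProbabilityMeasure.null_iff_toMeasure_null]
      exact h1
    exact h2.le
  -- All measures live in one closed ball, hence in a compact set of probability measures; an
  -- ultrafilter limit replaces the extraction of a subsequence.
  obtain ⟨μ, -, hμlim⟩ := hcomp.ultrafilter_le_nhds ((hyperfilter ℕ).map ν)
    (le_principal_iff.2 (Filter.mem_map.2 (Filter.univ_mem' hmem)))
  have hμlim : Tendsto ν (hyperfilter ℕ : Filter ℕ) (𝓝 μ) := hμlim
  have hslim' : Tendsto s (hyperfilter ℕ : Filter ℕ) (𝓝 1) :=
    hslim.mono_left Nat.hyperfilter_le_atTop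
  have hμP : (μ : Measure ℂ) exteriorComponent = 0 := by
    -- These open sets exhaust P_∞, and the curve carrying `ν n` is disjoint from `O m` once s n > s
    -- m, so the limit measure charges none of them.
    set O : ℕ → Set ℂ := fun m => extPsi '' (ball 0 (s m) \ {0})
    have hO : ∀ m, (μ : Measure ℂ) (O m) = 0 := by
      intro m
      have hsub : ball (0 : ℂ) (s m) \ {0} ⊆ ball 0 1 \ {0} :=
        sdiff_subset_sdiff_left (ball_subset_ball (hs1 m).le)
      have hopen : IsOpen (O m) := isOpen_image_of_injOn (isOpen_ball.sdiff isClosed_singleton)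
        (differentiableOn_extPsi.mono hsub) (injOn_extPsi.mono (hsub.trans sdiff_subset))
      have h1 := ProbabilityMeasure.le_liminf_measure_open_of_tendsto hμlim hopen
      have h2 : ∀ᶠ n in (hyperfilter ℕ : Filter ℕ), (ν n : Measure ℂ) (O m) = 0 := by
        filter_upwards [hslim'.eventually (lt_mem_nhds (hs1 m))] with n hn
        refine measure_mono_null ?_ (equipotential_compl (hs0 n) (hs1 n))
        rintro _ ⟨c, hc, rfl⟩ ⟨c', hc', he⟩
        have := injOn_extPsi (sphere_subset_ball_one (hs1 n) hc') (hsub hc).1 he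
        rw [this] at hc'
        have h3 : ‖c‖ = s n := by simpa using hc'
        have h4 := mem_ball_zero_iff.1 hc.1
        linarith
      have h3 : liminf (fun n => (ν n : Measure ℂ) (O m)) (hyperfilter ℕ : Filter ℕ) = 0 := by
        rw [liminf_congr h2]
        simp
      rw [h3] at h1
      exact le_antisymm h1 zero_le
    refine measure_mono_null (fun a ha => ?_) (measure_iUnion_null hO)
    obtain ⟨c, hc, hc0, rfl⟩ := exists_extPsi_eq ha
    obtain ⟨m, hm⟩ := (hslim.eventually (lt_mem_nhds (mem_ball_zero_iff.1 hc))).exists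
    exact mem_iUnion.2 ⟨m, c, ⟨mem_ball_zero_iff.2 hm, hc0⟩, rfl⟩
  refine ⟨μ, inferInstance, hμP, ?_⟩
  have hD : 0 ≤ Real.log 288 := Real.log_nonneg (by norm_num)
  have hdist : ∀ z ∈ closedBall (0 : ℂ) 144, ∀ w ∈ closedBall (0 : ℂ) 144,
      dist z w ≤ Real.exp (Real.log 288) := by
    intro z hz w hw
    rw [Real.exp_log (by norm_num), dist_eq_norm]
    have h1 := mem_closedBall_zero_iff.1 hz
    have h2 := mem_closedBall_zero_iff.1 hw
    linarith [norm_sub_le z w]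
  refine logEnergy_le (C := exteriorComponentᶜ) (by rwa [compl_compl]) hD
    (fun z hz w hw => hdist z (compl_exteriorComponent_subset hz) w
      (compl_exteriorComponent_subset hw)) fun n => ?_
  let f : BoundedContinuousFunction (ℂ × ℂ) ℝ := BoundedContinuousFunction.ofNormedAddCommGroup
    (clampLog (Real.log 288) n) (continuous_clampLog _ n) (Real.log 288 + n) fun p => by
      have h1 := neg_le_clampLog hD n p
      have h2 := clampLog_le (Real.log 288) n p
      have : (0 : ℝ) ≤ n := Nat.cast_nonneg n
      rw [Real.norm_eq_abs, abs_le]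
      constructor <;> linarith
  -- For a fixed truncation the kernel is bounded and continuous, so its integral passes to the weak
  -- limit; the truncation is removed afterwards by `logEnergy_le`.
  have hprod : Tendsto (fun m => (ν m).prod (ν m)) (hyperfilter ℕ : Filter ℕ) (𝓝 (μ.prod μ)) :=
    (ProbabilityMeasure.continuous_prod.tendsto (μ, μ)).comp (hμlim.prodMk_nhds hμlim)
  have hint := ProbabilityMeasure.tendsto_iff_forall_integral_tendsto.1 hprod f
  refine le_of_tendsto' hint fun m => ?_
  have h1 := integral_prod_equipotential_le (hs0 m) (hs1 m) (continuous_clampLog (Real.log 288) n)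
    fun z hz w hw hzw => clampLog_le_neg_log hzw (hdist z (hsupp m hz) w (hsupp m hw))
  have h2 : Real.log (s m) ≤ 0 := Real.log_nonpos (hs0 m).le (hs1 m).le
  refine le_trans (le_of_eq ?_) (h1.trans (show Real.log (s m) - Real.log 2 ≤ -Real.log 2 by linarith))
  rfl

theorem logCapacity_compl_exteriorComponent : logCapacity exteriorComponentᶜ = 2 := by
  have h2 : EReal.exp ((Real.log 2 : ℝ) : EReal) = 2 := by
    rw [EReal.exp_coe, Real.exp_log two_pos]
    norm_num
  apply le_antisymm
  · refine iSup₂_le fun μ hμ => ?_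
    obtain ⟨hp, C, hCK, hC, hμC⟩ := hμ
    have h := neg_log_two_le_logEnergy hC hCK hμC
    rw [← h2, EReal.exp_le_exp_iff]
    apply EReal.neg_le_of_neg_le
    exact_mod_cast h
  · obtain ⟨μ, hp, hμP, hle⟩ := exists_logEnergy_le
    refine le_trans ?_ (le_iSup₂ (f := fun (μ : Measure ℂ)
      (_ : μ ∈ {μ : Measure ℂ | IsProbabilityMeasure μ ∧
        ∃ C ⊆ exteriorComponentᶜ, IsCompact C ∧ μ Cᶜ = 0}) => EReal.exp (-logEnergy μ)) μ
      ⟨hp, exteriorComponentᶜ, subset_rfl, isCompact_compl_exteriorComponent, by rwa [compl_compl]⟩)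
    rw [← h2, EReal.exp_le_exp_iff]
    apply EReal.le_neg_of_le_neg
    exact_mod_cast hle

end BasilicaFamily

end

theorem mainTheorem10 :
    IsCompact (BasilicaFamily.exteriorComponentᶜ : Set ℂ) ∧
    IsSimplyConnected
      (insert OnePoint.infty ((fun a : ℂ => (a : OnePoint ℂ)) '' BasilicaFamily.exteriorComponent)) ∧
    BasilicaFamily.logCapacity (BasilicaFamily.exteriorComponentᶜ) = 2 ∧
    ∃ F : ℂ → ℂ,
      (∀ a ∈ BasilicaFamily.exteriorComponent, ∀ w : ℂ,
        BasilicaFamily.IsBottcherValue a (-a) w ↔ w = F a) ∧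
      DifferentiableOn ℂ F BasilicaFamily.exteriorComponent ∧
      Set.BijOn F BasilicaFamily.exteriorComponent {w : ℂ | 1 < ‖w‖} ∧
      Filter.Tendsto (fun a => F a / a) (Bornology.cobounded ℂ) (𝓝 (-1 / 2 : ℂ)) :=
  ⟨BasilicaFamily.isCompact_compl_exteriorComponent,
    BasilicaFamily.isSimplyConnected_insert_exteriorComponent,
    BasilicaFamily.logCapacity_compl_exteriorComponent,
    fun a => (BasilicaFamily.critCoord a)⁻¹,
    fun _ ha w => BasilicaFamily.isBottcherValue_iff ha w,
    BasilicaFamily.differentiableOn_inv_critCoord,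
    BasilicaFamily.bijOn_inv_critCoord,
    BasilicaFamily.tendsto_inv_critCoord_div⟩
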